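/- **Setting.** Let $b,d>0$, $-\xi<d$, $0<\underline k<\overline k$, $R>0$, and let $x_j=-b+jh$, $y_s=-b+sh$ $(0\le j,s\le N+1)$, $h=2b/(N+1)$, be a uniform grid in $[-b,b]^2$. A node is *interior* if $|x_j|,|y_s|<b$ and *lateral* otherwise. Semidiscrete functions are complex valued functions of $(x_j,y_s,z)$ or of $(x_j,y_s,z,k)$ with $z\in(-\xi,d)$, $k\in(\underline k,\overline k)$; $\Omega_h$ denotes the set of the points $(x_j,y_s,z)$. Put $$\|f\|^2_{H^{m,h}}=\sum_{j,s}\sum_{r=0}^m h^2\int_{-\xi}^d|\partial_z^rf|^2dz,\qquad \|f\|^2_{H^h_m}=\int_{\underline k}^{\overline k}\|f(\cdot,k)\|^2_{H^{m,h}}dk,$$ and let $\|c\|^2_{L_2^h}=\sum h^2\int_{-\xi}^d|c|^2dz$, the sum being over the interior nodes. A function *has boundary data* $(\phi_0,\phi_1)$ if $f=\phi_0$, $f_z=\phi_1$ at $z=-\xi$ at the interior nodes and $f=0$ at $z=d$ and at the lateral nodes. $H_0^{2,h}\subset H^{2,h}$ and $H^h_{0,2}\subset H^h_2$ are the subspaces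 with boundary data $(0,0)$ (for a.e. $k$), regarded as real Hilbert spaces; $B(R)=\{p\in H^h_{0,2}:\|p\|_{H_2^h}<R\}$. At interior nodes let $\Delta^hu=u_{zz}+u^h_{xx}+u^h_{yy}$ with the standard second differences and $\nabla^hu=(\partial^h_xu,\partial^h_yu,\partial_zu)$ with central differences; $a\cdot b=\sum a_mb_m$. For functions $V(\mathbf x)$, $q(\mathbf x,k)$ put $v(\cdot,k)=V-\int_k^{\overline k}q(\cdot,\kappa)\,d\kappa$ and $$L^h_V(q)=\Delta^hq+2k\,\nabla^hv\cdot\big(k\nabla^hq+\nabla^hv\big)+2i\,(kq_z+v_z).$$ The coefficient reconstructed from $(V,q)$ at a fixed $k\in[\underline k,\overline k]$ is $c=-(\Delta^hv+k^2\nabla^hv\cdot\nabla^hv)$ or, if $v$ is normalized by the incident wave $e^{ikz}$, $c=1-(\Delta^hv+k^2\nabla^hv\cdot\nabla^hv+2ikv_z)$; the theorem holds for each of the two formulas and each such $k$. **Exact solution.** $V_*\in H^{2,h}$ satisfies $\Delta^hV_*=0$ with boundary data $(\psi_{0*},\psi_{1*})$; $q_*\in H_2^h$ satisfies $L^h_{V_*}(q_*)=0$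 with boundary data $(\phi_{0*},\phi_{1*})$; $c_*$ is the coefficient given by $(V_*,q_*)$; $Q_*\in H^{2,h}$ and $F_*\in H_3^h$ have the boundary data $(\psi_{0*},\psi_{1*})$ and $(\phi_{0*},\phi_{1*})$; $p_*=q_*-F_*$. **Noisy data.** $Q\in H^{2,h}$ and $F\in H_3^h$ have boundary data $(\psi_0,\psi_1)$ and $(\phi_0,\phi_1)$, and $\|Q-Q_*\|_{H^{2,h}}<\delta$, $\|F-F_*\|_{H_3^h}<\delta$. For $\mu(\delta)=\ln\delta^{-1/(2(d+\xi))}$ let $V=W_{\min}+Q$, where $W_{\min}$ is the minimizer over $W\in H_0^{2,h}$ of $e^{2\mu d}\sum h^2\int_{-\xi}^d|\Delta^h(W+Q)|^2e^{-2\mu z}dz$ (sum over interior nodes). Let $$J_\lambda(p)=e^{2\lambda d}\sum h^2\int_{\underline k}^{\overline k}\!\int_{-\xi}^d|L^h_V(p+F)|^2e^{-2\lambda z}\,dz\,d\kappa,\qquad p\in H^h_{0,2}.$$ **Theorem 7.6.** There are numbers $\lambda_1>1$, $C_1,C_2>0$, $\gamma_0(\lambda)\in(0,1)$ and $\theta(\lambda,\gamma)\in(0,1)$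 for $0<\gamma<\gamma_0(\lambda)$, depending only on $\Omega_h,R,\underline k,\overline k$ and on upper bounds for $\|F_*\|_{H^h_3}$ and $\|V_*\|_{H^{2,h}}$ (and on $\lambda$, $\gamma$ where indicated), such that the following holds for all $\delta\in(0,e^{-4(d+\xi)\lambda_1})$ and all data as above with $p_*\in B(R)$. The minimizer $W_{\min}$ exists and is unique; $J_\lambda$ has a Fréchet derivative $J_\lambda'(p)\in H^h_{0,2}$ at every $p$, and for $\lambda\ge\lambda_1$ $$J_\lambda(p+r)-J_\lambda(p)-J_\lambda'(p)(r)\ge C_1\|r\|^2_{H_2^h}\qquad\text{for all }p,\,p+r\in\overline{B(R)}.$$ Let $\lambda=\lambda(\delta)=\ln\delta^{-1/(4(d+\xi))}$. Then $\lambda>\lambda_1$, the functional $J_\lambda$ has a unique minimizer $p_{\min}$ on $\overline{B(R)}$, and $$\|p_*-p_{\min}\|_{H_2^h}\le C_2\delta^{1/4},\qquad\|c_*-c_{\min}\|_{L_2^h}\le C_2\delta^{1/4},$$ where $c_{\min}$ is reconstructed from $(V,p_{\min}+F)$. Moreover, let $\gamma\in(0,\gamma_0(\lambda))$, $\theta=\theta(\lambda,\gamma)$,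 $p_0\in B(R)$ and $p_n=P_{\overline B}(p_{n-1}-\gamma J'_\lambda(p_{n-1}))$ with the projection $P_{\overline B}$ of $H^h_{0,2}$ onto $\overline{B(R)}$, and let $c_n$ be reconstructed from $(V,p_n+F)$. Then for $n=1,2,\dots$ $$\|p_{\min}-p_n\|_{H_2^h}\le\theta^n\|p_{\min}-p_0\|_{H_2^h},$$ $$\|p_*-p_n\|_{H_2^h}\le C_2\delta^{1/4}+\theta^n\|p_{\min}-p_0\|_{H_2^h},\qquad \|c_*-c_n\|_{L_2^h}\le C_2\delta^{1/4}+C_2\theta^n\|p_{\min}-p_0\|_{H_2^h}.$$ -/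

import Mathlib

open MeasureTheory

noncomputable section

namespace Convexification

/-- The geometry: the box `|x|, |y| < b`, `-ξ < z < d`, the interval `[kmin, kmax]` of wave numbers,
and a uniform grid in `(x, y)` with `N` interior nodes in each direction. -/
structure Config where
  b : ℝ
  ξ : ℝ
  d : ℝ
  kmin : ℝ
  kmax : ℝ
  N : ℕ
  b_pos : 0 < b
  d_pos : 0 < d
  ξ_lt : -ξ < d
  kmin_pos : 0 < kmin
  k_lt : kmin < kmax

namespace Config

variable (D : Config)

/-- The grid step: the nodes are `x_j = -b + j h`, `y_s = -b + s h`, `0 ≤ j, s ≤ N + 1`. -/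
def h : ℝ := 2 * D.b / (D.N + 1)

/-- Nodes of the closed square `|x|, |y| ≤ b`. -/
abbrev Node : Type := Fin (D.N + 2) × Fin (D.N + 2)

/-- Indices of the interior nodes `|x|, |y| < b`; `(j, s)` stands for the node `(j + 1, s + 1)`. -/
abbrev Inner : Type := Fin D.N × Fin D.N

variable {D}

/-- The node itself and its four neighbours. -/
def ctr (i : D.Inner) : D.Node := (i.1.succ.castSucc, i.2.succ.castSucc)
def xPlus (i : D.Inner) : D.Node := (i.1.succ.succ, i.2.succ.castSucc)
def xMinus (i : D.Inner) : D.Node := (i.1.castSucc.castSucc, i.2.succ.castSucc)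
def yPlus (i : D.Inner) : D.Node := (i.1.succ.castSucc, i.2.succ.succ)
def yMinus (i : D.Inner) : D.Node := (i.1.succ.castSucc, i.2.castSucc.castSucc)

/-- Nodes with `|x| = b` or `|y| = b`. -/
def IsLateral (n : D.Node) : Prop :=
  n.1 = 0 ∨ n.1 = Fin.last _ ∨ n.2 = 0 ∨ n.2 = Fin.last _

variable (D)

/-- Lebesgue measure on `(-ξ, d)`. -/
def zMeas : Measure ℝ := volume.restrict (Set.Ioo (-D.ξ) D.d)

/-- Lebesgue measure on the interval of wave numbers. -/
def kMeas : Measure ℝ := volume.restrict (Set.Ioo D.kmin D.kmax)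

/-- The one-point parameter space: functions without dependence on `k` are functions of `((), z)`. -/
def unitMeas : Measure Unit := Measure.dirac ()

instance : IsFiniteMeasure D.zMeas := by unfold zMeas; infer_instance
instance : IsFiniteMeasure D.kMeas := by unfold kMeas; infer_instance
instance : IsFiniteMeasure unitMeas := by unfold unitMeas; infer_instance

variable {K : Type} [MeasurableSpace K]

/-- The measure `h² dν(κ) dz`. -/
def cylMeas (ν : Measure K) : Measure (K × ℝ) :=
  ENNReal.ofReal (D.h ^ 2) • ν.prod D.zMeas

/-- Families `f (n, r)`, for a node `n` and `0 ≤ r ≤ m`, of elements of `L²`; the entry `(n, r)` is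
to be `∂_z^r f` at the node `n`. The norm is
`‖f‖² = ∑_n ∑_r h² ∫∫ |f (n, r)|² dz dν`. -/
abbrev Jet (m : ℕ) (ν : Measure K) : Type :=
  PiLp 2 (fun _ : D.Node × Fin (m + 1) => Lp ℂ 2 (D.cylMeas ν))

/-- For almost every `κ`, the function `f(κ, ·)` is absolutely continuous on `[-ξ, d]` (after a
change on a null set), has the derivative `g(κ, ·)` and takes the value `a κ` at the point `z₀`. -/
def HasTrace (ν : Measure K) (f g : K × ℝ → ℂ) (z₀ : ℝ) (a : K → ℂ) : Prop :=
  ∀ᵐ κ ∂ν, ∀ᵐ z ∂D.zMeas, f (κ, z) = a κ + ∫ t in z₀..z, g (κ, t)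

/-- `g` is the `z`-derivative of `f`. -/
def IsZDeriv (ν : Measure K) (f g : K × ℝ → ℂ) : Prop :=
  ∃ a : K → ℂ, D.HasTrace ν f g (-D.ξ) a

section Closure

variable {D} {ν : Measure K}

theorem h_pos : 0 < D.h := by
  have := D.b_pos
  unfold h
  positivity

theorem ae_slice {p : K × ℝ → Prop} (hp : ∀ᵐ w ∂D.cylMeas ν, p w) :
    ∀ᵐ κ ∂ν, ∀ᵐ z ∂D.zMeas, p (κ, z) := by
  have hc : ENNReal.ofReal (D.h ^ 2) ≠ 0 := by
    have := h_pos (D := D)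
    simpa using by positivity
  have h1 : ∀ᵐ w ∂ν.prod D.zMeas, p w := by
    rwa [cylMeas, Measure.ae_ennreal_smul_measure_iff hc] at hp
  exact Measure.ae_ae_of_ae_prod h1

theorem integrable_slice [IsFiniteMeasure ν] (f : Lp ℂ 2 (D.cylMeas ν)) :
    ∀ᵐ κ ∂ν, Integrable (fun z => f (κ, z)) D.zMeas := by
  have hc : ENNReal.ofReal (D.h ^ 2) ≠ 0 := by
    have := h_pos (D := D)
    simpa using by positivity
  have : IsFiniteMeasure (D.cylMeas ν) := by
    unfold cylMeas
    exact (ν.prod D.zMeas).smul_finite ENNReal.ofReal_ne_top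
  have h1 : Integrable f (D.cylMeas ν) := (Lp.memLp f).integrable (by norm_num)
  have h2 : Integrable f (ν.prod D.zMeas) :=
    (integrable_smul_measure hc ENNReal.ofReal_ne_top).1 h1
  exact h2.prod_right_ae

theorem restrict_le {z₀ z : ℝ} (h₀ : z₀ ∈ Set.Icc (-D.ξ) D.d) (hz : z ∈ Set.Ioo (-D.ξ) D.d) :
    volume.restrict (Set.uIoc z₀ z) ≤ D.zMeas := by
  rw [zMeas, restrict_Ioo_eq_restrict_Ioc]
  apply Measure.restrict_mono _ le_rfl
  intro t ht
  rw [Set.mem_uIoc] at ht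
  obtain ⟨a1, a2⟩ := h₀
  obtain ⟨b1, b2⟩ := hz
  rcases ht with ⟨c1, c2⟩ | ⟨c1, c2⟩ <;> constructor <;> linarith

theorem zMem : ∀ᵐ z ∂D.zMeas, z ∈ Set.Ioo (-D.ξ) D.d :=
  ae_restrict_mem measurableSet_Ioo

theorem HasTrace.zero (z₀ : ℝ) (h₀ : z₀ ∈ Set.Icc (-D.ξ) D.d) :
    D.HasTrace ν (0 : Lp ℂ 2 (D.cylMeas ν)) (0 : Lp ℂ 2 (D.cylMeas ν)) z₀ 0 := by
  have h1 := ae_slice (D := D) (ν := ν) (Lp.coeFn_zero ℂ 2 (D.cylMeas ν))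
  filter_upwards [h1] with κ h1
  filter_upwards [h1, zMem] with z h2 hz
  rw [h2]
  have : ∫ t in z₀..z, (0 : Lp ℂ 2 (D.cylMeas ν)) (κ, t) = ∫ t in z₀..z, (0 : ℂ) :=
    intervalIntegral.integral_congr_ae_restrict
      (ae_mono (restrict_le h₀ hz) h1)
  rw [this]
  simp

theorem HasTrace.add [IsFiniteMeasure ν] {f g f' g' : Lp ℂ 2 (D.cylMeas ν)} {z₀ : ℝ}
    (h₀ : z₀ ∈ Set.Icc (-D.ξ) D.d) {a a' : K → ℂ}
    (h1 : D.HasTrace ν f g z₀ a) (h2 : D.HasTrace ν f' g' z₀ a') :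
    D.HasTrace ν (f + f' : Lp ℂ 2 (D.cylMeas ν)) (g + g' : Lp ℂ 2 (D.cylMeas ν)) z₀ (a + a') := by
  filter_upwards [h1, h2, ae_slice (Lp.coeFn_add f f'), ae_slice (Lp.coeFn_add g g'),
    integrable_slice g, integrable_slice g'] with κ h1 h2 h3 h4 i1 i2
  filter_upwards [h1, h2, h3, zMem] with z h1 h2 h3 hz
  have e : ∫ t in z₀..z, (g + g' : Lp ℂ 2 (D.cylMeas ν)) (κ, t)
      = ∫ t in z₀..z, (g (κ, t) + g' (κ, t)) :=
    intervalIntegral.integral_congr_ae_restrict (ae_mono (restrict_le h₀ hz) h4)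
  rw [h3, e, intervalIntegral.integral_add, Pi.add_apply, h1, h2, Pi.add_apply]
  · ring
  · rw [intervalIntegrable_iff]
    exact i1.mono_measure (restrict_le h₀ hz)
  · rw [intervalIntegrable_iff]
    exact i2.mono_measure (restrict_le h₀ hz)

theorem HasTrace.smul {f g : Lp ℂ 2 (D.cylMeas ν)} {z₀ : ℝ}
    (h₀ : z₀ ∈ Set.Icc (-D.ξ) D.d) {a : K → ℂ} (c : ℝ)
    (h1 : D.HasTrace ν f g z₀ a) :
    D.HasTrace ν (c • f : Lp ℂ 2 (D.cylMeas ν)) (c • g : Lp ℂ 2 (D.cylMeas ν)) z₀ (c • a) := by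
  filter_upwards [h1, ae_slice (Lp.coeFn_smul c f), ae_slice (Lp.coeFn_smul c g)] with κ h1 h3 h4
  filter_upwards [h1, h3, zMem] with z h1 h3 hz
  have e : ∫ t in z₀..z, (c • g : Lp ℂ 2 (D.cylMeas ν)) (κ, t)
      = ∫ t in z₀..z, (c • g (κ, t)) :=
    intervalIntegral.integral_congr_ae_restrict (ae_mono (restrict_le h₀ hz) h4)
  rw [h3, e, intervalIntegral.integral_smul, Pi.smul_apply, h1, Pi.smul_apply, smul_add]

theorem left_mem : -D.ξ ∈ Set.Icc (-D.ξ) D.d := ⟨le_rfl, D.ξ_lt.le⟩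
theorem right_mem : D.d ∈ Set.Icc (-D.ξ) D.d := ⟨D.ξ_lt.le, le_rfl⟩

end Closure

/-- Semidiscrete functions with `z`-derivatives up to the order `m` in `L²`. With `ν = unitMeas` this
is `H^{m,h}(Ω_h)`, with `ν = kMeas` it is `H_m^h`. -/
def H (m : ℕ) (ν : Measure K) [IsFiniteMeasure ν] : Submodule ℝ (D.Jet m ν) where
  carrier := {f | ∀ n : D.Node, ∀ r : Fin m, D.IsZDeriv ν (f (n, r.castSucc)) (f (n, r.succ))}
  zero_mem' := fun _ _ => ⟨0, HasTrace.zero _ left_mem⟩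
  add_mem' := fun hf hg n r => by
    obtain ⟨a, ha⟩ := hf n r
    obtain ⟨a', ha'⟩ := hg n r
    exact ⟨a + a', HasTrace.add left_mem ha ha'⟩
  smul_mem' := fun c _ hf n r => by
    obtain ⟨a, ha⟩ := hf n r
    exact ⟨c • a, HasTrace.smul left_mem c ha⟩

variable {D}

/-- The boundary conditions `f = φ₀`, `f_z = φ₁` on `Γ = {|x|, |y| < b, z = -ξ}` and `f = 0` on the
rest of the boundary of the box, that is, at `z = d` and at the lateral nodes. -/
structure HasBC {ν : Measure K} (f : D.Jet 2 ν) (φ₀ φ₁ : D.Inner → K → ℂ) : Prop where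
  lateral : ∀ n : D.Node, IsLateral n → f (n, 0) = 0
  bottom : ∀ i : D.Inner, D.HasTrace ν (f (ctr i, 0)) (f (ctr i, 1)) (-D.ξ) (φ₀ i)
  bottom_z : ∀ i : D.Inner, D.HasTrace ν (f (ctr i, 1)) (f (ctr i, 2)) (-D.ξ) (φ₁ i)
  top : ∀ i : D.Inner, D.HasTrace ν (f (ctr i, 0)) (f (ctr i, 1)) D.d 0

variable (D)

/-- The subspace of functions with zero boundary data: `H_0^{2,h}(Ω_h)` for `ν = unitMeas` and
`H_{0,2}^h` for `ν = kMeas`. -/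
def H0 (ν : Measure K) [IsFiniteMeasure ν] : Submodule ℝ (D.Jet 2 ν) where
  carrier := {f | f ∈ D.H 2 ν ∧ HasBC f 0 0}
  zero_mem' := ⟨(D.H 2 ν).zero_mem, fun _ _ => rfl, fun _ => HasTrace.zero _ left_mem,
    fun _ => HasTrace.zero _ left_mem, fun _ => HasTrace.zero _ right_mem⟩
  add_mem' := fun {f g} hf hg => by
    refine ⟨(D.H 2 ν).add_mem hf.1 hg.1, fun n hn => ?_, fun i => ?_, fun i => ?_, fun i => ?_⟩
    · rw [PiLp.add_apply, hf.2.lateral n hn, hg.2.lateral n hn, add_zero]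
    · simpa using HasTrace.add left_mem (hf.2.bottom i) (hg.2.bottom i)
    · simpa using HasTrace.add left_mem (hf.2.bottom_z i) (hg.2.bottom_z i)
    · simpa using HasTrace.add right_mem (hf.2.top i) (hg.2.top i)
  smul_mem' := fun c f hf => by
    refine ⟨(D.H 2 ν).smul_mem c hf.1, fun n hn => ?_, fun i => ?_, fun i => ?_, fun i => ?_⟩
    · rw [PiLp.smul_apply, hf.2.lateral n hn, smul_zero]
    · simpa using HasTrace.smul left_mem c (hf.2.bottom i)
    · simpa using HasTrace.smul left_mem c (hf.2.bottom_z i)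
    · simpa using HasTrace.smul right_mem c (hf.2.top i)

variable {D}

/-- The inclusion of functions with three derivatives into those with two. -/
def trunc {ν : Measure K} (F : D.Jet 3 ν) : D.Jet 2 ν :=
  WithLp.toLp 2 fun p => F (p.1, p.2.castSucc)

/-- `Δ^h u = u_zz + u_xx^h + u_yy^h` at an interior node. -/
def lapH {ν : Measure K} (u : D.Jet 2 ν) (i : D.Inner) (w : K × ℝ) : ℂ :=
  u (ctr i, 2) w
    + (u (xMinus i, 0) w - 2 * u (ctr i, 0) w + u (xPlus i, 0) w) / (D.h : ℂ) ^ 2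
    + (u (yMinus i, 0) w - 2 * u (ctr i, 0) w + u (yPlus i, 0) w) / (D.h : ℂ) ^ 2

/-- `∇^h u = (∂_x^h u, ∂_y^h u, ∂_z u)` at an interior node. -/
def gradH {ν : Measure K} (u : D.Jet 2 ν) (i : D.Inner) (w : K × ℝ) : Fin 3 → ℂ :=
  ![(u (xPlus i, 0) w - u (xMinus i, 0) w) / (2 * (D.h : ℂ)),
    (u (yPlus i, 0) w - u (yMinus i, 0) w) / (2 * (D.h : ℂ)),
    u (ctr i, 1) w]

/-- `Δ^h v` for `v(·, k) = V - ∫_k^{kmax} q(·, κ) dκ`. -/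
def lapV (V : D.Jet 2 unitMeas) (q : D.Jet 2 D.kMeas) (i : D.Inner) (k z : ℝ) : ℂ :=
  lapH V i ((), z) - ∫ κ in k..D.kmax, lapH q i (κ, z)

/-- `∇^h v` for `v(·, k) = V - ∫_k^{kmax} q(·, κ) dκ`. -/
def gradV (V : D.Jet 2 unitMeas) (q : D.Jet 2 D.kMeas) (i : D.Inner) (k z : ℝ) : Fin 3 → ℂ :=
  fun m => gradH V i ((), z) m - ∫ κ in k..D.kmax, gradH q i (κ, z) m

/-- The integro-differential operator with the tail function `V`, at `w = (k, z)`: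
`L^h(q) = Δ^h q + 2k ∇^h v · (k ∇^h q + ∇^h v) + 2i (k q_z + v_z)`, `v = V - ∫_k^{kmax} q dκ`,
where `a · b = ∑ a_m b_m` without complex conjugation. -/
def Lh (V : D.Jet 2 unitMeas) (q : D.Jet 2 D.kMeas) (i : D.Inner) (w : ℝ × ℝ) : ℂ :=
  lapH q i w
    + 2 * (w.1 : ℂ) *
      (gradV V q i w.1 w.2 ⬝ᵥ ((w.1 : ℂ) • gradH q i w + gradV V q i w.1 w.2))
    + 2 * Complex.I * ((w.1 : ℂ) * gradH q i w 2 + gradV V q i w.1 w.2 2)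

/-- The Carleman weight function. -/
def cwf (lam z : ℝ) : ℝ := Real.exp (-2 * lam * z)

/-- `I_μ(W) = e^{2μd} ∑ h² ∫ |Δ^h (W + Q)|² φ_μ dz`. -/
def tailCost (Q : D.Jet 2 unitMeas) (mu : ℝ) (W : D.H0 unitMeas) : ℝ :=
  Real.exp (2 * mu * D.d) *
    ∑ i : D.Inner, ∫ w, ‖lapH ((W : D.Jet 2 unitMeas) + Q) i w‖ ^ 2 * cwf mu w.2
      ∂D.cylMeas unitMeas

/-- `J_λ(p) = e^{2λd} ∑ h² ∫∫ |L^h(p + F)|² φ_λ dz dκ`. -/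
def cost (V : D.Jet 2 unitMeas) (F : D.Jet 3 D.kMeas) (lam : ℝ) (p : D.H0 D.kMeas) : ℝ :=
  Real.exp (2 * lam * D.d) *
    ∑ i : D.Inner, ∫ w, ‖Lh V ((p : D.Jet 2 D.kMeas) + trunc F) i w‖ ^ 2 * cwf lam w.2
      ∂D.cylMeas D.kMeas

/-- `V` is an `H^{2,h}` solution of `Δ^h V = 0` with the Cauchy data `ψ₀, ψ₁` on `Γ` and zero data on
the rest of the boundary. -/
structure IsTail (V : D.Jet 2 unitMeas) (ψ₀ ψ₁ : D.Inner → Unit → ℂ) : Prop where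
  mem : V ∈ D.H 2 unitMeas
  bc : HasBC V ψ₀ ψ₁
  eq : ∀ i : D.Inner, ∀ᵐ w ∂D.cylMeas unitMeas, lapH V i w = 0

/-- `q` is an `H_2^h` solution of `L^h(q) = 0`, with the tail function `V`, with the Cauchy data
`φ₀, φ₁` on `Γ` and zero data on the rest of the boundary. -/
structure IsField (V : D.Jet 2 unitMeas) (q : D.Jet 2 D.kMeas) (φ₀ φ₁ : D.Inner → ℝ → ℂ) :
    Prop where
  mem : q ∈ D.H 2 D.kMeas
  bc : HasBC q φ₀ φ₁
  eq : ∀ i : D.Inner, ∀ᵐ w ∂D.cylMeas D.kMeas, Lh V q i w = 0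

/-- The two formulas for the coefficient in terms of `v`: for `v = k⁻² log u` with the total wave `u`,
and for `v = k⁻² log (u / e^{ikz})`. -/
inductive Rule where
  | total : Rule
  | ratio : Rule

/-- The coefficient computed from `v(·, k) = V - ∫_k^{kmax} q(·, κ) dκ`:
`c = -(Δ^h v + k² ∇^h v · ∇^h v)` or `c = 1 - (Δ^h v + k² ∇^h v · ∇^h v + 2ik v_z)`. -/
def coeff (V : D.Jet 2 unitMeas) (q : D.Jet 2 D.kMeas) (k : ℝ) (i : D.Inner) (z : ℝ) : Rule → ℂ
  | .total => -(lapV V q i k z + (k : ℂ) ^ 2 * (gradV V q i k z ⬝ᵥ gradV V q i k z))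
  | .ratio => 1 - (lapV V q i k z + (k : ℂ) ^ 2 * (gradV V q i k z ⬝ᵥ gradV V q i k z)
      + 2 * Complex.I * (k : ℂ) * gradV V q i k z 2)

/-- The norm of `L_2^h(Ω_h)`, `∞` if the function is not square integrable. -/
def l2h (c : D.Inner → ℝ → ℂ) : ENNReal :=
  (∑ i : D.Inner, ENNReal.ofReal (D.h ^ 2) * ∫⁻ z, ‖c i z‖ₑ ^ 2 ∂D.zMeas) ^ (1 / 2 : ℝ)

end Config

/-- `x` is the unique minimizer of `f` on `S`. -/
def IsUniqueMinOn {X : Type} (f : X → ℝ) (S : Set X) (x : X) : Prop :=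
  x ∈ S ∧ ∀ y ∈ S, y ≠ x → f x < f y

/-- `x` is the projection of `y` on `S`. -/
def IsProjection {X : Type} [NormedAddCommGroup X] (S : Set X) (y x : X) : Prop :=
  x ∈ S ∧ ∀ w ∈ S, ‖y - x‖ ≤ ‖y - w‖

end Convexification

end

/-!
Integration from the zero data at `z = -ξ` gains a factor of order `λ^{-1/2}` in the `L²` norm with
the Carleman weight `e^{2λ(d - z)}`. On a grid of fixed step size the difference operators in `x`
and `y` are bounded, so for large `λ` the term `u_zz` dominates all the other terms of the
linearized operator, and it controls the `H^{2,h}` norm.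

The map `(V, q) ↦ L^h_V(q)` is the sum of a linear and a quadratic one, and the second-order Taylor
remainder of `J_λ` on the ball is bounded below by the weighted norm of `r_zz`: `J_λ` is strongly
convex there. The same estimate for the Laplacian, with the weight `μ = 2λ`, shows that `V` differs
from `V_*` by `O(√δ)`. The weight costs at most the factor `e^{2λ(d + ξ)} = δ^{-1/2}`, hence
`J_λ(p_*) = O(√δ)`, and strong convexity gives the distance `O(δ^{1/4})` from `p_*` to the
minimizer. The remainder is also bounded above by a multiple of `‖r‖²`, so gradient projection with
a small step contracts towards the minimizer.
-/

noncomputable section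

namespace Convexification

open scoped ENNReal

section IntervalIntegral

variable {α E : Type*} [MeasurableSpace α] [NormedAddCommGroup E]

theorem sq_lintegral_mul_le (μ : Measure α) {f g : α → ℝ≥0∞} (hf : AEMeasurable f μ)
    (hg : AEMeasurable g μ) :
    (∫⁻ a, f a * g a ∂μ) ^ 2 ≤ (∫⁻ a, f a ^ 2 ∂μ) * ∫⁻ a, g a ^ 2 ∂μ := by
  have holder := ENNReal.lintegral_mul_le_Lp_mul_Lq μ Real.HolderConjugate.two_two hf hg
  simp only [Pi.mul_apply, ENNReal.rpow_two] at holder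
  calc (∫⁻ a, f a * g a ∂μ) ^ 2
      ≤ ((∫⁻ a, f a ^ 2 ∂μ) ^ (1 / 2 : ℝ) * (∫⁻ a, g a ^ 2 ∂μ) ^ (1 / 2 : ℝ)) ^ 2 := by gcongr
    _ = (∫⁻ a, f a ^ 2 ∂μ) * ∫⁻ a, g a ^ 2 ∂μ := by
      rw [mul_pow, ← ENNReal.rpow_two, ← ENNReal.rpow_two, ← ENNReal.rpow_mul, ← ENNReal.rpow_mul]
      norm_num

theorem enorm_add_sq_le (x y : E) : ‖x + y‖ₑ ^ 2 ≤ 2 * (‖x‖ₑ ^ 2 + ‖y‖ₑ ^ 2) := by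
  have h := ENNReal.rpow_add_le_mul_rpow_add_rpow ‖x‖ₑ ‖y‖ₑ one_le_two
  norm_num only [ENNReal.rpow_two, ENNReal.rpow_one] at h
  exact (pow_le_pow_left₀ zero_le (enorm_add_le x y) 2).trans h

theorem enorm_sq_eq_ofReal (x : E) : ‖x‖ₑ ^ 2 = ENNReal.ofReal (‖x‖ ^ 2) := by
  rw [← ofReal_norm, ENNReal.ofReal_pow (norm_nonneg x)]

variable [NormedSpace ℝ E]

theorem stronglyMeasurable_intervalIntegral {f : α × ℝ → E} (hf : StronglyMeasurable f)
    {a b : α → ℝ} (ha : Measurable a) (hb : Measurable b) :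
    StronglyMeasurable fun w => ∫ t in a w..b w, f (w, t) := by
  have integral_Ioc : ∀ {a b : α → ℝ}, Measurable a → Measurable b →
      StronglyMeasurable fun w => ∫ t in Set.Ioc (a w) (b w), f (w, t) := by
    intro a b ha hb
    have hs : MeasurableSet {p : α × ℝ | a p.1 < p.2 ∧ p.2 ≤ b p.1} :=
      (measurableSet_lt (ha.comp measurable_fst) measurable_snd).inter
        (measurableSet_le measurable_snd (hb.comp measurable_fst))
    convert (hf.indicator hs).integral_prod_right' (ν := (volume : Measure ℝ)) using 2 with w
    rw [← integral_indicator measurableSet_Ioc]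
    rfl
  simp only [intervalIntegral]
  exact (integral_Ioc ha hb).sub (integral_Ioc hb ha)

theorem enorm_intervalIntegral_le_lintegral_enorm (f : ℝ → E) (a b : ℝ) :
    ‖∫ t in a..b, f t‖ₑ ≤ ∫⁻ t in Set.uIoc a b, ‖f t‖ₑ := by
  rw [← ofReal_norm, intervalIntegral.norm_intervalIntegral_eq f a b volume, ofReal_norm]
  exact enorm_integral_le_lintegral_enorm _

theorem enorm_intervalIntegral_sq_le {a b s t : ℝ} (hs : s ∈ Set.Icc a b) (ht : t ∈ Set.Icc a b)
    {g : ℝ → E} (hg : AEStronglyMeasurable g (volume.restrict (Set.Ioo a b))) :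
    ‖∫ x in s..t, g x‖ₑ ^ 2 ≤ ENNReal.ofReal (b - a) * ∫⁻ x in Set.Ioo a b, ‖g x‖ₑ ^ 2 := by
  have hst : volume.restrict (Set.uIoc s t) ≤ volume.restrict (Set.Ioo a b) := by
    rw [restrict_Ioo_eq_restrict_Ioc]
    exact Measure.restrict_mono (Set.Ioc_subset_Ioc (le_inf hs.1 ht.1) (sup_le hs.2 ht.2)) le_rfl
  have h1 : ‖∫ x in s..t, g x‖ₑ ≤ ∫⁻ x in Set.Ioo a b, 1 * ‖g x‖ₑ := by
    simpa only [one_mul] using (enorm_intervalIntegral_le_lintegral_enorm g s t).trans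
      (lintegral_mono' hst le_rfl)
  calc ‖∫ x in s..t, g x‖ₑ ^ 2 ≤ (∫⁻ x in Set.Ioo a b, 1 * ‖g x‖ₑ) ^ 2 := by gcongr
    _ ≤ _ := sq_lintegral_mul_le _ (by fun_prop) hg.enorm
    _ = _ := by simp

theorem lintegral_exp_mul_sub_sq_le {lam : ℝ} (hl : 0 < lam) {a z : ℝ} (haz : a ≤ z) :
    ∫⁻ t in Set.Ioc a z, ENNReal.ofReal (Real.exp (lam * (t - z))) ^ 2
      ≤ ENNReal.ofReal (1 / (2 * lam)) := by
  have hsq : ∀ t, ENNReal.ofReal (Real.exp (lam * (t - z))) ^ 2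
      = ENNReal.ofReal (Real.exp (2 * lam * t + -(2 * lam * z))) := by
    intro t
    rw [← ENNReal.ofReal_pow (Real.exp_pos _).le, ← Real.exp_nat_mul]
    congr 2
    push_cast
    ring
  have hi : IntervalIntegrable (fun t => Real.exp (2 * lam * t + -(2 * lam * z))) volume a z :=
    Continuous.intervalIntegrable (by fun_prop) _ _
  simp_rw [hsq]
  rw [← ofReal_integral_eq_lintegral_ofReal
    ((intervalIntegrable_iff_integrableOn_Ioc_of_le haz).1 hi)
    (Filter.Eventually.of_forall fun t => (Real.exp_pos _).le),
    ← intervalIntegral.integral_of_le haz,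
    intervalIntegral.integral_comp_mul_add Real.exp (by positivity), integral_exp, smul_eq_mul,
    add_neg_cancel, Real.exp_zero, inv_eq_one_div]
  have := Real.exp_pos (2 * lam * a + -(2 * lam * z))
  have : 0 < 1 / (2 * lam) := by positivity
  exact ENNReal.ofReal_le_ofReal (by nlinarith)

-- The kernel `e^{λ (t - z)}` of the conjugated integral has `L²` norm at most `(2λ)^{-1/2}`.
theorem enorm_exp_smul_intervalIntegral_sq_le {lam : ℝ} (hl : 0 < lam) (c : ℝ) {a z : ℝ}
    (haz : a ≤ z) {g : ℝ → E} (hg : AEStronglyMeasurable g (volume.restrict (Set.Ioc a z))) :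
    ‖Real.exp (lam * (c - z)) • ∫ t in a..z, g t‖ₑ ^ 2
      ≤ ENNReal.ofReal (1 / (2 * lam)) *
        ∫⁻ t in Set.Ioc a z, ‖Real.exp (lam * (c - t)) • g t‖ₑ ^ 2 := by
  have hkernel : ∀ t, Real.exp (lam * (c - z)) • g t
      = Real.exp (lam * (t - z)) • Real.exp (lam * (c - t)) • g t := by
    intro t
    rw [smul_smul, ← Real.exp_add]
    ring_nf
  have h1 : ‖Real.exp (lam * (c - z)) • ∫ t in a..z, g t‖ₑ
      ≤ ∫⁻ t in Set.Ioc a z,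
        ENNReal.ofReal (Real.exp (lam * (t - z))) * ‖Real.exp (lam * (c - t)) • g t‖ₑ := by
    rw [← intervalIntegral.integral_smul]
    refine (enorm_intervalIntegral_le_lintegral_enorm _ _ _).trans_eq ?_
    simp_rw [Set.uIoc_of_le haz, hkernel, enorm_smul, Real.enorm_eq_ofReal (Real.exp_pos _).le]
  have hm : AEStronglyMeasurable (fun t => Real.exp (lam * (c - t)) • g t)
      (volume.restrict (Set.Ioc a z)) :=
    (Continuous.aestronglyMeasurable (by fun_prop)).smul hg
  calc _ ≤ (∫⁻ t in Set.Ioc a z,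
        ENNReal.ofReal (Real.exp (lam * (t - z))) * ‖Real.exp (lam * (c - t)) • g t‖ₑ) ^ 2 := by
        gcongr
    _ ≤ _ := sq_lintegral_mul_le _ (by fun_prop) hm.enorm
    _ ≤ _ := by gcongr; exact lintegral_exp_mul_sub_sq_le hl haz

theorem ae_eq_zero_of_primitive_ae_eq_const [CompleteSpace E] {a b : ℝ} {g : ℝ → E} {c : E}
    (hg : IntegrableOn g (Set.Ioo a b))
    (h : ∀ᵐ z ∂volume.restrict (Set.Ioo a b), ∫ t in a..z, g t = c) :
    ∀ᵐ z ∂volume.restrict (Set.Ioo a b), g z = 0 := by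
  rcases le_or_gt b a with hba | hab
  · simp [Set.Ioo_eq_empty_of_le hba]
  have hgi : IntervalIntegrable g volume a b :=
    (intervalIntegrable_iff_integrableOn_Ioo_of_le hab.le).2 hg
  have hsub : Set.Ioo a b ⊆ Set.uIcc a b := Set.uIcc_of_le hab.le ▸ Set.Ioo_subset_Icc_self
  have hcont : ContinuousOn (fun z => ∫ t in a..z, g t) (Set.Ioo a b) :=
    (intervalIntegral.continuousOn_primitive_interval' hgi Set.left_mem_uIcc).mono hsub
  have hconst : Set.EqOn (fun z => ∫ t in a..z, g t) (fun _ => c) (Set.Ioo a b) :=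
    Measure.eqOn_open_of_ae_eq h isOpen_Ioo hcont continuousOn_const
  filter_upwards [ae_restrict_of_ae hgi.ae_hasDerivAt_integral, ae_restrict_mem measurableSet_Ioo]
    with z hz hzm
  have hderiv : HasDerivAt (fun _ : ℝ => c) (g z) z :=
    (hz (hsub hzm) a Set.left_mem_uIcc).congr_of_eventuallyEq <| by
      filter_upwards [isOpen_Ioo.mem_nhds hzm] with y hy using (hconst hy).symm
  exact hderiv.unique (hasDerivAt_const z c)

theorem enorm_sq_mul_le_of_ae_eq_primitive {a b : ℝ} {f g : ℝ → E} {c : E}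
    (hg : IntegrableOn g (Set.Ioo a b))
    (h : ∀ᵐ z ∂volume.restrict (Set.Ioo a b), f z = c + ∫ t in a..z, g t) :
    ∀ᵐ z ∂volume.restrict (Set.Ioo a b), ‖f z‖ₑ ^ 2 * ENNReal.ofReal (b - a)
      ≤ 2 * (∫⁻ t in Set.Ioo a b, ‖f t‖ₑ ^ 2)
        + 2 * (ENNReal.ofReal (b - a) * ∫⁻ t in Set.Ioo a b, ‖g t‖ₑ ^ 2)
          * ENNReal.ofReal (b - a) := by
  have hi : ∀ z ∈ Set.Ioo a b, IntervalIntegrable g volume a z := fun z hz =>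
    (intervalIntegrable_iff_integrableOn_Ioo_of_le hz.1.le).2
      (hg.mono_set (Set.Ioo_subset_Ioo_right hz.2.le))
  filter_upwards [h, ae_restrict_mem measurableSet_Ioo] with z hz hzm
  have hpt : ∀ᵐ t ∂volume.restrict (Set.Ioo a b), ‖f z‖ₑ ^ 2
      ≤ 2 * ‖f t‖ₑ ^ 2 + 2 * (ENNReal.ofReal (b - a) * ∫⁻ t in Set.Ioo a b, ‖g t‖ₑ ^ 2) := by
    filter_upwards [h, ae_restrict_mem measurableSet_Ioo] with t ht htm
    have hzt : f z = f t + ∫ s in t..z, g s := by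
      rw [hz, ht, add_assoc, intervalIntegral.integral_add_adjacent_intervals (hi t htm)
        ((hi t htm).symm.trans (hi z hzm))]
    rw [hzt, ← mul_add]
    refine (enorm_add_sq_le _ _).trans ?_
    gcongr
    exact enorm_intervalIntegral_sq_le (Set.Ioo_subset_Icc_self htm) (Set.Ioo_subset_Icc_self hzm)
      hg.aestronglyMeasurable
  have hint := lintegral_mono_ae hpt
  rwa [lintegral_add_right _ measurable_const, lintegral_const_mul' _ _ ENNReal.ofNat_ne_top,
    lintegral_const, lintegral_const, Measure.restrict_apply_univ, Real.volume_Ioo] at hint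

theorem enorm_sq_le_of_ae_eq_primitive {a b : ℝ} {f g : ℝ → E} {c : E}
    (hg : IntegrableOn g (Set.Ioo a b))
    (h : ∀ᵐ z ∂volume.restrict (Set.Ioo a b), f z = c + ∫ t in a..z, g t) :
    ∀ᵐ z ∂volume.restrict (Set.Ioo a b), ‖f z‖ₑ ^ 2
      ≤ ENNReal.ofReal (2 / (b - a)) * (∫⁻ t in Set.Ioo a b, ‖f t‖ₑ ^ 2)
        + ENNReal.ofReal (2 * (b - a)) * ∫⁻ t in Set.Ioo a b, ‖g t‖ₑ ^ 2 := by
  filter_upwards [enorm_sq_mul_le_of_ae_eq_primitive hg h, ae_restrict_mem measurableSet_Ioo]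
    with z hz hzm
  have hab : 0 < b - a := sub_pos.2 (hzm.1.trans hzm.2)
  have hl0 : ENNReal.ofReal (b - a) ≠ 0 := (ENNReal.ofReal_pos.2 hab).ne'
  rw [← ENNReal.le_div_iff_mul_le (.inl hl0) (.inl ENNReal.ofReal_ne_top), ENNReal.add_div,
    ENNReal.mul_div_cancel_right hl0 ENNReal.ofReal_ne_top] at hz
  rw [ENNReal.ofReal_div_of_pos hab, ENNReal.ofReal_mul zero_le_two, ENNReal.ofReal_ofNat]
  refine hz.trans_eq ?_
  rw [mul_assoc, ENNReal.mul_div_right_comm]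

end IntervalIntegral

section Norms

variable {E F G : Type*} [NormedAddCommGroup E] [NormedAddCommGroup F] [NormedAddCommGroup G]

theorem norm_le_sqrt_mul_add_of_enorm_sq_le {x : E} {y : F} {z : G} {c c' : ℝ} (hc : 0 ≤ c)
    (hc' : 0 ≤ c') (h : ‖x‖ₑ ^ 2 ≤ ENNReal.ofReal c * ‖y‖ₑ ^ 2 + ENNReal.ofReal c' * ‖z‖ₑ ^ 2) :
    ‖x‖ ≤ √c * ‖y‖ + √c' * ‖z‖ := by
  rw [enorm_sq_eq_ofReal, enorm_sq_eq_ofReal, enorm_sq_eq_ofReal, ← ENNReal.ofReal_mul hc,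
    ← ENNReal.ofReal_mul hc', ← ENNReal.ofReal_add (by positivity) (by positivity),
    ENNReal.ofReal_le_ofReal_iff (by positivity)] at h
  refine le_of_sq_le_sq ?_ (by positivity)
  have : 0 ≤ (√c * ‖y‖) * (√c' * ‖z‖) := by positivity
  rw [add_sq, mul_pow, mul_pow, Real.sq_sqrt hc, Real.sq_sqrt hc']
  linarith

theorem norm_le_sqrt_mul_of_enorm_sq_le {x : E} {y : F} {c : ℝ} (hc : 0 ≤ c)
    (h : ‖x‖ₑ ^ 2 ≤ ENNReal.ofReal c * ‖y‖ₑ ^ 2) : ‖x‖ ≤ √c * ‖y‖ := by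
  simpa using norm_le_sqrt_mul_add_of_enorm_sq_le (z := (0 : E)) hc le_rfl (by simpa using h)

end Norms

section Lp

variable {α E : Type*} [MeasurableSpace α] {μ : Measure α} [NormedAddCommGroup E]

theorem enorm_sq_eq_lintegral_enorm_sq (f : Lp E 2 μ) : ‖f‖ₑ ^ 2 = ∫⁻ x, ‖f x‖ₑ ^ 2 ∂μ := by
  rw [Lp.enorm_def, eLpNorm_eq_lintegral_rpow_enorm_toReal (by norm_num) (by norm_num),
    ← ENNReal.rpow_natCast, ← ENNReal.rpow_mul]
  norm_num

theorem measurable_enorm_sq {p : ℝ≥0∞} (f : Lp E p μ) : Measurable fun x => ‖f x‖ₑ ^ 2 :=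
  (Lp.stronglyMeasurable f).enorm.pow_const 2

theorem memLp_two_of_lintegral_enorm_sq_lt_top {f : α → E} (hf : AEStronglyMeasurable f μ)
    (h : ∫⁻ x, ‖f x‖ₑ ^ 2 ∂μ < ∞) : MemLp f 2 μ := by
  refine ⟨hf, ?_⟩
  rw [eLpNorm_lt_top_iff_lintegral_rpow_enorm_lt_top (by norm_num) (by norm_num)]
  simpa using h

theorem norm_Lp_top_le {f : Lp E ∞ μ} {C : ℝ} (hC : 0 ≤ C) (h : ∀ᵐ x ∂μ, ‖f x‖ ≤ C) :
    ‖f‖ ≤ C := by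
  rw [Lp.norm_def, eLpNorm_exponent_top]
  exact ENNReal.toReal_le_of_le_ofReal hC (eLpNormEssSup_le_of_ae_bound h)

theorem norm_toLp_top_le {f : α → E} (hf : MemLp f ∞ μ) {C : ℝ} (hC : 0 ≤ C)
    (h : ∀ᵐ x ∂μ, ‖f x‖ ≤ C) : ‖hf.toLp f‖ ≤ C := by
  refine norm_Lp_top_le hC ?_
  filter_upwards [h, hf.coeFn_toLp] with x hx hfx
  rwa [hfx]

variable {A : Type*} [NormedCommRing A] [NormedAlgebra ℝ A] {q : ℝ≥0∞} [Fact (1 ≤ q)]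

/-- Multiplication of a function in `L^q` by a bounded function, as a bilinear operator. -/
def mulLp (μ : Measure α) (q : ℝ≥0∞) [Fact (1 ≤ q)] : Lp A ∞ μ →L[ℝ] Lp A q μ →L[ℝ] Lp A q μ :=
  (ContinuousLinearMap.mul ℝ A).holderL μ ∞ q q

theorem coeFn_mulLp (f : Lp A ∞ μ) (g : Lp A q μ) : mulLp μ q f g =ᵐ[μ] fun x => f x * g x :=
  (ContinuousLinearMap.mul ℝ A).coeFn_holder f g

theorem norm_mulLp_le (f : Lp A ∞ μ) (g : Lp A q μ) : ‖mulLp μ q f g‖ ≤ ‖f‖ * ‖g‖ := by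
  refine ((ContinuousLinearMap.mul ℝ A).norm_holder_apply_apply_le f g).trans ?_
  rw [mul_assoc]
  exact mul_le_of_le_one_left (by positivity) (ContinuousLinearMap.opNorm_mul_le ℝ A)

theorem mulLp_mulLp (f g : Lp A ∞ μ) (u : Lp A q μ) :
    mulLp μ q f (mulLp μ q g u) = mulLp μ q (mulLp μ ∞ f g) u := by
  rw [Lp.ext_iff]
  filter_upwards [coeFn_mulLp f (mulLp μ q g u), coeFn_mulLp g u,
    coeFn_mulLp (mulLp μ ∞ f g) u, coeFn_mulLp f g] with x h1 h2 h3 h4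
  rw [h1, h2, h3, h4, mul_assoc]

theorem mulLp_comm (f g : Lp A ∞ μ) (u : Lp A q μ) :
    mulLp μ q f (mulLp μ q g u) = mulLp μ q g (mulLp μ q f u) := by
  rw [Lp.ext_iff]
  filter_upwards [coeFn_mulLp f (mulLp μ q g u), coeFn_mulLp g u,
    coeFn_mulLp g (mulLp μ q f u), coeFn_mulLp f u] with x h1 h2 h3 h4
  rw [h1, h2, h3, h4, mul_left_comm]

end Lp

namespace Config

variable {D : Config} {K : Type} [MeasurableSpace K] {ν : Measure K}

/-- The length of the interval `(-ξ, d)`. -/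
def len (D : Config) : ℝ := D.d + D.ξ

theorem len_pos : 0 < D.len := by
  have := D.ξ_lt
  unfold len
  linarith

theorem zMeas_univ : D.zMeas Set.univ = ENNReal.ofReal D.len := by
  simp [zMeas, len, sub_neg_eq_add]

theorem h_sq_ne_zero : ENNReal.ofReal (D.h ^ 2) ≠ 0 := by
  have := h_pos (D := D)
  simpa using by positivity

instance [IsFiniteMeasure ν] : IsFiniteMeasure (D.cylMeas ν) := by
  unfold cylMeas
  exact (ν.prod D.zMeas).smul_finite ENNReal.ofReal_ne_top

theorem ae_cylMeas_iff {p : K × ℝ → Prop} :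
    (∀ᵐ w ∂D.cylMeas ν, p w) ↔ ∀ᵐ w ∂ν.prod D.zMeas, p w := by
  rw [cylMeas, Measure.ae_ennreal_smul_measure_iff h_sq_ne_zero]

theorem ae_cylMeas_of_ae_ae {p : K × ℝ → Prop} (hm : MeasurableSet {w | p w})
    (h : ∀ᵐ κ ∂ν, ∀ᵐ z ∂D.zMeas, p (κ, z)) : ∀ᵐ w ∂D.cylMeas ν, p w :=
  ae_cylMeas_iff.2 ((Measure.ae_prod_iff_ae_ae hm).2 h)

theorem ae_slice_swap [SFinite ν] {p : K × ℝ → Prop} (hp : ∀ᵐ w ∂D.cylMeas ν, p w) :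
    ∀ᵐ z ∂D.zMeas, ∀ᵐ κ ∂ν, p (κ, z) := by
  have h1 := ae_cylMeas_iff.1 hp
  rw [← Measure.prod_swap] at h1
  exact Measure.ae_ae_of_ae_prod (ae_of_ae_map measurable_swap.aemeasurable h1)

theorem ae_cylMeas_of_ae_snd [SFinite ν] {p : ℝ → Prop} (h : ∀ᵐ z ∂D.zMeas, p z) :
    ∀ᵐ w ∂D.cylMeas ν, p w.2 := by
  rw [ae_cylMeas_iff]
  exact Measure.quasiMeasurePreserving_snd.ae h

theorem ae_cylMeas_of_ae_fst [SFinite ν] {p : K → Prop} (h : ∀ᵐ κ ∂ν, p κ) :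
    ∀ᵐ w ∂D.cylMeas ν, p w.1 := by
  rw [ae_cylMeas_iff]
  exact Measure.quasiMeasurePreserving_fst.ae h

theorem lintegral_cylMeas [SFinite ν] {f : K × ℝ → ℝ≥0∞} (hf : Measurable f) :
    ∫⁻ w, f w ∂D.cylMeas ν
      = ENNReal.ofReal (D.h ^ 2) * ∫⁻ κ, ∫⁻ z, f (κ, z) ∂D.zMeas ∂ν := by
  rw [cylMeas, lintegral_smul_measure, lintegral_prod _ hf.aemeasurable, smul_eq_mul]

theorem enorm_sq_eq [SFinite ν] (f : Lp ℂ 2 (D.cylMeas ν)) :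
    ‖f‖ₑ ^ 2 = ENNReal.ofReal (D.h ^ 2) * ∫⁻ κ, ∫⁻ z, ‖f (κ, z)‖ₑ ^ 2 ∂D.zMeas ∂ν := by
  rw [enorm_sq_eq_lintegral_enorm_sq, lintegral_cylMeas (measurable_enorm_sq f)]

theorem lintegral_lintegral_eq [SFinite ν] (f : Lp ℂ 2 (D.cylMeas ν)) :
    ∫⁻ κ, ∫⁻ z, ‖f (κ, z)‖ₑ ^ 2 ∂D.zMeas ∂ν = (ENNReal.ofReal (D.h ^ 2))⁻¹ * ‖f‖ₑ ^ 2 := by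
  rw [enorm_sq_eq, ← mul_assoc, ENNReal.inv_mul_cancel h_sq_ne_zero ENNReal.ofReal_ne_top,
    one_mul]

theorem measurable_slice_lintegral (f : Lp ℂ 2 (D.cylMeas ν)) :
    Measurable fun κ => ∫⁻ z, ‖f (κ, z)‖ₑ ^ 2 ∂D.zMeas :=
  (measurable_enorm_sq f).lintegral_prod_right'

theorem stronglyMeasurable_slice (f : Lp ℂ 2 (D.cylMeas ν)) (κ : K) :
    StronglyMeasurable fun z => f (κ, z) :=
  (Lp.stronglyMeasurable f).comp_measurable measurable_prodMk_left

theorem stronglyMeasurable_slice_swap (f : Lp ℂ 2 (D.cylMeas ν)) (z : ℝ) :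
    StronglyMeasurable fun κ => f (κ, z) :=
  (Lp.stronglyMeasurable f).comp_measurable measurable_prodMk_right

/-- The factor `e^{λ (d - z)}`, the square root of `e^{2λd} e^{-2λz}`. -/
def weight (D : Config) (lam : ℝ) (z : ℝ) : ℂ := (Real.exp (lam * (D.d - z)) : ℝ)

theorem measurable_weight (lam : ℝ) : Measurable (D.weight lam) := by
  unfold weight
  fun_prop

theorem norm_weight (lam z : ℝ) : ‖D.weight lam z‖ = Real.exp (lam * (D.d - z)) := by
  rw [weight, Complex.norm_real, Real.norm_eq_abs, abs_of_pos (Real.exp_pos _)]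

theorem norm_weight_le (lam : ℝ) {z : ℝ} (hz : z ∈ Set.Ioo (-D.ξ) D.d) :
    ‖D.weight lam z‖ ≤ Real.exp (|lam| * D.len) := by
  rw [norm_weight, Real.exp_le_exp]
  have h1 : 0 ≤ D.d - z := by linarith [hz.2]
  have h2 : D.d - z ≤ D.len := by unfold len; linarith [hz.1]
  calc lam * (D.d - z) ≤ |lam| * (D.d - z) := mul_le_mul_of_nonneg_right (le_abs_self _) h1
    _ ≤ _ := mul_le_mul_of_nonneg_left h2 (abs_nonneg _)

theorem one_le_norm_weight {lam : ℝ} (hl : 0 ≤ lam) {z : ℝ} (hz : z ∈ Set.Ioo (-D.ξ) D.d) :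
    1 ≤ ‖D.weight lam z‖ := by
  rw [norm_weight]
  exact Real.one_le_exp (mul_nonneg hl (by linarith [hz.2]))

theorem stronglyMeasurable_volterra (z₀ : ℝ) (g : Lp ℂ 2 (D.cylMeas ν)) :
    StronglyMeasurable fun w : K × ℝ => ∫ t in z₀..w.2, g (w.1, t) :=
  stronglyMeasurable_intervalIntegral
    (f := fun p : (K × ℝ) × ℝ => g (p.1.1, p.2))
    ((Lp.stronglyMeasurable g).comp_measurable (by fun_prop)) measurable_const measurable_snd

theorem enorm_integral_z_sq_le {g : ℝ → ℂ} (hg : AEStronglyMeasurable g D.zMeas) {z₀ z : ℝ}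
    (h₀ : z₀ ∈ Set.Icc (-D.ξ) D.d) (hz : z ∈ Set.Ioo (-D.ξ) D.d) :
    ‖∫ t in z₀..z, g t‖ₑ ^ 2 ≤ ENNReal.ofReal D.len * ∫⁻ t, ‖g t‖ₑ ^ 2 ∂D.zMeas := by
  have h := enorm_intervalIntegral_sq_le h₀ (Set.Ioo_subset_Icc_self hz) hg
  rwa [sub_neg_eq_add] at h

theorem lintegral_volterra_le [SFinite ν] {z₀ : ℝ} (h₀ : z₀ ∈ Set.Icc (-D.ξ) D.d)
    (g : Lp ℂ 2 (D.cylMeas ν)) :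
    ∫⁻ w, ‖∫ t in z₀..w.2, g (w.1, t)‖ₑ ^ 2 ∂D.cylMeas ν ≤ (ENNReal.ofReal D.len * ‖g‖ₑ) ^ 2 := by
  rw [lintegral_cylMeas ((stronglyMeasurable_volterra z₀ g).enorm.pow_const 2)]
  calc ENNReal.ofReal (D.h ^ 2) * ∫⁻ κ, ∫⁻ z, ‖∫ t in z₀..z, g (κ, t)‖ₑ ^ 2 ∂D.zMeas ∂ν
      ≤ ENNReal.ofReal (D.h ^ 2) * ∫⁻ κ, ∫⁻ _, ENNReal.ofReal D.len *
        ∫⁻ t, ‖g (κ, t)‖ₑ ^ 2 ∂D.zMeas ∂D.zMeas ∂ν := by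
        refine mul_le_mul' le_rfl (lintegral_mono fun κ => lintegral_mono_ae ?_)
        filter_upwards [zMem] with z hz
        exact enorm_integral_z_sq_le (stronglyMeasurable_slice g κ).aestronglyMeasurable h₀ hz
    _ = (ENNReal.ofReal D.len * ‖g‖ₑ) ^ 2 := by
        simp_rw [lintegral_const, zMeas_univ]
        rw [lintegral_mul_const _ ((measurable_slice_lintegral g).const_mul _),
          lintegral_const_mul _ (measurable_slice_lintegral g), mul_pow, enorm_sq_eq]
        ring

variable [IsFiniteMeasure ν]

theorem memLp_volterra {z₀ : ℝ} (h₀ : z₀ ∈ Set.Icc (-D.ξ) D.d) (g : Lp ℂ 2 (D.cylMeas ν)) :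
    MemLp (fun w : K × ℝ => ∫ t in z₀..w.2, g (w.1, t)) 2 (D.cylMeas ν) :=
  memLp_two_of_lintegral_enorm_sq_lt_top (stronglyMeasurable_volterra z₀ g).aestronglyMeasurable
    ((lintegral_volterra_le h₀ g).trans_lt (by finiteness))

theorem hasTrace_zero_iff_toLp_eq {z₀ : ℝ} (h₀ : z₀ ∈ Set.Icc (-D.ξ) D.d)
    (f g : Lp ℂ 2 (D.cylMeas ν)) :
    D.HasTrace ν f g z₀ 0 ↔ (memLp_volterra h₀ g).toLp = f := by
  have hm : MeasurableSet {w : K × ℝ | f w = ∫ t in z₀..w.2, g (w.1, t)} :=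
    (Lp.stronglyMeasurable f).measurableSet_eq_fun (stronglyMeasurable_volterra z₀ g)
  rw [Lp.ext_iff]
  constructor
  · intro h
    filter_upwards [ae_cylMeas_of_ae_ae (ν := ν) hm (by simpa [HasTrace] using h),
      (memLp_volterra h₀ g).coeFn_toLp] with w hw hvw
    rw [hw, hvw]
  · intro h
    simpa [HasTrace] using ae_slice (h.symm.trans (memLp_volterra h₀ g).coeFn_toLp)

theorem norm_toLp_volterra_le {z₀ : ℝ} (h₀ : z₀ ∈ Set.Icc (-D.ξ) D.d)
    (g : Lp ℂ 2 (D.cylMeas ν)) : ‖(memLp_volterra h₀ g).toLp‖ ≤ D.len * ‖g‖ := by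
  have hsq : ‖(memLp_volterra h₀ g).toLp‖ₑ ^ 2 ≤ (ENNReal.ofReal D.len * ‖g‖ₑ) ^ 2 := by
    rw [enorm_sq_eq_lintegral_enorm_sq]
    refine (lintegral_congr_ae ?_).trans_le (lintegral_volterra_le h₀ g)
    filter_upwards [(memLp_volterra h₀ g).coeFn_toLp] with w hw
    rw [hw]
  have h := (ENNReal.pow_right_strictMono two_ne_zero).le_iff_le.1 hsq
  rw [← ofReal_norm, ← ofReal_norm, ← ENNReal.ofReal_mul len_pos.le] at h
  exact (ENNReal.ofReal_le_ofReal_iff (mul_nonneg len_pos.le (norm_nonneg _))).1 h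

/-- The Volterra operator `g ↦ ∫_{z₀}^z g dt` on `L²`. -/
def volterra (z₀ : ℝ) (h₀ : z₀ ∈ Set.Icc (-D.ξ) D.d) :
    Lp ℂ 2 (D.cylMeas ν) →L[ℝ] Lp ℂ 2 (D.cylMeas ν) :=
  LinearMap.mkContinuous
    { toFun := fun g => (memLp_volterra h₀ g).toLp
      map_add' := fun g g' => by
        rw [← hasTrace_zero_iff_toLp_eq h₀]
        simpa using HasTrace.add h₀ ((hasTrace_zero_iff_toLp_eq h₀ _ g).2 rfl)
          ((hasTrace_zero_iff_toLp_eq h₀ _ g').2 rfl)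
      map_smul' := fun c g => by
        rw [← hasTrace_zero_iff_toLp_eq h₀]
        simpa using HasTrace.smul h₀ c ((hasTrace_zero_iff_toLp_eq h₀ _ g).2 rfl) }
    D.len (norm_toLp_volterra_le h₀)

theorem hasTrace_zero_iff_volterra_eq {z₀ : ℝ} (h₀ : z₀ ∈ Set.Icc (-D.ξ) D.d)
    (f g : Lp ℂ 2 (D.cylMeas ν)) : D.HasTrace ν f g z₀ 0 ↔ volterra z₀ h₀ g = f :=
  hasTrace_zero_iff_toLp_eq h₀ f g

theorem IsZDeriv.eq_zero {g : Lp ℂ 2 (D.cylMeas ν)}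
    (h : D.IsZDeriv ν (0 : Lp ℂ 2 (D.cylMeas ν)) g) : g = 0 := by
  obtain ⟨a, ha⟩ := h
  have h0 := Lp.coeFn_zero ℂ 2 (D.cylMeas ν)
  suffices hg : ∀ᵐ w ∂D.cylMeas ν, g w = 0 by
    refine Lp.ext ?_
    filter_upwards [hg, h0] with w hw h0w
    rw [hw, h0w, Pi.zero_apply]
  refine ae_cylMeas_of_ae_ae ((Lp.stronglyMeasurable g).measurableSet_eq_fun
    stronglyMeasurable_const) ?_
  filter_upwards [ha, ae_slice h0, integrable_slice g] with κ hκ h0κ hint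
  refine ae_eq_zero_of_primitive_ae_eq_const (c := -a κ) hint ?_
  filter_upwards [hκ, h0κ] with z hz h0z
  rw [h0z, Pi.zero_apply] at hz
  exact (neg_eq_of_add_eq_zero_right hz.symm).symm

theorem ae_norm_weight_le (ν : Measure K) [IsFiniteMeasure ν] (lam : ℝ) :
    ∀ᵐ w ∂D.cylMeas ν, ‖D.weight lam w.2‖ ≤ Real.exp (|lam| * D.len) := by
  filter_upwards [ae_cylMeas_of_ae_snd (ν := ν) (zMem (D := D))] with w hw
  exact norm_weight_le lam hw

theorem memLp_weight (ν : Measure K) [IsFiniteMeasure ν] (lam : ℝ) :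
    MemLp (fun w : K × ℝ => D.weight lam w.2) ∞ (D.cylMeas ν) :=
  memLp_top_of_bound ((measurable_weight lam).comp measurable_snd).aestronglyMeasurable _
    (ae_norm_weight_le ν lam)

/-- The weight `e^{λ (d - z)}` as a bounded function. -/
def weightInf (D : Config) (ν : Measure K) [IsFiniteMeasure ν] (lam : ℝ) :
    Lp ℂ ∞ (D.cylMeas ν) :=
  (memLp_weight ν lam).toLp

theorem norm_weightInf_le (lam : ℝ) : ‖D.weightInf ν lam‖ ≤ Real.exp (|lam| * D.len) :=
  norm_toLp_top_le _ (Real.exp_pos _).le (ae_norm_weight_le ν lam)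

/-- Multiplication by the weight `e^{λ (d - z)}`. -/
def mulWeight (D : Config) (ν : Measure K) [IsFiniteMeasure ν] (q : ℝ≥0∞) [Fact (1 ≤ q)]
    (lam : ℝ) : Lp ℂ q (D.cylMeas ν) →L[ℝ] Lp ℂ q (D.cylMeas ν) :=
  mulLp (D.cylMeas ν) q (D.weightInf ν lam)

section

variable {q : ℝ≥0∞} [Fact (1 ≤ q)]

theorem coeFn_mulWeight (lam : ℝ) (f : Lp ℂ q (D.cylMeas ν)) :
    ∀ᵐ w ∂D.cylMeas ν, D.mulWeight ν q lam f w = D.weight lam w.2 * f w := by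
  filter_upwards [coeFn_mulLp (D.weightInf ν lam) f, (memLp_weight (D := D) ν lam).coeFn_toLp]
    with w h1 h2
  rw [mulWeight, h1, weightInf, h2]

theorem norm_mulWeight_le (lam : ℝ) (f : Lp ℂ q (D.cylMeas ν)) :
    ‖D.mulWeight ν q lam f‖ ≤ Real.exp (|lam| * D.len) * ‖f‖ :=
  (norm_mulLp_le _ _).trans (mul_le_mul_of_nonneg_right (norm_weightInf_le lam) (norm_nonneg _))

theorem norm_le_norm_mulWeight {lam : ℝ} (hl : 0 ≤ lam) (f : Lp ℂ q (D.cylMeas ν)) :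
    ‖f‖ ≤ ‖D.mulWeight ν q lam f‖ := by
  refine Lp.norm_le_norm_of_ae_le ?_
  filter_upwards [coeFn_mulWeight lam f, ae_cylMeas_of_ae_snd (ν := ν) (zMem (D := D))] with w h1 h2
  rw [h1, norm_mul]
  exact le_mul_of_one_le_left (norm_nonneg _) (one_le_norm_weight hl h2)

end

theorem inner_mulWeight (lam : ℝ) (f g : Lp ℂ 2 (D.cylMeas ν)) :
    inner ℝ (D.mulWeight ν 2 lam f) g = inner ℝ f (D.mulWeight ν 2 lam g) := by
  rw [L2.inner_def, L2.inner_def]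
  refine integral_congr_ae ?_
  filter_upwards [coeFn_mulWeight lam f, coeFn_mulWeight lam g] with w h1 h2
  simp only [h1, h2, Complex.inner, weight, map_mul, Complex.conj_ofReal]
  congr 1
  ring

theorem enorm_mulWeight_sq_le_of_hasTrace {f g : Lp ℂ 2 (D.cylMeas ν)}
    (h : D.HasTrace ν f g (-D.ξ) 0) {lam : ℝ} (hl : 0 < lam) :
    ∀ᵐ κ ∂ν, ∀ᵐ z ∂D.zMeas, ‖D.mulWeight ν 2 lam f (κ, z)‖ₑ ^ 2
      ≤ ENNReal.ofReal (1 / (2 * lam)) * ∫⁻ t, ‖D.mulWeight ν 2 lam g (κ, t)‖ₑ ^ 2 ∂D.zMeas := by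
  filter_upwards [h, ae_slice (coeFn_mulWeight lam f), ae_slice (coeFn_mulWeight lam g)]
    with κ hκ hfκ hgκ
  have hweight : ∫⁻ t, ‖Real.exp (lam * (D.d - t)) • g (κ, t)‖ₑ ^ 2 ∂D.zMeas
      = ∫⁻ t, ‖D.mulWeight ν 2 lam g (κ, t)‖ₑ ^ 2 ∂D.zMeas := by
    refine lintegral_congr_ae ?_
    filter_upwards [hgκ] with t ht
    rw [ht, weight, Complex.real_smul]
  filter_upwards [hκ, hfκ, zMem] with z hz hfz hzm
  have hsub := restrict_le (left_mem (D := D)) hzm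
  rw [Set.uIoc_of_le hzm.1.le] at hsub
  rw [hfz, hz, Pi.zero_apply, zero_add, ← hweight, weight, ← Complex.real_smul]
  refine (enorm_exp_smul_intervalIntegral_sq_le hl D.d hzm.1.le
    (stronglyMeasurable_slice g κ).aestronglyMeasurable).trans ?_
  gcongr

theorem enorm_sq_le_of_ae_slice_le {f : Lp ℂ 2 (D.cylMeas ν)} {σ : K → ℝ≥0∞}
    (h : ∀ᵐ κ ∂ν, ∀ᵐ z ∂D.zMeas, ‖f (κ, z)‖ₑ ^ 2 ≤ σ κ) :
    ‖f‖ₑ ^ 2 ≤ ENNReal.ofReal (D.h ^ 2) * ∫⁻ κ, σ κ * ENNReal.ofReal D.len ∂ν := by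
  rw [enorm_sq_eq]
  refine mul_le_mul' le_rfl (lintegral_mono_ae ?_)
  filter_upwards [h] with κ hκ
  refine (lintegral_mono_ae hκ).trans ?_
  rw [lintegral_const, zMeas_univ]

theorem norm_mulWeight_le_of_hasTrace {f g : Lp ℂ 2 (D.cylMeas ν)} (h : D.HasTrace ν f g (-D.ξ) 0)
    {lam : ℝ} (hl : 0 < lam) :
    ‖D.mulWeight ν 2 lam f‖ ≤ √(D.len / (2 * lam)) * ‖D.mulWeight ν 2 lam g‖ := by
  have hlen := len_pos (D := D)
  refine norm_le_sqrt_mul_of_enorm_sq_le (by positivity)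
    ((enorm_sq_le_of_ae_slice_le (enorm_mulWeight_sq_le_of_hasTrace h hl)).trans (le_of_eq ?_))
  rw [lintegral_mul_const _ ((measurable_slice_lintegral _).const_mul _),
    lintegral_const_mul _ (measurable_slice_lintegral _), enorm_sq_eq (D.mulWeight ν 2 lam g),
    div_eq_mul_one_div D.len, ENNReal.ofReal_mul hlen.le]
  ring

theorem enorm_sq_le_of_isZDeriv {f g : Lp ℂ 2 (D.cylMeas ν)} (h : D.IsZDeriv ν f g) :
    ∀ᵐ κ ∂ν, ∀ᵐ z ∂D.zMeas, ‖f (κ, z)‖ₑ ^ 2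
      ≤ ENNReal.ofReal (2 / D.len) * (∫⁻ t, ‖f (κ, t)‖ₑ ^ 2 ∂D.zMeas)
        + ENNReal.ofReal (2 * D.len) * ∫⁻ t, ‖g (κ, t)‖ₑ ^ 2 ∂D.zMeas := by
  obtain ⟨a, ha⟩ := h
  filter_upwards [ha, integrable_slice g] with κ hκ hint
  have hsobolev := enorm_sq_le_of_ae_eq_primitive hint hκ
  rwa [sub_neg_eq_add] at hsobolev

theorem enorm_integral_k_sq_le (f : Lp ℂ 2 (D.cylMeas D.kMeas)) {k : ℝ}
    (hk : k ∈ Set.Icc D.kmin D.kmax) (z : ℝ) :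
    ‖∫ κ in k..D.kmax, f (κ, z)‖ₑ ^ 2
      ≤ ENNReal.ofReal (D.kmax - D.kmin) * ∫⁻ κ, ‖f (κ, z)‖ₑ ^ 2 ∂D.kMeas :=
  enorm_intervalIntegral_sq_le hk ⟨D.k_lt.le, le_rfl⟩
    (stronglyMeasurable_slice_swap f z).aestronglyMeasurable

theorem enorm_integral_k_sq_le_of_ae_slice_le {f : Lp ℂ 2 (D.cylMeas D.kMeas)} {σ : ℝ → ℝ≥0∞}
    (hσ : Measurable σ) (h : ∀ᵐ κ ∂D.kMeas, ∀ᵐ z ∂D.zMeas, ‖f (κ, z)‖ₑ ^ 2 ≤ σ κ) :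
    ∀ᵐ z ∂D.zMeas, ∀ k ∈ Set.Icc D.kmin D.kmax, ‖∫ κ in k..D.kmax, f (κ, z)‖ₑ ^ 2
      ≤ ENNReal.ofReal (D.kmax - D.kmin) * ∫⁻ κ, σ κ ∂D.kMeas := by
  have h1 := ae_slice_swap (ae_cylMeas_of_ae_ae
    (measurableSet_le (measurable_enorm_sq f) (hσ.comp measurable_fst)) h)
  filter_upwards [h1] with z hz k hk
  exact (enorm_integral_k_sq_le f hk z).trans (mul_le_mul' le_rfl (lintegral_mono_ae hz))

theorem norm_integral_k_mulWeight_le {f g : Lp ℂ 2 (D.cylMeas D.kMeas)}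
    (h : D.HasTrace D.kMeas f g (-D.ξ) 0) {lam : ℝ} (hl : 0 < lam) :
    ∀ᵐ z ∂D.zMeas, ∀ k ∈ Set.Icc D.kmin D.kmax,
      ‖∫ κ in k..D.kmax, D.mulWeight D.kMeas 2 lam f (κ, z)‖
        ≤ √((D.kmax - D.kmin) / D.h ^ 2 / (2 * lam)) * ‖D.mulWeight D.kMeas 2 lam g‖ := by
  have hh := h_pos (D := D)
  have hK : 0 < D.kmax - D.kmin := sub_pos.2 D.k_lt
  filter_upwards [enorm_integral_k_sq_le_of_ae_slice_le
    ((measurable_slice_lintegral _).const_mul _) (enorm_mulWeight_sq_le_of_hasTrace h hl)]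
    with z hz k hk
  refine norm_le_sqrt_mul_of_enorm_sq_le (by positivity) ((hz k hk).trans (le_of_eq ?_))
  rw [lintegral_const_mul _ (measurable_slice_lintegral _), lintegral_lintegral_eq,
    div_eq_mul_one_div (_ / _), div_eq_mul_inv (_ - _), ENNReal.ofReal_mul (by positivity),
    ENNReal.ofReal_mul hK.le, ENNReal.ofReal_inv_of_pos (by positivity)]
  ring

/-- The constant of the Sobolev inequality in `z`, both for a fixed wave number and after an
integration over a subinterval of the wave numbers. -/
def sobolevConst (D : Config) : ℝ :=
  √((D.kmax - D.kmin + 1) * (2 / D.len) / D.h ^ 2)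
    + √((D.kmax - D.kmin + 1) * (2 * D.len) / D.h ^ 2)

theorem sobolevConst_nonneg : 0 ≤ D.sobolevConst := by
  unfold sobolevConst
  positivity

theorem norm_le_sobolevConst_mul {E F G : Type*} [NormedAddCommGroup E]
    [NormedAddCommGroup F] [NormedAddCommGroup G] {x : E} {y : F} {z : G} {c : ℝ}
    (hc : c ≤ D.kmax - D.kmin + 1)
    (h : ‖x‖ₑ ^ 2 ≤ ENNReal.ofReal c *
      (ENNReal.ofReal (2 / D.len) * ((ENNReal.ofReal (D.h ^ 2))⁻¹ * ‖y‖ₑ ^ 2)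
        + ENNReal.ofReal (2 * D.len) * ((ENNReal.ofReal (D.h ^ 2))⁻¹ * ‖z‖ₑ ^ 2))) :
    ‖x‖ ≤ D.sobolevConst * (‖y‖ + ‖z‖) := by
  have hlen := len_pos (D := D)
  have hh := h_pos (D := D)
  have hK : 0 < D.kmax - D.kmin := sub_pos.2 D.k_lt
  have hofReal : ∀ b : ℝ, 0 ≤ b → ENNReal.ofReal ((D.kmax - D.kmin + 1) * b / D.h ^ 2)
      = ENNReal.ofReal (D.kmax - D.kmin + 1) *
        (ENNReal.ofReal b * (ENNReal.ofReal (D.h ^ 2))⁻¹) := fun b hb => by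
    rw [div_eq_mul_inv, ENNReal.ofReal_mul (by positivity), ENNReal.ofReal_mul (by positivity),
      ENNReal.ofReal_inv_of_pos (by positivity), mul_assoc]
  have hsum := norm_le_sqrt_mul_add_of_enorm_sq_le (x := x) (y := y) (z := z)
    (c := (D.kmax - D.kmin + 1) * (2 / D.len) / D.h ^ 2)
    (c' := (D.kmax - D.kmin + 1) * (2 * D.len) / D.h ^ 2)
    (by positivity) (by positivity) (h.trans <| by
      rw [hofReal _ (by positivity), hofReal _ (by positivity), mul_add]
      simp only [mul_assoc]
      gcongr)
  refine hsum.trans ?_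
  rw [sobolevConst, mul_add]
  gcongr
  · exact le_add_of_nonneg_right (Real.sqrt_nonneg _)
  · exact le_add_of_nonneg_left (Real.sqrt_nonneg _)

theorem norm_integral_k_le {f g : Lp ℂ 2 (D.cylMeas D.kMeas)} (h : D.IsZDeriv D.kMeas f g) :
    ∀ᵐ z ∂D.zMeas, ∀ k ∈ Set.Icc D.kmin D.kmax,
      ‖∫ κ in k..D.kmax, f (κ, z)‖ ≤ D.sobolevConst * (‖f‖ + ‖g‖) := by
  filter_upwards [enorm_integral_k_sq_le_of_ae_slice_le
    (((measurable_slice_lintegral _).const_mul _).add ((measurable_slice_lintegral _).const_mul _))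
    (enorm_sq_le_of_isZDeriv h)] with z hz k hk
  refine norm_le_sobolevConst_mul (c := D.kmax - D.kmin) (by linarith)
    ((hz k hk).trans_eq ?_)
  simp only [Pi.add_apply]
  rw [lintegral_add_left ((measurable_slice_lintegral _).const_mul _),
    lintegral_const_mul _ (measurable_slice_lintegral _),
    lintegral_const_mul _ (measurable_slice_lintegral _), lintegral_lintegral_eq,
    lintegral_lintegral_eq]

theorem ae_unit {p : Unit → Prop} (h : ∀ᵐ κ ∂unitMeas, p κ) : p () := by
  simpa [unitMeas, ae_dirac_eq] using h

theorem lintegral_unit (u : Lp ℂ 2 (D.cylMeas unitMeas)) :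
    ∫⁻ z, ‖u ((), z)‖ₑ ^ 2 ∂D.zMeas = (ENNReal.ofReal (D.h ^ 2))⁻¹ * ‖u‖ₑ ^ 2 := by
  rw [← lintegral_lintegral_eq]
  exact (lintegral_dirac () fun κ : Unit => ∫⁻ z, ‖u (κ, z)‖ₑ ^ 2 ∂D.zMeas).symm

theorem norm_unit_le {f g : Lp ℂ 2 (D.cylMeas unitMeas)} (h : D.IsZDeriv unitMeas f g) :
    ∀ᵐ z ∂D.zMeas, ‖f ((), z)‖ ≤ D.sobolevConst * (‖f‖ + ‖g‖) := by
  have hkpos : 0 < D.kmax - D.kmin := sub_pos.2 D.k_lt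
  filter_upwards [ae_unit (enorm_sq_le_of_isZDeriv h)] with z hz
  refine norm_le_sobolevConst_mul (c := 1) (by linarith) ?_
  rw [ENNReal.ofReal_one, one_mul]
  rwa [lintegral_unit, lintegral_unit] at hz

end Config

namespace Config

variable {D : Config} {K : Type} [MeasurableSpace K] {ν : Measure K}

theorem node_cases (n : D.Node) : IsLateral n ∨ ∃ i : D.Inner, n = ctr i := by
  by_cases hn : IsLateral n
  · exact Or.inl hn
  right
  have key : ∀ a : Fin (D.N + 2), a ≠ 0 → a ≠ Fin.last _ →
      ∃ j : Fin D.N, a = j.succ.castSucc := by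
    intro a h0 h1
    obtain ⟨b, rfl⟩ := Fin.exists_castSucc_eq.2 h1
    have hb : b ≠ 0 := by
      rintro rfl
      exact h0 rfl
    obtain ⟨j, rfl⟩ := Fin.exists_succ_eq.2 hb
    exact ⟨j, rfl⟩
  simp only [IsLateral, not_or] at hn
  obtain ⟨j, hj⟩ := key n.1 hn.1 hn.2.1
  obtain ⟨s, hs⟩ := key n.2 hn.2.2.1 hn.2.2.2
  exact ⟨(j, s), Prod.ext hj hs⟩

/-- The entry `∂_z^r u` of a jet `u` at the node `n`, as a bounded operator. -/
def component {m : ℕ} (ν : Measure K) (n : D.Node) (r : Fin (m + 1)) :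
    D.Jet m ν →L[ℝ] Lp ℂ 2 (D.cylMeas ν) :=
  PiLp.proj 2 (fun _ : D.Node × Fin (m + 1) => Lp ℂ 2 (D.cylMeas ν)) (n, r)

@[simp]
theorem component_apply {m : ℕ} (n : D.Node) (r : Fin (m + 1)) (u : D.Jet m ν) :
    component ν n r u = u (n, r) := rfl

/-- The part `u_xx^h + u_yy^h` of the discrete Laplacian at an interior node, as a bounded
operator. -/
def lapLowCLM (ν : Measure K) (i : D.Inner) : D.Jet 2 ν →L[ℝ] Lp ℂ 2 (D.cylMeas ν) :=
  (D.h ^ 2)⁻¹ •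
      (component ν (xMinus i) 0 - (2 : ℝ) • component ν (ctr i) 0 + component ν (xPlus i) 0)
    + (D.h ^ 2)⁻¹ •
      (component ν (yMinus i) 0 - (2 : ℝ) • component ν (ctr i) 0 + component ν (yPlus i) 0)

/-- The discrete Laplacian `Δ^h u` at an interior node, as a bounded operator. -/
def lapCLM (ν : Measure K) (i : D.Inner) : D.Jet 2 ν →L[ℝ] Lp ℂ 2 (D.cylMeas ν) :=
  component ν (ctr i) 2 + lapLowCLM ν i

/-- The discrete gradient `∇^h ∂_z^r u`, `r = 0, 1`, at an interior node, as a bounded operator. -/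
def gradCLM (ν : Measure K) (r : Fin 2) (i : D.Inner) :
    Fin 3 → (D.Jet 2 ν →L[ℝ] Lp ℂ 2 (D.cylMeas ν)) :=
  ![(2 * D.h)⁻¹ • (component ν (xPlus i) r.castSucc - component ν (xMinus i) r.castSucc),
    (2 * D.h)⁻¹ • (component ν (yPlus i) r.castSucc - component ν (yMinus i) r.castSucc),
    component ν (ctr i) r.succ]

theorem coeFn_smul_sub {α : Type*} [MeasurableSpace α] {μ : Measure α} (c : ℝ) (f g : Lp ℂ 2 μ) :
    ∀ᵐ w ∂μ, (c • (f - g) : Lp ℂ 2 μ) w = (f w - g w) * c := by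
  filter_upwards [Lp.coeFn_smul c (f - g), Lp.coeFn_sub f g] with w h1 h2
  rw [h1, Pi.smul_apply, h2, Pi.sub_apply, Complex.real_smul, mul_comm]

theorem coeFn_smul_sub_two_smul_add {α : Type*} [MeasurableSpace α] {μ : Measure α} (c : ℝ)
    (f g k : Lp ℂ 2 μ) :
    ∀ᵐ w ∂μ, (c • (f - (2 : ℝ) • g + k) : Lp ℂ 2 μ) w = (f w - 2 * g w + k w) * c := by
  filter_upwards [Lp.coeFn_smul c (f - (2 : ℝ) • g + k), Lp.coeFn_add (f - (2 : ℝ) • g) k,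
    Lp.coeFn_sub f ((2 : ℝ) • g), Lp.coeFn_smul (2 : ℝ) g] with w h1 h2 h3 h4
  rw [h1, Pi.smul_apply, h2, Pi.add_apply, h3, Pi.sub_apply, h4, Pi.smul_apply, Complex.real_smul,
    Complex.real_smul, mul_comm]
  push_cast
  ring

theorem coeFn_lapCLM (i : D.Inner) (u : D.Jet 2 ν) :
    ∀ᵐ w ∂D.cylMeas ν, lapCLM ν i u w = lapH u i w := by
  have hlow : lapCLM ν i u = u (ctr i, 2) + lapLowCLM ν i u := rfl
  have hxy : lapLowCLM ν i u =
      (D.h ^ 2)⁻¹ • (u (xMinus i, 0) - (2 : ℝ) • u (ctr i, 0) + u (xPlus i, 0))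
      + (D.h ^ 2)⁻¹ • (u (yMinus i, 0) - (2 : ℝ) • u (ctr i, 0) + u (yPlus i, 0)) := rfl
  filter_upwards [Lp.coeFn_add (u (ctr i, 2)) (lapLowCLM ν i u), hxy ▸ Lp.coeFn_add _ _,
    coeFn_smul_sub_two_smul_add (D.h ^ 2)⁻¹ (u (xMinus i, 0)) (u (ctr i, 0)) (u (xPlus i, 0)),
    coeFn_smul_sub_two_smul_add (D.h ^ 2)⁻¹ (u (yMinus i, 0)) (u (ctr i, 0)) (u (yPlus i, 0))]
    with w h1 h2 h3 h4
  rw [hlow, h1, Pi.add_apply, h2, Pi.add_apply, h3, h4, lapH]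
  push_cast
  ring

theorem coeFn_gradCLM (i : D.Inner) (u : D.Jet 2 ν) (m : Fin 3) :
    ∀ᵐ w ∂D.cylMeas ν, gradCLM ν 0 i m u w = gradH u i w m := by
  fin_cases m
  · filter_upwards [coeFn_smul_sub (2 * D.h)⁻¹ (u (xPlus i, 0)) (u (xMinus i, 0))] with w h1
    refine h1.trans ?_
    simp [gradH, div_eq_mul_inv]
  · filter_upwards [coeFn_smul_sub (2 * D.h)⁻¹ (u (yPlus i, 0)) (u (yMinus i, 0))] with w h1
    refine h1.trans ?_
    simp [gradH, div_eq_mul_inv]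
  · exact Filter.Eventually.of_forall fun w => rfl

/-- A common bound for the norms of the difference operators on the grid. -/
def gridConst (D : Config) : ℝ := 1 + D.h⁻¹ + 8 * (D.h ^ 2)⁻¹

theorem one_le_gridConst : 1 ≤ D.gridConst := by
  have h1 : 0 < D.h⁻¹ := inv_pos.2 h_pos
  have h2 : 0 < (D.h ^ 2)⁻¹ := inv_pos.2 (pow_pos h_pos 2)
  unfold gridConst
  linarith

theorem norm_smul_sub_two_smul_add_le {E : Type*} [NormedAddCommGroup E] [NormedSpace ℝ E]
    {f g k : E} {c M : ℝ} (hc : 0 ≤ c) (hf : ‖f‖ ≤ M) (hg : ‖g‖ ≤ M) (hk : ‖k‖ ≤ M) :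
    ‖c • (f - (2 : ℝ) • g + k)‖ ≤ 4 * c * M := by
  have htwo : ‖(2 : ℝ) • g‖ = 2 * ‖g‖ := by rw [norm_smul]; norm_num
  have hsum : ‖f - (2 : ℝ) • g + k‖ ≤ 4 * M := by
    linarith [norm_add_le (f - (2 : ℝ) • g) k, norm_sub_le f ((2 : ℝ) • g)]
  calc ‖c • (f - (2 : ℝ) • g + k)‖ = c * ‖f - (2 : ℝ) • g + k‖ := norm_smul_of_nonneg hc _
    _ ≤ c * (4 * M) := by gcongr
    _ = 4 * c * M := by ring

theorem norm_two_mul_h_inv_smul_sub_le {E : Type*} [NormedAddCommGroup E] [NormedSpace ℝ E]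
    {f g : E} {M : ℝ} (hf : ‖f‖ ≤ M) (hg : ‖g‖ ≤ M) :
    ‖(2 * D.h)⁻¹ • (f - g)‖ ≤ D.gridConst * M := by
  have hh := h_pos (D := D)
  have hM : 0 ≤ M := (norm_nonneg f).trans hf
  have hinv : D.h⁻¹ ≤ D.gridConst := by
    have : 0 < (D.h ^ 2)⁻¹ := by positivity
    unfold gridConst
    linarith
  calc ‖(2 * D.h)⁻¹ • (f - g)‖ = (2 * D.h)⁻¹ * ‖f - g‖ := norm_smul_of_nonneg (by positivity) _
    _ ≤ (2 * D.h)⁻¹ * (M + M) := by gcongr; exact norm_sub_le_of_le hf hg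
    _ = D.h⁻¹ * M := by field_simp; ring
    _ ≤ D.gridConst * M := by gcongr

section Operators

variable {E : Type*} [NormedAddCommGroup E] [NormedSpace ℝ E]

theorem norm_map_lapLowCLM_le (T : Lp ℂ 2 (D.cylMeas ν) →L[ℝ] E) (i : D.Inner) {u : D.Jet 2 ν}
    {M : ℝ} (h : ∀ n, ‖T (u (n, 0))‖ ≤ M) :
    ‖T (lapLowCLM ν i u)‖ ≤ 8 * (D.h ^ 2)⁻¹ * M := by
  have e : T (lapLowCLM ν i u)
      = (D.h ^ 2)⁻¹ • (T (u (xMinus i, 0)) - (2 : ℝ) • T (u (ctr i, 0)) + T (u (xPlus i, 0)))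
      + (D.h ^ 2)⁻¹ • (T (u (yMinus i, 0)) - (2 : ℝ) • T (u (ctr i, 0)) + T (u (yPlus i, 0))) := by
    simp [lapLowCLM]
  have hc : 0 ≤ (D.h ^ 2)⁻¹ := by positivity
  rw [e]
  refine (norm_add_le_of_le (norm_smul_sub_two_smul_add_le hc (h _) (h _) (h _))
    (norm_smul_sub_two_smul_add_le hc (h _) (h _) (h _))).trans (le_of_eq ?_)
  ring

theorem norm_map_gradCLM_le (T : Lp ℂ 2 (D.cylMeas ν) →L[ℝ] E) (r : Fin 2) (i : D.Inner)
    {u : D.Jet 2 ν} {M : ℝ} (h0 : ∀ n, ‖T (u (n, r.castSucc))‖ ≤ M)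
    (h1 : ∀ n, ‖T (u (n, r.succ))‖ ≤ M) (m : Fin 3) :
    ‖T (gradCLM ν r i m u)‖ ≤ D.gridConst * M := by
  have hM : 0 ≤ M := (norm_nonneg _).trans (h0 (ctr i))
  have hdiff : ∀ n n' : D.Node, ‖T ((2 * D.h)⁻¹ • (u (n, r.castSucc) - u (n', r.castSucc)))‖
      ≤ D.gridConst * M := fun n n' => by
    rw [map_smul, map_sub]
    exact norm_two_mul_h_inv_smul_sub_le (h0 n) (h0 n')
  fin_cases m
  · exact hdiff (xPlus i) (xMinus i)
  · exact hdiff (yPlus i) (yMinus i)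
  · exact (h1 (ctr i)).trans (le_mul_of_one_le_left hM one_le_gridConst)

end Operators

theorem norm_gradCLM_le (r : Fin 2) (i : D.Inner) (m : Fin 3) (u : D.Jet 2 ν) :
    ‖gradCLM ν r i m u‖ ≤ D.gridConst * ‖u‖ :=
  norm_map_gradCLM_le (ContinuousLinearMap.id ℝ _) r i (fun _ => PiLp.norm_apply_le u _)
    (fun _ => PiLp.norm_apply_le u _) m

theorem norm_lapCLM_le (i : D.Inner) (u : D.Jet 2 ν) : ‖lapCLM ν i u‖ ≤ D.gridConst * ‖u‖ := by
  have hlow : ‖lapLowCLM ν i u‖ ≤ 8 * (D.h ^ 2)⁻¹ * ‖u‖ :=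
    norm_map_lapLowCLM_le (ContinuousLinearMap.id ℝ _) i fun _ => PiLp.norm_apply_le u _
  have hsum : ‖lapCLM ν i u‖ ≤ ‖u (ctr i, 2)‖ + ‖lapLowCLM ν i u‖ := norm_add_le _ _
  have hzz : ‖u (ctr i, 2)‖ ≤ ‖u‖ := PiLp.norm_apply_le u _
  have hinv : 0 ≤ D.h⁻¹ * ‖u‖ := mul_nonneg (inv_nonneg.2 h_pos.le) (norm_nonneg _)
  unfold gridConst
  linarith

section Finite

variable [IsFiniteMeasure ν]

theorem HasTrace.sub {f g f' g' : Lp ℂ 2 (D.cylMeas ν)} {z₀ : ℝ}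
    (h₀ : z₀ ∈ Set.Icc (-D.ξ) D.d) {a a' : K → ℂ}
    (h1 : D.HasTrace ν f g z₀ a) (h2 : D.HasTrace ν f' g' z₀ a') :
    D.HasTrace ν (f - f' : Lp ℂ 2 (D.cylMeas ν)) (g - g' : Lp ℂ 2 (D.cylMeas ν)) z₀ (a - a') := by
  simpa [sub_eq_add_neg] using HasTrace.add h₀ h1 (HasTrace.smul h₀ (-1) h2)

theorem HasTrace.smul_sub {f g f' g' : Lp ℂ 2 (D.cylMeas ν)} {z₀ : ℝ}
    (h₀ : z₀ ∈ Set.Icc (-D.ξ) D.d) (c : ℝ) {a a' : K → ℂ}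
    (h1 : D.HasTrace ν f g z₀ a) (h2 : D.HasTrace ν f' g' z₀ a') :
    D.HasTrace ν (c • (f - f') : Lp ℂ 2 (D.cylMeas ν)) (c • (g - g') : Lp ℂ 2 (D.cylMeas ν)) z₀
      (c • (a - a')) :=
  HasTrace.smul h₀ c (HasTrace.sub h₀ h1 h2)

theorem isZDeriv_gradCLM {u : D.Jet 2 ν} (hu : u ∈ D.H 2 ν) (i : D.Inner) (m : Fin 3) :
    D.IsZDeriv ν (gradCLM ν 0 i m u) (gradCLM ν 1 i m u) := by
  have hdiff : ∀ n n' : D.Node, D.IsZDeriv ν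
      ((2 * D.h)⁻¹ • (u (n, 0) - u (n', 0)) : Lp ℂ 2 (D.cylMeas ν))
      ((2 * D.h)⁻¹ • (u (n, 1) - u (n', 1)) : Lp ℂ 2 (D.cylMeas ν)) := fun n n' => by
    obtain ⟨a, ha⟩ := hu n 0
    obtain ⟨a', ha'⟩ := hu n' 0
    exact ⟨_, HasTrace.smul_sub left_mem _ ha ha'⟩
  fin_cases m
  · exact hdiff (xPlus i) (xMinus i)
  · exact hdiff (yPlus i) (yMinus i)
  · exact hu (ctr i) 1

theorem eq_zero_of_mem_H0_of_isLateral {u : D.Jet 2 ν} (hu : u ∈ D.H0 ν) {n : D.Node}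
    (hn : IsLateral n) (r : Fin 3) : u (n, r) = 0 := by
  induction r using Fin.induction with
  | zero => exact hu.2.lateral n hn
  | succ r hr =>
    have := hu.1 n r
    rw [hr] at this
    exact this.eq_zero

theorem hasTrace_of_mem_H0 {u : D.Jet 2 ν} (hu : u ∈ D.H0 ν) (n : D.Node) (r : Fin 2) :
    D.HasTrace ν (u (n, r.castSucc)) (u (n, r.succ)) (-D.ξ) 0 := by
  rcases node_cases n with hn | ⟨i, rfl⟩
  · rw [eq_zero_of_mem_H0_of_isLateral hu hn, eq_zero_of_mem_H0_of_isLateral hu hn]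
    exact HasTrace.zero _ left_mem
  · fin_cases r
    · exact hu.2.bottom i
    · exact hu.2.bottom_z i

theorem hasTrace_gradCLM {u : D.Jet 2 ν} (hu : u ∈ D.H0 ν) (i : D.Inner) (m : Fin 3) :
    D.HasTrace ν (gradCLM ν 0 i m u) (gradCLM ν 1 i m u) (-D.ξ) 0 := by
  have hdiff : ∀ n n' : D.Node, D.HasTrace ν
      ((2 * D.h)⁻¹ • (u (n, 0) - u (n', 0)) : Lp ℂ 2 (D.cylMeas ν))
      ((2 * D.h)⁻¹ • (u (n, 1) - u (n', 1)) : Lp ℂ 2 (D.cylMeas ν)) (-D.ξ) 0 := fun n n' => by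
    simpa using HasTrace.smul_sub left_mem (2 * D.h)⁻¹ (hasTrace_of_mem_H0 hu n 0)
      (hasTrace_of_mem_H0 hu n' 0)
  fin_cases m
  · exact hdiff (xPlus i) (xMinus i)
  · exact hdiff (yPlus i) (yMinus i)
  · exact hasTrace_of_mem_H0 hu (ctr i) 1

theorem mem_H0_iff {u : D.Jet 2 ν} : u ∈ D.H0 ν ↔
    (∀ n : D.Node, IsLateral n → ∀ r, component ν n r u = 0) ∧
    (∀ i : D.Inner, volterra (-D.ξ) left_mem (component ν (ctr i) 1 u) = component ν (ctr i) 0 u) ∧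
    (∀ i : D.Inner, volterra (-D.ξ) left_mem (component ν (ctr i) 2 u) = component ν (ctr i) 1 u) ∧
    ∀ i : D.Inner, volterra D.d right_mem (component ν (ctr i) 1 u) = component ν (ctr i) 0 u := by
  simp only [← hasTrace_zero_iff_volterra_eq]
  constructor
  · intro hu
    exact ⟨fun n hn r => eq_zero_of_mem_H0_of_isLateral hu hn r, hu.2.bottom, hu.2.bottom_z,
      hu.2.top⟩
  · rintro ⟨hlat, hbot, hbotz, htop⟩
    refine ⟨fun n r => ?_, ⟨fun n hn => hlat n hn 0, hbot, hbotz, htop⟩⟩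
    rcases node_cases n with hn | ⟨i, rfl⟩
    · have e1 : u (n, r.castSucc) = 0 := hlat n hn _
      have e2 : u (n, r.succ) = 0 := hlat n hn _
      rw [e1, e2]
      exact ⟨0, HasTrace.zero _ left_mem⟩
    · fin_cases r
      · exact ⟨0, hbot i⟩
      · exact ⟨0, hbotz i⟩

theorem isClosed_H0 : IsClosed (D.H0 ν : Set (D.Jet 2 ν)) := by
  change IsClosed {u | u ∈ D.H0 ν}
  simp only [mem_H0_iff, Set.ofPred_and, Set.ofPred_forall]
  refine IsClosed.inter (isClosed_iInter fun n => isClosed_iInter fun _ => isClosed_iInter fun r =>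
    isClosed_eq (by fun_prop) (by fun_prop)) (IsClosed.inter ?_ (IsClosed.inter ?_ ?_)) <;>
  exact isClosed_iInter fun i => isClosed_eq (by fun_prop) (by fun_prop)

instance : CompleteSpace (D.H0 ν) := isClosed_H0.completeSpace_coe

theorem H0_le_H : D.H0 ν ≤ D.H 2 ν := fun _ hu => hu.1

/-- The weighted norm `(∑ h² ∫∫ |u_zz|² e^{2λ(d-z)} dz dν)^{1/2}`, which dominates the
weighted norms of all components of a function with zero boundary data. -/
def weightedZZNorm (lam : ℝ) (u : D.Jet 2 ν) : ℝ :=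
  √(∑ i : D.Inner, ‖D.mulWeight ν 2 lam (u (ctr i, 2))‖ ^ 2)

theorem weightedZZNorm_nonneg (lam : ℝ) (u : D.Jet 2 ν) : 0 ≤ weightedZZNorm lam u :=
  Real.sqrt_nonneg _

theorem weightedZZNorm_sq (lam : ℝ) (u : D.Jet 2 ν) :
    weightedZZNorm lam u ^ 2 = ∑ i : D.Inner, ‖D.mulWeight ν 2 lam (u (ctr i, 2))‖ ^ 2 :=
  Real.sq_sqrt (by positivity)

/-- The factor `(|(-ξ, d)| / 2λ)^{1/2}` which an integration in `z` from `-ξ` gains in the weighted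
norms. -/
def carlemanConst (D : Config) (lam : ℝ) : ℝ := √(D.len / (2 * lam))

theorem carlemanConst_nonneg (lam : ℝ) : 0 ≤ D.carlemanConst lam := Real.sqrt_nonneg _

theorem carlemanConst_le_one {lam : ℝ} (hl : D.len ≤ lam) : D.carlemanConst lam ≤ 1 := by
  have := len_pos (D := D)
  rw [carlemanConst, Real.sqrt_le_one, div_le_one (by linarith)]
  linarith

variable {u : D.Jet 2 ν} {lam : ℝ}

theorem norm_mulWeight_two_le (hu : u ∈ D.H0 ν) (n : D.Node) :
    ‖D.mulWeight ν 2 lam (u (n, 2))‖ ≤ weightedZZNorm lam u := by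
  rcases node_cases n with hn | ⟨i, rfl⟩
  · rw [eq_zero_of_mem_H0_of_isLateral hu hn, map_zero, norm_zero]
    exact weightedZZNorm_nonneg _ _
  · refine Real.le_sqrt_of_sq_le ?_
    exact Finset.single_le_sum (f := fun i : D.Inner => ‖D.mulWeight ν 2 lam (u (ctr i, 2))‖ ^ 2)
      (fun i _ => by positivity) (Finset.mem_univ i)

theorem norm_mulWeight_one_le (hu : u ∈ D.H0 ν) (hl : D.len ≤ lam) (n : D.Node) :
    ‖D.mulWeight ν 2 lam (u (n, 1))‖ ≤ D.carlemanConst lam * weightedZZNorm lam u :=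
  (norm_mulWeight_le_of_hasTrace (hasTrace_of_mem_H0 hu n 1) (len_pos.trans_le hl)).trans
    (mul_le_mul_of_nonneg_left (norm_mulWeight_two_le hu n) (carlemanConst_nonneg _))

theorem norm_mulWeight_one_le_weightedZZNorm (hu : u ∈ D.H0 ν) (hl : D.len ≤ lam) (n : D.Node) :
    ‖D.mulWeight ν 2 lam (u (n, 1))‖ ≤ weightedZZNorm lam u :=
  (norm_mulWeight_one_le hu hl n).trans
    (mul_le_of_le_one_left (weightedZZNorm_nonneg _ _) (carlemanConst_le_one hl))

theorem norm_mulWeight_zero_le (hu : u ∈ D.H0 ν) (hl : D.len ≤ lam) (n : D.Node) :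
    ‖D.mulWeight ν 2 lam (u (n, 0))‖ ≤ D.carlemanConst lam * weightedZZNorm lam u :=
  (norm_mulWeight_le_of_hasTrace (hasTrace_of_mem_H0 hu n 0) (len_pos.trans_le hl)).trans
    (mul_le_mul_of_nonneg_left (norm_mulWeight_one_le_weightedZZNorm hu hl n)
      (carlemanConst_nonneg _))

theorem norm_mulWeight_gradCLM_le (hu : u ∈ D.H0 ν) (hl : D.len ≤ lam) (i : D.Inner) (m : Fin 3) :
    ‖D.mulWeight ν 2 lam (gradCLM ν 0 i m u)‖
      ≤ D.gridConst * (D.carlemanConst lam * weightedZZNorm lam u) :=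
  norm_map_gradCLM_le _ 0 i (norm_mulWeight_zero_le hu hl) (norm_mulWeight_one_le hu hl) m

theorem norm_mulWeight_gradCLM_one_le (hu : u ∈ D.H0 ν) (hl : D.len ≤ lam) (i : D.Inner)
    (m : Fin 3) :
    ‖D.mulWeight ν 2 lam (gradCLM ν 1 i m u)‖ ≤ D.gridConst * weightedZZNorm lam u :=
  norm_map_gradCLM_le _ 1 i (norm_mulWeight_one_le_weightedZZNorm hu hl)
    (norm_mulWeight_two_le hu) m

theorem norm_mulWeight_lapLowCLM_le (hu : u ∈ D.H0 ν) (hl : D.len ≤ lam) (i : D.Inner) :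
    ‖D.mulWeight ν 2 lam (lapLowCLM ν i u)‖
      ≤ D.gridConst * (D.carlemanConst lam * weightedZZNorm lam u) := by
  refine (norm_map_lapLowCLM_le _ i (norm_mulWeight_zero_le hu hl)).trans
    (mul_le_mul_of_nonneg_right ?_
      (mul_nonneg (carlemanConst_nonneg _) (weightedZZNorm_nonneg _ _)))
  have : 0 ≤ D.h⁻¹ := inv_nonneg.2 h_pos.le
  unfold gridConst
  linarith

/-- The number of components of an element of `Jet 2`. -/
def jetCard (D : Config) : ℝ := Fintype.card (D.Node × Fin 3)

theorem jetCard_pos : 0 < D.jetCard := by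
  unfold jetCard
  exact_mod_cast Fintype.card_pos

theorem norm_sq_le_weightedZZNorm (hu : u ∈ D.H0 ν) (hl : D.len ≤ lam) :
    ‖u‖ ^ 2 ≤ D.jetCard * weightedZZNorm lam u ^ 2 := by
  have hl0 : 0 ≤ lam := len_pos.le.trans hl
  rw [PiLp.norm_sq_eq_of_L2]
  have h1 : ∀ p : D.Node × Fin 3, ‖u p‖ ^ 2 ≤ weightedZZNorm lam u ^ 2 := by
    rintro ⟨n, r⟩
    refine pow_le_pow_left₀ (norm_nonneg _) ((norm_le_norm_mulWeight hl0 _).trans ?_) 2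
    fin_cases r
    · exact (norm_mulWeight_zero_le hu hl n).trans
        (mul_le_of_le_one_left (weightedZZNorm_nonneg _ _) (carlemanConst_le_one hl))
    · exact norm_mulWeight_one_le_weightedZZNorm hu hl n
    · exact norm_mulWeight_two_le hu n
  calc _ ≤ ∑ _p : D.Node × Fin 3, weightedZZNorm lam u ^ 2 := Finset.sum_le_sum fun p _ => h1 p
    _ = _ := by rw [Finset.sum_const, nsmul_eq_mul]; rfl

end Finite

end Config

namespace Config

variable {D : Config}

theorem ae_cylMeas_of_ae_forall {p : ℝ → ℝ → Prop}
    (h : ∀ᵐ z ∂D.zMeas, ∀ k ∈ Set.Icc D.kmin D.kmax, p k z) :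
    ∀ᵐ w ∂D.cylMeas D.kMeas, p w.1 w.2 := by
  have hk : ∀ᵐ k ∂D.kMeas, k ∈ Set.Ioo D.kmin D.kmax := ae_restrict_mem measurableSet_Ioo
  filter_upwards [ae_cylMeas_of_ae_snd (ν := D.kMeas) h, ae_cylMeas_of_ae_fst (D := D) hk]
    with w h1 h2
  exact h1 _ (Set.Ioo_subset_Icc_self h2)

theorem restrict_k_le {k : ℝ} (hk : k ∈ Set.Icc D.kmin D.kmax) :
    volume.restrict (Set.uIoc k D.kmax) ≤ D.kMeas := by
  rw [kMeas, restrict_Ioo_eq_restrict_Ioc, Set.uIoc_of_le hk.2]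
  exact Measure.restrict_mono (Set.Ioc_subset_Ioc_left hk.1) le_rfl

/-- The function `f(z) - ∫_k^{kmax} g(κ, z) dκ` of `(k, z)`, formed from components `f`, `g` of `V`,
`q` in the way in which `v` is formed from `V`, `q`. -/
def tailInt (f : Lp ℂ 2 (D.cylMeas unitMeas)) (g : Lp ℂ 2 (D.cylMeas D.kMeas))
    (k z : ℝ) : ℂ :=
  f ((), z) - ∫ κ in k..D.kmax, g (κ, z)

theorem integral_k_congr {f g : ℝ × ℝ → ℂ} (h : ∀ᵐ w ∂D.cylMeas D.kMeas, f w = g w) :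
    ∀ᵐ z ∂D.zMeas, ∀ k ∈ Set.Icc D.kmin D.kmax,
      ∫ κ in k..D.kmax, f (κ, z) = ∫ κ in k..D.kmax, g (κ, z) := by
  filter_upwards [ae_slice_swap h] with z hz k hk
  exact intervalIntegral.integral_congr_ae_restrict (ae_mono (restrict_k_le hk) hz)

theorem ae_unit_slice {p : Unit × ℝ → Prop} (h : ∀ᵐ w ∂D.cylMeas unitMeas, p w) :
    ∀ᵐ z ∂D.zMeas, p ((), z) :=
  ae_unit (p := fun κ => ∀ᵐ z ∂D.zMeas, p (κ, z)) (ae_slice h)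

theorem gradV_eq_tailInt (V : D.Jet 2 unitMeas) (q : D.Jet 2 D.kMeas) (i : D.Inner) (m : Fin 3) :
    ∀ᵐ z ∂D.zMeas, ∀ k ∈ Set.Icc D.kmin D.kmax,
      gradV V q i k z m = tailInt (gradCLM unitMeas 0 i m V) (gradCLM D.kMeas 0 i m q) k z := by
  filter_upwards [ae_unit_slice (coeFn_gradCLM i V m), integral_k_congr (coeFn_gradCLM i q m)]
    with z h1 h2 k hk
  rw [gradV, tailInt, h1, h2 k hk]

theorem lapV_eq_tailInt (V : D.Jet 2 unitMeas) (q : D.Jet 2 D.kMeas) (i : D.Inner) :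
    ∀ᵐ z ∂D.zMeas, ∀ k ∈ Set.Icc D.kmin D.kmax,
      lapV V q i k z = tailInt (lapCLM unitMeas i V) (lapCLM D.kMeas i q) k z := by
  filter_upwards [ae_unit_slice (coeFn_lapCLM i V), integral_k_congr (coeFn_lapCLM i q)]
    with z h1 h2 k hk
  rw [lapV, tailInt, h1, h2 k hk]

theorem integrable_k (g : Lp ℂ 2 (D.cylMeas D.kMeas)) :
    ∀ᵐ z ∂D.zMeas, ∀ k ∈ Set.Icc D.kmin D.kmax,
      IntervalIntegrable (fun κ => g (κ, z)) volume k D.kmax := by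
  have h1 : Integrable g (D.cylMeas D.kMeas) := (Lp.memLp g).integrable (by norm_num)
  have h2 : Integrable g (D.kMeas.prod D.zMeas) :=
    (integrable_smul_measure h_sq_ne_zero ENNReal.ofReal_ne_top).1 h1
  filter_upwards [h2.prod_left_ae] with z hz k hk
  rw [intervalIntegrable_iff]
  exact hz.mono_measure (restrict_k_le hk)

theorem tailInt_add (f f' : Lp ℂ 2 (D.cylMeas unitMeas)) (g g' : Lp ℂ 2 (D.cylMeas D.kMeas)) :
    ∀ᵐ z ∂D.zMeas, ∀ k ∈ Set.Icc D.kmin D.kmax,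
      tailInt (f + f') (g + g') k z = tailInt f g k z + tailInt f' g' k z := by
  filter_upwards [ae_unit_slice (Lp.coeFn_add f f'), integral_k_congr (Lp.coeFn_add g g'),
    integrable_k g, integrable_k g'] with z h1 h2 h3 h4 k hk
  simp only [tailInt, h1, h2 k hk, Pi.add_apply]
  rw [intervalIntegral.integral_add (h3 k hk) (h4 k hk)]
  ring

theorem tailInt_smul (c : ℝ) (f : Lp ℂ 2 (D.cylMeas unitMeas))
    (g : Lp ℂ 2 (D.cylMeas D.kMeas)) :
    ∀ᵐ z ∂D.zMeas, ∀ k ∈ Set.Icc D.kmin D.kmax,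
      tailInt (c • f) (c • g) k z = c • tailInt f g k z := by
  filter_upwards [ae_unit_slice (Lp.coeFn_smul c f), integral_k_congr (Lp.coeFn_smul c g)]
    with z h1 h2 k hk
  simp only [tailInt, h1, h2 k hk, Pi.smul_apply]
  rw [intervalIntegral.integral_smul, smul_sub]

theorem tailInt_mulWeight (lam : ℝ) (g : Lp ℂ 2 (D.cylMeas D.kMeas)) :
    ∀ᵐ z ∂D.zMeas, ∀ k ∈ Set.Icc D.kmin D.kmax,
      D.weight lam z * tailInt 0 g k z = -∫ κ in k..D.kmax, D.mulWeight D.kMeas 2 lam g (κ, z) := by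
  filter_upwards [ae_unit_slice (Lp.coeFn_zero ℂ 2 (D.cylMeas unitMeas)),
    integral_k_congr (coeFn_mulWeight lam g)] with z h1 h2 k hk
  rw [h2 k hk, intervalIntegral.integral_const_mul, tailInt, h1]
  simp

theorem norm_tailInt_le {f f' : Lp ℂ 2 (D.cylMeas unitMeas)} {g g' : Lp ℂ 2 (D.cylMeas D.kMeas)}
    (hf : D.IsZDeriv unitMeas f f') (hg : D.IsZDeriv D.kMeas g g') :
    ∀ᵐ z ∂D.zMeas, ∀ k ∈ Set.Icc D.kmin D.kmax,
      ‖tailInt f g k z‖ ≤ D.sobolevConst * (‖f‖ + ‖f'‖) + D.sobolevConst * (‖g‖ + ‖g'‖) := by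
  filter_upwards [norm_unit_le hf, norm_integral_k_le hg] with z h1 h2 k hk
  exact (norm_sub_le _ _).trans (add_le_add h1 (h2 k hk))

theorem stronglyMeasurable_tailInt (f : Lp ℂ 2 (D.cylMeas unitMeas))
    (g : Lp ℂ 2 (D.cylMeas D.kMeas)) :
    StronglyMeasurable fun w : ℝ × ℝ => tailInt f g w.1 w.2 := by
  refine ((Lp.stronglyMeasurable f).comp_measurable (by fun_prop)).sub
    (stronglyMeasurable_intervalIntegral (f := fun p : (ℝ × ℝ) × ℝ => g (p.2, p.1.2))
      ((Lp.stronglyMeasurable g).comp_measurable (by fun_prop)) measurable_fst measurable_const)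

variable (D) in
/-- The space of pairs `(V, q)` of a tail function and a solution of the integro-differential
equation, with the maximum of the two norms. -/
abbrev Pairs : Type := D.H 2 unitMeas × D.H 2 D.kMeas

/-- The factor by which the weighted supremum norm of `∫_k^{kmax} f dκ` exceeds `carlemanConst`
times the weighted `L²` norm of `∂_z f`. -/
def kIntegralConst (D : Config) : ℝ := √((D.kmax - D.kmin) / D.h ^ 2 / D.len)

/-- A common bound for the supremum norm of `∇^h v` in terms of the norm of `(V, q)` and for its
weighted supremum norm in terms of the weighted norm of `q_zz`. -/
def gradConst (D : Config) : ℝ := (4 * D.sobolevConst + D.kIntegralConst) * D.gridConst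

theorem gridConst_nonneg : 0 ≤ D.gridConst := zero_le_one.trans one_le_gridConst

theorem gradConst_nonneg : 0 ≤ D.gradConst :=
  mul_nonneg (add_nonneg (mul_nonneg zero_le_four sobolevConst_nonneg) (Real.sqrt_nonneg _))
    gridConst_nonneg

theorem norm_tailInt_gradCLM_le (i : D.Inner) (m : Fin 3) (x : Pairs D) :
    ∀ᵐ z ∂D.zMeas, ∀ k ∈ Set.Icc D.kmin D.kmax,
      ‖tailInt (gradCLM unitMeas 0 i m x.1.1) (gradCLM D.kMeas 0 i m x.2.1) k z‖
        ≤ D.gradConst * ‖x‖ := by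
  filter_upwards [norm_tailInt_le (isZDeriv_gradCLM x.1.2 i m) (isZDeriv_gradCLM x.2.2 i m)]
    with z hz k hk
  have hg := gridConst_nonneg (D := D)
  have hV : ∀ r, ‖gradCLM unitMeas r i m x.1.1‖ ≤ D.gridConst * ‖x‖ := fun r =>
    (norm_gradCLM_le r i m x.1.1).trans (mul_le_mul_of_nonneg_left (norm_fst_le x) hg)
  have hq : ∀ r, ‖gradCLM D.kMeas r i m x.2.1‖ ≤ D.gridConst * ‖x‖ := fun r =>
    (norm_gradCLM_le r i m x.2.1).trans (mul_le_mul_of_nonneg_left (norm_snd_le x) hg)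
  have hS := sobolevConst_nonneg (D := D)
  have hI : 0 ≤ D.kIntegralConst * D.gridConst * ‖x‖ :=
    mul_nonneg (mul_nonneg (Real.sqrt_nonneg _) hg) (norm_nonneg x)
  refine (hz k hk).trans ((add_le_add (mul_le_mul_of_nonneg_left (add_le_add (hV 0) (hV 1)) hS)
    (mul_le_mul_of_nonneg_left (add_le_add (hq 0) (hq 1)) hS)).trans ?_)
  unfold gradConst
  linarith

theorem norm_gradV_le (i : D.Inner) (m : Fin 3) (x : Pairs D) :
    ∀ᵐ z ∂D.zMeas, ∀ k ∈ Set.Icc D.kmin D.kmax,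
      ‖gradV x.1.1 x.2.1 i k z m‖ ≤ D.gradConst * ‖x‖ := by
  filter_upwards [norm_tailInt_gradCLM_le i m x, gradV_eq_tailInt x.1.1 x.2.1 i m] with z h1 h2 k hk
  rw [h2 k hk]
  exact h1 k hk

theorem memLp_tailInt (i : D.Inner) (m : Fin 3) (x : Pairs D) :
    MemLp (fun w : ℝ × ℝ =>
      tailInt (gradCLM unitMeas 0 i m x.1.1) (gradCLM D.kMeas 0 i m x.2.1) w.1 w.2)
      ∞ (D.cylMeas D.kMeas) :=
  memLp_top_of_bound (stronglyMeasurable_tailInt _ _).aestronglyMeasurable _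
    (ae_cylMeas_of_ae_forall (norm_tailInt_gradCLM_le i m x))

/-- The components of `∇^h v` as bounded functions of `(k, z)`, depending linearly on `(V, q)`. -/
def gradVInf (i : D.Inner) (m : Fin 3) :
    Pairs D →L[ℝ] Lp ℂ ∞ (D.cylMeas D.kMeas) :=
  LinearMap.mkContinuous
    { toFun := fun x => (memLp_tailInt i m x).toLp
      map_add' := fun x y => by
        rw [← MemLp.toLp_add]
        refine MemLp.toLp_congr _ _ ?_
        have h := ae_cylMeas_of_ae_forall (tailInt_add (gradCLM unitMeas 0 i m x.1.1)
          (gradCLM unitMeas 0 i m y.1.1) (gradCLM D.kMeas 0 i m x.2.1)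
          (gradCLM D.kMeas 0 i m y.2.1))
        filter_upwards [h] with w hw
        simpa using hw
      map_smul' := fun c x => by
        rw [RingHom.id_apply, ← MemLp.toLp_const_smul]
        refine MemLp.toLp_congr _ _ ?_
        have h := ae_cylMeas_of_ae_forall (tailInt_smul c (gradCLM unitMeas 0 i m x.1.1)
          (gradCLM D.kMeas 0 i m x.2.1))
        filter_upwards [h] with w hw
        simpa using hw }
    D.gradConst (fun x => norm_toLp_top_le (memLp_tailInt i m x)
      (mul_nonneg gradConst_nonneg (norm_nonneg _))
      (ae_cylMeas_of_ae_forall (norm_tailInt_gradCLM_le i m x)))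

theorem gradVInf_apply (i : D.Inner) (m : Fin 3) (x : Pairs D) :
    gradVInf i m x = (memLp_tailInt i m x).toLp := rfl

theorem norm_gradVInf_le (i : D.Inner) (m : Fin 3) (x : Pairs D) :
    ‖gradVInf i m x‖ ≤ D.gradConst * ‖x‖ := by
  rw [gradVInf_apply]
  exact norm_toLp_top_le _ (mul_nonneg gradConst_nonneg (norm_nonneg _))
    (ae_cylMeas_of_ae_forall (norm_tailInt_gradCLM_le i m x))

theorem coeFn_gradVInf_eq_tailInt (i : D.Inner) (m : Fin 3) (x : Pairs D) :
    ∀ᵐ w ∂D.cylMeas D.kMeas, gradVInf i m x w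
      = tailInt (gradCLM unitMeas 0 i m x.1.1) (gradCLM D.kMeas 0 i m x.2.1) w.1 w.2 := by
  rw [gradVInf_apply]
  exact (memLp_tailInt i m x).coeFn_toLp

theorem coeFn_gradVInf (i : D.Inner) (m : Fin 3) (x : Pairs D) :
    ∀ᵐ w ∂D.cylMeas D.kMeas, gradVInf i m x w = gradV x.1.1 x.2.1 i w.1 w.2 m := by
  filter_upwards [coeFn_gradVInf_eq_tailInt i m x,
    ae_cylMeas_of_ae_forall (gradV_eq_tailInt x.1.1 x.2.1 i m)] with w h1 h2
  rw [h1, h2]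

variable (D) in
/-- The inclusion `r ↦ (0, r)` of `H_{0,2}^h` into the space of pairs. -/
def incl : D.H0 D.kMeas →L[ℝ] Pairs D :=
  (0 : D.H0 D.kMeas →L[ℝ] D.H 2 unitMeas).prod
    ((Submodule.inclusion (H0_le_H (D := D) (ν := D.kMeas))).mkContinuous 1
      (fun r => by rw [one_mul]; rfl))

theorem incl_fst (r : D.H0 D.kMeas) : (incl D r).1 = 0 := rfl

theorem incl_snd (r : D.H0 D.kMeas) : ((incl D r).2 : D.Jet 2 D.kMeas) = r := rfl

theorem coe_fst_add_incl (x : Pairs D) (p : D.H0 D.kMeas) :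
    ((x + incl D p).1 : D.Jet 2 unitMeas) = x.1 := by
  rw [Prod.fst_add, incl_fst, add_zero]

theorem coe_snd_add_incl (x : Pairs D) (p : D.H0 D.kMeas) :
    ((x + incl D p).2 : D.Jet 2 D.kMeas) = p + x.2 := by
  rw [Prod.snd_add, Submodule.coe_add, incl_snd, add_comm]

theorem norm_incl (r : D.H0 D.kMeas) : ‖incl D r‖ = ‖r‖ := by
  rw [Prod.norm_def, incl_fst, norm_zero, max_eq_right (norm_nonneg _)]
  rfl

theorem sqrt_eq_kIntegralConst_mul_carlemanConst {lam : ℝ} :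
    √((D.kmax - D.kmin) / D.h ^ 2 / (2 * lam)) = D.kIntegralConst * D.carlemanConst lam := by
  have hlen := len_pos (D := D)
  have hK : 0 < D.kmax - D.kmin := sub_pos.2 D.k_lt
  rw [kIntegralConst, carlemanConst, ← Real.sqrt_mul (by positivity)]
  congr 1
  field_simp

theorem norm_mulWeight_gradVInf_le {lam : ℝ} (hl : D.len ≤ lam) (r : D.H0 D.kMeas) (i : D.Inner)
    (m : Fin 3) :
    ‖D.mulWeight D.kMeas ∞ lam (gradVInf i m (incl D r))‖
      ≤ D.gradConst * (D.carlemanConst lam * weightedZZNorm lam (r : D.Jet 2 D.kMeas)) := by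
  have hr : 0 ≤ D.carlemanConst lam * weightedZZNorm lam (r : D.Jet 2 D.kMeas) :=
    mul_nonneg (carlemanConst_nonneg _) (weightedZZNorm_nonneg _ _)
  refine norm_Lp_top_le (mul_nonneg gradConst_nonneg hr) ?_
  filter_upwards [coeFn_mulWeight lam (gradVInf i m (incl D r)),
    coeFn_gradVInf_eq_tailInt i m (incl D r),
    ae_cylMeas_of_ae_forall (tailInt_mulWeight lam (gradCLM D.kMeas 0 i m (r : D.Jet 2 D.kMeas))),
    ae_cylMeas_of_ae_forall
      (norm_integral_k_mulWeight_le (hasTrace_gradCLM r.2 i m) (len_pos.trans_le hl))]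
    with w h1 h2 h3 h4
  rw [h1, h2, incl_fst, incl_snd, Submodule.coe_zero, map_zero, h3, norm_neg]
  refine h4.trans ((mul_le_mul_of_nonneg_left (norm_mulWeight_gradCLM_one_le r.2 hl i m)
    (Real.sqrt_nonneg _)).trans ?_)
  rw [sqrt_eq_kIntegralConst_mul_carlemanConst]
  have hS := mul_nonneg
    (mul_nonneg (sobolevConst_nonneg (D := D)) (gridConst_nonneg (D := D))) hr
  unfold gradConst
  linarith

end Config

namespace Config

variable {D : Config}

theorem kmax_pos : 0 < D.kmax := D.kmin_pos.trans D.k_lt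

theorem ae_norm_k_le : ∀ᵐ w ∂D.cylMeas D.kMeas, ‖((w.1 : ℝ) : ℂ)‖ ≤ D.kmax :=
  ae_cylMeas_of_ae_forall (p := fun k _ => ‖(k : ℂ)‖ ≤ D.kmax) <|
    Filter.Eventually.of_forall fun _ k hk => by
      rw [Complex.norm_real, Real.norm_of_nonneg (D.kmin_pos.le.trans hk.1)]
      exact hk.2

theorem memLp_k : MemLp (fun w : ℝ × ℝ => (w.1 : ℂ)) ∞ (D.cylMeas D.kMeas) :=
  memLp_top_of_bound (by fun_prop) _ ae_norm_k_le

/-- The wave number `k` as a bounded function of `(k, z)`. -/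
def waveNumber (D : Config) : Lp ℂ ∞ (D.cylMeas D.kMeas) := memLp_k.toLp

theorem norm_waveNumber_le : ‖D.waveNumber‖ ≤ D.kmax := norm_toLp_top_le _ kmax_pos.le ae_norm_k_le

theorem coeFn_waveNumber : ∀ᵐ w ∂D.cylMeas D.kMeas, D.waveNumber w = (w.1 : ℂ) :=
  memLp_k.coeFn_toLp

/-- The constant `c` as a bounded function. -/
def constInf (D : Config) (c : ℂ) : Lp ℂ ∞ (D.cylMeas D.kMeas) := (memLp_const c).toLp

theorem norm_constInf_le (c : ℂ) : ‖D.constInf c‖ ≤ ‖c‖ :=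
  norm_toLp_top_le _ (norm_nonneg _) (Filter.Eventually.of_forall fun _ => le_rfl)

theorem norm_constInf_two_le : ‖D.constInf 2‖ ≤ 2 := (norm_constInf_le 2).trans (by simp)

theorem norm_constInf_two_mul_I_le : ‖D.constInf (2 * Complex.I)‖ ≤ 2 :=
  (norm_constInf_le _).trans (by simp)

theorem coeFn_constInf (c : ℂ) : ∀ᵐ w ∂D.cylMeas D.kMeas, D.constInf c w = c :=
  (memLp_const c).coeFn_toLp

/-- The constant `1` as a square integrable function; multiplication by it embeds `L^∞` into
`L²`. -/
def oneL2 (D : Config) : Lp ℂ 2 (D.cylMeas D.kMeas) := (memLp_const 1).toLp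

theorem coeFn_oneL2 : ∀ᵐ w ∂D.cylMeas D.kMeas, D.oneL2 w = 1 := (memLp_const 1).coeFn_toLp

/-- Multiplication of square integrable functions of `(k, z)` by bounded ones. -/
abbrev mulL2 (D : Config) : Lp ℂ ∞ (D.cylMeas D.kMeas) →L[ℝ]
    Lp ℂ 2 (D.cylMeas D.kMeas) →L[ℝ] Lp ℂ 2 (D.cylMeas D.kMeas) :=
  mulLp (D.cylMeas D.kMeas) 2

variable (D) in
/-- The component `q` of a pair `(V, q)`. -/
def fieldCLM : Pairs D →L[ℝ] D.Jet 2 D.kMeas :=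
  (D.H 2 D.kMeas).subtypeL.comp (ContinuousLinearMap.snd ℝ _ _)

/-- The components of `k ∇^h q + ∇^h v`. -/
def flux (i : D.Inner) (m : Fin 3) : Pairs D →L[ℝ] Lp ℂ 2 (D.cylMeas D.kMeas) :=
  (D.mulL2 D.waveNumber).comp ((gradCLM D.kMeas 0 i m).comp (fieldCLM D))
    + (D.mulL2.flip D.oneL2).comp (gradVInf i m)

theorem flux_apply (i : D.Inner) (m : Fin 3) (x : Pairs D) :
    flux i m x = D.mulL2 D.waveNumber (gradCLM D.kMeas 0 i m x.2.1)
      + D.mulL2 (gradVInf i m x) D.oneL2 := rfl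

/-- The components of `2k (k ∇^h q + ∇^h v)`. -/
def kFlux (i : D.Inner) (m : Fin 3) : Pairs D →L[ℝ] Lp ℂ 2 (D.cylMeas D.kMeas) :=
  (D.mulL2 (D.constInf 2)).comp ((D.mulL2 D.waveNumber).comp (flux i m))

theorem kFlux_apply (i : D.Inner) (m : Fin 3) (x : Pairs D) :
    kFlux i m x = D.mulL2 (D.constInf 2) (D.mulL2 D.waveNumber (flux i m x)) := rfl

/-- The quadratic part of `L^h`, as a bilinear map; it is not symmetric. -/
def quadPart (i : D.Inner) :
    Pairs D →L[ℝ] Pairs D →L[ℝ] Lp ℂ 2 (D.cylMeas D.kMeas) :=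
  ∑ m : Fin 3, D.mulL2.bilinearComp (gradVInf i m) (kFlux i m)

theorem quadPart_apply (i : D.Inner) (x y : Pairs D) :
    quadPart i x y = ∑ m : Fin 3, D.mulL2 (gradVInf i m x) (kFlux i m y) := by
  simp only [quadPart, _root_.sum_apply]
  rfl

/-- The linear part of `L^h` without the term `q_zz`, which dominates all the others. -/
def linLowPart (i : D.Inner) : Pairs D →L[ℝ] Lp ℂ 2 (D.cylMeas D.kMeas) :=
  (lapLowCLM D.kMeas i).comp (fieldCLM D)
    + (D.mulL2 (D.constInf (2 * Complex.I))).comp (flux i 2)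

theorem linLowPart_apply (i : D.Inner) (x : Pairs D) :
    linLowPart i x
      = lapLowCLM D.kMeas i x.2.1 + D.mulL2 (D.constInf (2 * Complex.I)) (flux i 2 x) := rfl

/-- The linear part of `L^h`. -/
def linPart (i : D.Inner) : Pairs D →L[ℝ] Lp ℂ 2 (D.cylMeas D.kMeas) :=
  (component D.kMeas (ctr i) 2).comp (fieldCLM D) + linLowPart i

theorem linPart_apply (i : D.Inner) (x : Pairs D) :
    linPart i x = (x.2 : D.Jet 2 D.kMeas) (ctr i, 2) + linLowPart i x := rfl

theorem linPart_eq_lapCLM_add (i : D.Inner) (x : Pairs D) :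
    linPart i x
      = lapCLM D.kMeas i x.2.1 + D.mulL2 (D.constInf (2 * Complex.I)) (flux i 2 x) := by
  rw [linPart_apply, linLowPart_apply, lapCLM, _root_.add_apply, component_apply, add_assoc]

/-- The operator `L^h` on pairs `(V, q)`. -/
def lhPair (i : D.Inner) (x : Pairs D) : Lp ℂ 2 (D.cylMeas D.kMeas) :=
  linPart i x + quadPart i x x

theorem coeFn_flux (i : D.Inner) (m : Fin 3) (x : Pairs D) :
    ∀ᵐ w ∂D.cylMeas D.kMeas, flux i m x w
      = (w.1 : ℂ) * gradH x.2.1 i w m + gradV x.1.1 x.2.1 i w.1 w.2 m := by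
  rw [flux_apply]
  filter_upwards [Lp.coeFn_add (D.mulL2 D.waveNumber (gradCLM D.kMeas 0 i m x.2.1))
      (D.mulL2 (gradVInf i m x) D.oneL2),
    coeFn_mulLp D.waveNumber (gradCLM D.kMeas 0 i m x.2.1), coeFn_mulLp (gradVInf i m x) D.oneL2,
    coeFn_waveNumber, coeFn_gradCLM i x.2.1 m, coeFn_gradVInf i m x, coeFn_oneL2]
    with w h1 h2 h3 h4 h5 h6 h7
  rw [h1, Pi.add_apply, h2, h3, h4, h5, h6, h7, mul_one]

theorem coeFn_linPart (i : D.Inner) (x : Pairs D) :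
    ∀ᵐ w ∂D.cylMeas D.kMeas, linPart i x w = lapH x.2.1 i w
      + 2 * Complex.I * ((w.1 : ℂ) * gradH x.2.1 i w 2 + gradV x.1.1 x.2.1 i w.1 w.2 2) := by
  rw [linPart_eq_lapCLM_add]
  filter_upwards [Lp.coeFn_add (lapCLM D.kMeas i x.2.1)
      (D.mulL2 (D.constInf (2 * Complex.I)) (flux i 2 x)), coeFn_lapCLM i x.2.1,
    coeFn_mulLp (D.constInf (2 * Complex.I)) (flux i 2 x), coeFn_flux i 2 x,
    coeFn_constInf (D := D) (2 * Complex.I)] with w h1 h2 h3 h4 h5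
  rw [h1, Pi.add_apply, h2, h3, h4, h5]

theorem coeFn_mulL2_gradVInf_kFlux (i : D.Inner) (m : Fin 3) (x : Pairs D) :
    ∀ᵐ w ∂D.cylMeas D.kMeas, D.mulL2 (gradVInf i m x) (kFlux i m x) w
      = gradV x.1.1 x.2.1 i w.1 w.2 m * (2 * ((w.1 : ℂ) *
        ((w.1 : ℂ) * gradH x.2.1 i w m + gradV x.1.1 x.2.1 i w.1 w.2 m))) := by
  filter_upwards [coeFn_mulLp (gradVInf i m x) (kFlux i m x),
    coeFn_mulLp (D.constInf 2) (D.mulL2 D.waveNumber (flux i m x)),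
    coeFn_mulLp D.waveNumber (flux i m x), coeFn_flux i m x, coeFn_gradVInf i m x,
    coeFn_waveNumber, coeFn_constInf (D := D) 2] with w h1 h2 h3 h4 h5 h6 h7
  rw [h1, kFlux_apply, h2, h3, h4, h5, h6, h7]

theorem coeFn_quadPart (i : D.Inner) (x : Pairs D) :
    ∀ᵐ w ∂D.cylMeas D.kMeas, quadPart i x x w = 2 * (w.1 : ℂ) *
      (gradV x.1.1 x.2.1 i w.1 w.2 ⬝ᵥ
        ((w.1 : ℂ) • gradH x.2.1 i w + gradV x.1.1 x.2.1 i w.1 w.2)) := by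
  set f : Fin 3 → Lp ℂ 2 (D.cylMeas D.kMeas) := fun m => D.mulL2 (gradVInf i m x) (kFlux i m x)
  have hsum : quadPart i x x = f 0 + f 1 + f 2 := by rw [quadPart_apply, Fin.sum_univ_three]
  rw [hsum]
  filter_upwards [Lp.coeFn_add (f 0 + f 1) (f 2), Lp.coeFn_add (f 0) (f 1),
    coeFn_mulL2_gradVInf_kFlux i 0 x, coeFn_mulL2_gradVInf_kFlux i 1 x,
    coeFn_mulL2_gradVInf_kFlux i 2 x] with w h1 h2 q0 q1 q2
  rw [h1, Pi.add_apply, h2, Pi.add_apply, q0, q1, q2]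
  simp only [dotProduct, Fin.sum_univ_three, Pi.add_apply, Pi.smul_apply, smul_eq_mul]
  ring

theorem coeFn_lhPair (i : D.Inner) (x : Pairs D) :
    ∀ᵐ w ∂D.cylMeas D.kMeas, lhPair i x w = Lh x.1.1 x.2.1 i w := by
  filter_upwards [Lp.coeFn_add (linPart i x) (quadPart i x x), coeFn_linPart i x,
    coeFn_quadPart i x] with w h1 h2 h3
  rw [lhPair, h1, Pi.add_apply, h2, h3, Lh, add_right_comm]

section

variable {lam : ℝ}

theorem mulWeight_mulL2_left (f : Lp ℂ ∞ (D.cylMeas D.kMeas)) (u : Lp ℂ 2 (D.cylMeas D.kMeas)) :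
    D.mulWeight D.kMeas 2 lam (D.mulL2 f u) = D.mulL2 (D.mulWeight D.kMeas ∞ lam f) u :=
  mulLp_mulLp _ _ _

theorem mulWeight_mulL2_right (f : Lp ℂ ∞ (D.cylMeas D.kMeas)) (u : Lp ℂ 2 (D.cylMeas D.kMeas)) :
    D.mulWeight D.kMeas 2 lam (D.mulL2 f u) = D.mulL2 f (D.mulWeight D.kMeas 2 lam u) :=
  mulLp_comm _ _ _

theorem norm_mulL2_le_of_le {f : Lp ℂ ∞ (D.cylMeas D.kMeas)} {u : Lp ℂ 2 (D.cylMeas D.kMeas)}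
    {a b : ℝ} (hf : ‖f‖ ≤ a) (hu : ‖u‖ ≤ b) : ‖D.mulL2 f u‖ ≤ a * b :=
  (norm_mulLp_le f u).trans (mul_le_mul hf hu (norm_nonneg _) ((norm_nonneg _).trans hf))

theorem norm_sum_mulL2_le_of_le {f : Fin 3 → Lp ℂ ∞ (D.cylMeas D.kMeas)}
    {u : Fin 3 → Lp ℂ 2 (D.cylMeas D.kMeas)} {C s t : ℝ} (hf : ∀ m, ‖f m‖ ≤ C * s)
    (hu : ∀ m, ‖u m‖ ≤ C * t) : ‖∑ m, D.mulL2 (f m) (u m)‖ ≤ 3 * C ^ 2 * (s * t) :=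
  calc _ ≤ ∑ _m : Fin 3, C * s * (C * t) :=
        norm_sum_le_of_le _ fun m _ => norm_mulL2_le_of_le (hf m) (hu m)
    _ = _ := by
        rw [Finset.sum_const, Finset.card_fin, nsmul_eq_mul, Nat.cast_ofNat]
        ring

/-- A bound for the components of `k ∇^h q + ∇^h v` in terms of the norm of `(V, q)`, and of the
weighted ones in terms of `lowSize`. -/
def fluxConst (D : Config) : ℝ := D.kmax * D.gridConst + D.gradConst * ‖D.oneL2‖

theorem fluxConst_nonneg : 0 ≤ D.fluxConst :=
  add_nonneg (mul_nonneg kmax_pos.le gridConst_nonneg) (mul_nonneg gradConst_nonneg (norm_nonneg _))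

/-- A common bound for the linear and quadratic parts of `L^h`, with and without weight. -/
def opConst (D : Config) : ℝ :=
  1 + D.gridConst + D.gradConst + (2 + 2 * D.kmax) * D.fluxConst

theorem opConst_eq : D.opConst
    = 1 + D.gridConst + D.gradConst + 2 * D.fluxConst + 2 * (D.kmax * D.fluxConst) := by
  unfold opConst
  ring

theorem kmax_mul_fluxConst_nonneg : 0 ≤ D.kmax * D.fluxConst :=
  mul_nonneg kmax_pos.le fluxConst_nonneg

theorem opConst_nonneg : 0 ≤ D.opConst := by
  linarith [gridConst_nonneg (D := D), gradConst_nonneg (D := D), fluxConst_nonneg (D := D),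
    kmax_mul_fluxConst_nonneg (D := D), opConst_eq (D := D)]

theorem gradConst_le_opConst : D.gradConst ≤ D.opConst := by
  linarith [gridConst_nonneg (D := D), fluxConst_nonneg (D := D),
    kmax_mul_fluxConst_nonneg (D := D), opConst_eq (D := D)]

theorem gridConst_add_two_mul_fluxConst_le_opConst :
    D.gridConst + 2 * D.fluxConst ≤ D.opConst := by
  linarith [gradConst_nonneg (D := D), kmax_mul_fluxConst_nonneg (D := D), opConst_eq (D := D)]

theorem two_mul_kmax_mul_fluxConst_le_opConst : 2 * (D.kmax * D.fluxConst) ≤ D.opConst := by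
  linarith [gridConst_nonneg (D := D), gradConst_nonneg (D := D), fluxConst_nonneg (D := D),
    opConst_eq (D := D)]

theorem norm_gradVInf_le_opConst_mul (i : D.Inner) (m : Fin 3) (x : Pairs D) :
    ‖gradVInf i m x‖ ≤ D.opConst * ‖x‖ :=
  (norm_gradVInf_le i m x).trans (mul_le_mul_of_nonneg_right gradConst_le_opConst (norm_nonneg _))

theorem norm_flux_le (i : D.Inner) (m : Fin 3) (x : Pairs D) :
    ‖flux i m x‖ ≤ D.fluxConst * ‖x‖ := by
  have hq : ‖D.mulL2 D.waveNumber (gradCLM D.kMeas 0 i m x.2.1)‖ ≤ D.kmax * (D.gridConst * ‖x‖) :=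
    norm_mulL2_le_of_le norm_waveNumber_le ((norm_gradCLM_le 0 i m x.2.1).trans
      (mul_le_mul_of_nonneg_left (norm_snd_le x) gridConst_nonneg))
  have hv : ‖D.mulL2 (gradVInf i m x) D.oneL2‖ ≤ D.gradConst * ‖x‖ * ‖D.oneL2‖ :=
    norm_mulL2_le_of_le (norm_gradVInf_le i m x) le_rfl
  calc _ ≤ _ := norm_add_le _ _
    _ ≤ _ := add_le_add hq hv
    _ = _ := by rw [fluxConst]; ring

theorem norm_kFlux_le (i : D.Inner) (m : Fin 3) (x : Pairs D) :
    ‖kFlux i m x‖ ≤ D.opConst * ‖x‖ :=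
  calc _ ≤ 2 * (D.kmax * (D.fluxConst * ‖x‖)) := norm_mulL2_le_of_le norm_constInf_two_le
        (norm_mulL2_le_of_le norm_waveNumber_le (norm_flux_le i m x))
    _ = 2 * (D.kmax * D.fluxConst) * ‖x‖ := by ring
    _ ≤ _ := mul_le_mul_of_nonneg_right two_mul_kmax_mul_fluxConst_le_opConst (norm_nonneg _)

theorem norm_quadPart_le (i : D.Inner) (x y : Pairs D) :
    ‖quadPart i x y‖ ≤ 3 * D.opConst ^ 2 * (‖x‖ * ‖y‖) := by
  rw [quadPart_apply]
  exact norm_sum_mulL2_le_of_le (fun m => norm_gradVInf_le_opConst_mul i m x)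
    fun m => norm_kFlux_le i m y

theorem norm_linPart_le (i : D.Inner) (x : Pairs D) : ‖linPart i x‖ ≤ D.opConst * ‖x‖ := by
  have hlap : ‖lapCLM D.kMeas i x.2.1‖ ≤ D.gridConst * ‖x‖ :=
    (norm_lapCLM_le i _).trans (mul_le_mul_of_nonneg_left (norm_snd_le x) gridConst_nonneg)
  have hflux : ‖D.mulL2 (D.constInf (2 * Complex.I)) (flux i 2 x)‖ ≤ 2 * (D.fluxConst * ‖x‖) :=
    norm_mulL2_le_of_le norm_constInf_two_mul_I_le (norm_flux_le i 2 x)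
  rw [linPart_eq_lapCLM_add]
  calc _ ≤ _ := norm_add_le _ _
    _ ≤ (D.gridConst + 2 * D.fluxConst) * ‖x‖ := by linarith
    _ ≤ _ :=
        mul_le_mul_of_nonneg_right gridConst_add_two_mul_fluxConst_le_opConst (norm_nonneg _)

variable (r : D.H0 D.kMeas)

/-- The size which the Carleman estimate gives to the weighted lower order terms in `r`: smaller
than the weighted norm of `r_zz` by the factor `carlemanConst lam`. -/
def lowSize (lam : ℝ) (r : D.H0 D.kMeas) : ℝ :=
  D.carlemanConst lam * weightedZZNorm lam (r : D.Jet 2 D.kMeas)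

theorem lowSize_nonneg : 0 ≤ lowSize lam r :=
  mul_nonneg (carlemanConst_nonneg _) (weightedZZNorm_nonneg _ _)

theorem norm_mulWeight_gradVInf_le_opConst_mul (hl : D.len ≤ lam) (i : D.Inner) (m : Fin 3) :
    ‖D.mulWeight D.kMeas ∞ lam (gradVInf i m (incl D r))‖ ≤ D.opConst * lowSize lam r :=
  (norm_mulWeight_gradVInf_le hl r i m).trans
    (mul_le_mul_of_nonneg_right gradConst_le_opConst (lowSize_nonneg r))

theorem norm_mulWeight_flux_le (hl : D.len ≤ lam) (i : D.Inner) (m : Fin 3) :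
    ‖D.mulWeight D.kMeas 2 lam (flux i m (incl D r))‖ ≤ D.fluxConst * lowSize lam r := by
  rw [flux_apply, map_add, mulWeight_mulL2_right, mulWeight_mulL2_left, incl_snd]
  have hq : ‖D.mulL2 D.waveNumber
      (D.mulWeight D.kMeas 2 lam (gradCLM D.kMeas 0 i m (r : D.Jet 2 D.kMeas)))‖
      ≤ D.kmax * (D.gridConst * lowSize lam r) :=
    norm_mulL2_le_of_le norm_waveNumber_le (norm_mulWeight_gradCLM_le r.2 hl i m)
  have hv : ‖D.mulL2 (D.mulWeight D.kMeas ∞ lam (gradVInf i m (incl D r))) D.oneL2‖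
      ≤ D.gradConst * lowSize lam r * ‖D.oneL2‖ :=
    norm_mulL2_le_of_le (norm_mulWeight_gradVInf_le hl r i m) le_rfl
  calc _ ≤ _ := norm_add_le _ _
    _ ≤ _ := add_le_add hq hv
    _ = _ := by rw [fluxConst]; ring

theorem norm_mulWeight_kFlux_le (hl : D.len ≤ lam) (i : D.Inner) (m : Fin 3) :
    ‖D.mulWeight D.kMeas 2 lam (kFlux i m (incl D r))‖ ≤ D.opConst * lowSize lam r := by
  rw [kFlux_apply, mulWeight_mulL2_right, mulWeight_mulL2_right]
  calc _ ≤ 2 * (D.kmax * (D.fluxConst * lowSize lam r)) := norm_mulL2_le_of_le norm_constInf_two_le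
        (norm_mulL2_le_of_le norm_waveNumber_le (norm_mulWeight_flux_le r hl i m))
    _ = 2 * (D.kmax * D.fluxConst) * lowSize lam r := by ring
    _ ≤ _ := mul_le_mul_of_nonneg_right two_mul_kmax_mul_fluxConst_le_opConst (lowSize_nonneg r)

theorem norm_mulWeight_linLowPart_le (hl : D.len ≤ lam) (i : D.Inner) :
    ‖D.mulWeight D.kMeas 2 lam (linLowPart i (incl D r))‖ ≤ D.opConst * lowSize lam r := by
  have hlap : ‖D.mulWeight D.kMeas 2 lam (lapLowCLM D.kMeas i (r : D.Jet 2 D.kMeas))‖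
      ≤ D.gridConst * lowSize lam r := norm_mulWeight_lapLowCLM_le r.2 hl i
  have hflux : ‖D.mulL2 (D.constInf (2 * Complex.I))
      (D.mulWeight D.kMeas 2 lam (flux i 2 (incl D r)))‖ ≤ 2 * (D.fluxConst * lowSize lam r) :=
    norm_mulL2_le_of_le norm_constInf_two_mul_I_le (norm_mulWeight_flux_le r hl i 2)
  rw [linLowPart_apply, map_add, mulWeight_mulL2_right, incl_snd]
  calc _ ≤ _ := norm_add_le _ _
    _ ≤ (D.gridConst + 2 * D.fluxConst) * lowSize lam r := by linarith
    _ ≤ _ :=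
        mul_le_mul_of_nonneg_right gridConst_add_two_mul_fluxConst_le_opConst (lowSize_nonneg r)

theorem norm_mulWeight_quadPart_right_le (hl : D.len ≤ lam) (i : D.Inner) (x : Pairs D) :
    ‖D.mulWeight D.kMeas 2 lam (quadPart i x (incl D r))‖
      ≤ 3 * D.opConst ^ 2 * (‖x‖ * lowSize lam r) := by
  simp only [quadPart_apply, map_sum, mulWeight_mulL2_right]
  exact norm_sum_mulL2_le_of_le (fun m => norm_gradVInf_le_opConst_mul i m x)
    fun m => norm_mulWeight_kFlux_le r hl i m

theorem norm_mulWeight_quadPart_left_le (hl : D.len ≤ lam) (i : D.Inner) (x : Pairs D) :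
    ‖D.mulWeight D.kMeas 2 lam (quadPart i (incl D r) x)‖
      ≤ 3 * D.opConst ^ 2 * (lowSize lam r * ‖x‖) := by
  simp only [quadPart_apply, map_sum, mulWeight_mulL2_left]
  exact norm_sum_mulL2_le_of_le (fun m => norm_mulWeight_gradVInf_le_opConst_mul r hl i m)
    fun m => norm_kFlux_le i m x

theorem norm_mulWeight_mulWeight_quadPart_le (hl : D.len ≤ lam) (i : D.Inner) :
    ‖D.mulWeight D.kMeas 2 lam (D.mulWeight D.kMeas 2 lam (quadPart i (incl D r) (incl D r)))‖
      ≤ 3 * D.opConst ^ 2 * (lowSize lam r * lowSize lam r) := by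
  have hright : D.mulWeight D.kMeas 2 lam (quadPart i (incl D r) (incl D r)) = ∑ m : Fin 3,
      D.mulL2 (gradVInf i m (incl D r)) (D.mulWeight D.kMeas 2 lam (kFlux i m (incl D r))) := by
    simp only [quadPart_apply, map_sum, mulWeight_mulL2_right]
  rw [hright, map_sum]
  simp only [mulWeight_mulL2_left]
  exact norm_sum_mulL2_le_of_le (fun m => norm_mulWeight_gradVInf_le_opConst_mul r hl i m)
    fun m => norm_mulWeight_kFlux_le r hl i m

theorem abs_inner_mulWeight_quadPart_le (hl : D.len ≤ lam) (i : D.Inner)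
    (y : Lp ℂ 2 (D.cylMeas D.kMeas)) :
    |inner ℝ (D.mulWeight D.kMeas 2 lam y)
        (D.mulWeight D.kMeas 2 lam (quadPart i (incl D r) (incl D r)))|
      ≤ 3 * D.opConst ^ 2 * (‖y‖ * lowSize lam r ^ 2) := by
  rw [inner_mulWeight]
  calc _ ≤ _ := abs_real_inner_le_norm _ _
    _ ≤ ‖y‖ * (3 * D.opConst ^ 2 * (lowSize lam r * lowSize lam r)) :=
        mul_le_mul_of_nonneg_left (norm_mulWeight_mulWeight_quadPart_le r hl i) (norm_nonneg _)
    _ = _ := by ring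

end

end Config

section Minimization

open Filter Topology

theorem cauchySeq_of_mul_norm_sub_sq_le {E : Type*} [SeminormedAddCommGroup E] {x : ℕ → E}
    {ε : ℕ → ℝ} (hε : Tendsto ε atTop (𝓝 0)) {c : ℝ} (hc : 0 < c)
    (h : ∀ m n, c * ‖x m - x n‖ ^ 2 ≤ ε m + ε n) : CauchySeq x := by
  refine Metric.cauchySeq_iff.2 fun r hr => ?_
  obtain ⟨N, hN⟩ := eventually_atTop.1 (hε.eventually_lt_const (by positivity : 0 < c * r ^ 2 / 2))
  refine ⟨N, fun m hm n hn => ?_⟩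
  have hsq : c * ‖x m - x n‖ ^ 2 < c * r ^ 2 := by linarith [h m n, hN m hm, hN n hn]
  rw [dist_eq_norm]
  exact lt_of_pow_lt_pow_left₀ 2 hr.le (lt_of_mul_lt_mul_left hsq hc.le)

section UniformConvexity

variable {X : Type} [NormedAddCommGroup X] {S : Set X} {J : X → ℝ} {c : ℝ}

theorem isUniqueMinOn_of_add_mul_norm_sub_sq_le (hc : 0 < c) {a : X} (ha : a ∈ S)
    (hgrowth : ∀ y ∈ S, J a + c * ‖a - y‖ ^ 2 ≤ J y) : IsUniqueMinOn J S a := by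
  refine ⟨ha, fun y hy hne => ?_⟩
  have hpos : 0 < ‖a - y‖ := norm_pos_iff.2 (sub_ne_zero.2 hne.symm)
  exact (lt_add_of_pos_right _ (by positivity)).trans_le (hgrowth y hy)

variable [NormedSpace ℝ X] [CompleteSpace X]

theorem exists_add_mul_norm_sub_sq_le_of_midpoint (hS : IsClosed S) (hconv : Convex ℝ S)
    (hne : S.Nonempty) (hJ : Continuous J) (hbdd : BddBelow (J '' S)) (hc : 0 < c)
    (hmid : ∀ x ∈ S, ∀ y ∈ S, c * ‖x - y‖ ^ 2 ≤ J x + J y - 2 * J (midpoint ℝ x y)) :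
    ∃ a ∈ S, ∀ y ∈ S, J a + c * ‖a - y‖ ^ 2 ≤ J y := by
  set m := sInf (J '' S)
  have hle : ∀ x ∈ S, m ≤ J x := fun x hx => csInf_le hbdd ⟨x, hx, rfl⟩
  have hgap : ∀ x ∈ S, ∀ y ∈ S, c * ‖x - y‖ ^ 2 ≤ (J x - m) + (J y - m) := fun x hx y hy => by
    linarith [hmid x hx y hy, hle _ (hconv.midpoint_mem hx hy)]
  obtain ⟨u, -, hum, humem⟩ := exists_seq_tendsto_sInf (hne.image J) hbdd
  choose x hxS hx using humem
  have hJx : Tendsto (fun n => J (x n)) atTop (𝓝 m) := by simpa only [hx] using hum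
  have hgap0 : Tendsto (fun n => J (x n) - m) atTop (𝓝 0) := by simpa using hJx.sub_const m
  have hcau : CauchySeq x :=
    cauchySeq_of_mul_norm_sub_sq_le hgap0 hc fun n k => hgap _ (hxS n) _ (hxS k)
  obtain ⟨a, ha⟩ := cauchySeq_tendsto_of_complete hcau
  have haS : a ∈ S := hS.mem_of_tendsto ha (Eventually.of_forall hxS)
  have hJa : J a = m := tendsto_nhds_unique ((hJ.tendsto a).comp ha) hJx
  exact ⟨a, haS, fun y hy => by linarith [hgap a haS y hy]⟩

end UniformConvexity

variable {X : Type} [NormedAddCommGroup X] [InnerProductSpace ℝ X]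

theorem norm_sq_add_norm_sq_sub_two_mul_midpoint (a b : X) :
    ‖a‖ ^ 2 + ‖b‖ ^ 2 - 2 * ‖midpoint ℝ a b‖ ^ 2 = 1 / 2 * ‖a - b‖ ^ 2 := by
  rw [midpoint_eq_smul_add, norm_smul, mul_pow, norm_add_sq_real, norm_sub_sq_real]
  norm_num
  ring

theorem IsProjection.inner_le_zero {S : Set X} (hS : Convex ℝ S) {y x : X}
    (h : IsProjection S y x) {w : X} (hw : w ∈ S) : inner ℝ (y - x) (w - x) ≤ 0 := by
  have : Nonempty S := ⟨⟨x, h.1⟩⟩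
  refine (norm_eq_iInf_iff_real_inner_le_zero hS h.1).1 (le_antisymm ?_ ?_) w hw
  · exact le_ciInf fun w => h.2 w w.2
  · exact ciInf_le ⟨0, by rintro _ ⟨w, rfl⟩; exact norm_nonneg _⟩ (⟨x, h.1⟩ : S)

section Gradient

variable {S : Set X} {J : X → ℝ} {g : X → X} {c M γ : ℝ}

theorem exists_add_mul_norm_sub_sq_le_of_gradient [CompleteSpace X] (hS : IsClosed S)
    (hconv : Convex ℝ S) (hne : S.Nonempty) (hJ : Continuous J) (hbdd : BddBelow (J '' S))
    (hc : 0 < c) (hlow : ∀ a ∈ S, ∀ b ∈ S, c * ‖b - a‖ ^ 2 ≤ J b - J a - inner ℝ (g a) (b - a)) :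
    ∃ a ∈ S, ∀ y ∈ S, J a + c / 2 * ‖a - y‖ ^ 2 ≤ J y := by
  refine exists_add_mul_norm_sub_sq_le_of_midpoint hS hconv hne hJ hbdd (half_pos hc)
    fun x hx y hy => ?_
  have hm := hconv.midpoint_mem hx hy
  have hxm : x - midpoint ℝ x y = (1 / 2 : ℝ) • (x - y) := by
    rw [left_sub_midpoint, invOf_eq_inv, one_div]
  have hym : y - midpoint ℝ x y = -((1 / 2 : ℝ) • (x - y)) := by
    rw [right_sub_midpoint, invOf_eq_inv, one_div, ← smul_neg, neg_sub]
  have hlowx := hlow _ hm x hx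
  have hlowy := hlow _ hm y hy
  rw [hxm, norm_smul, mul_pow] at hlowx
  rw [hym, norm_neg, inner_neg_right, norm_smul, mul_pow] at hlowy
  norm_num at hlowx hlowy
  linarith

theorem norm_sub_projection_sq_le (hS : Convex ℝ S) {x p p' : X} (hγ : 0 ≤ γ)
    (hM : 2 * γ * M ≤ 1) (hx : x ∈ S) (hmin : ∀ y ∈ S, J x ≤ J y)
    (hproj : IsProjection S (p - γ • g p) p')
    (hlow : c * ‖x - p‖ ^ 2 ≤ J x - J p - inner ℝ (g p) (x - p))
    (hup : J p' - J p - inner ℝ (g p) (p' - p) ≤ M * ‖p' - p‖ ^ 2) :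
    ‖x - p'‖ ^ 2 ≤ (1 - 2 * γ * c) * ‖x - p‖ ^ 2 := by
  have hobtuse : inner ℝ (x - p') (p - p') - γ * inner ℝ (g p) (x - p') ≤ 0 := by
    have h := hproj.inner_le_zero hS hx
    rwa [sub_right_comm, inner_sub_left, real_inner_smul_left,
      real_inner_comm (x - p') (p - p')] at h
  have hcosine : ‖x - p‖ ^ 2
      = ‖x - p'‖ ^ 2 - 2 * inner ℝ (x - p') (p - p') + ‖p' - p‖ ^ 2 := by
    rw [norm_sub_rev p' p, ← norm_sub_sq_real, sub_sub_sub_cancel_right]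
  have hgrad : c * ‖x - p‖ ^ 2 + inner ℝ (g p) (x - p') ≤ M * ‖p' - p‖ ^ 2 := by
    have hsplit : inner ℝ (g p) (x - p') = inner ℝ (g p) (x - p) - inner ℝ (g p) (p' - p) := by
      rw [← inner_sub_right, sub_sub_sub_cancel_right]
    linarith [hmin p' hproj.1]
  have hgrad' := mul_le_mul_of_nonneg_left hgrad hγ
  have hstep := mul_le_mul_of_nonneg_right hM (sq_nonneg ‖p' - p‖)
  linarith

theorem norm_sub_gradient_projection_le (hS : Convex ℝ S) {x : X} {p : ℕ → X} (hγ : 0 ≤ γ)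
    (hM : 2 * γ * M ≤ 1) (hx : x ∈ S) (hmin : ∀ y ∈ S, J x ≤ J y)
    (hlow : ∀ a ∈ S, ∀ b ∈ S, c * ‖b - a‖ ^ 2 ≤ J b - J a - inner ℝ (g a) (b - a))
    (hup : ∀ a ∈ S, ∀ b ∈ S, J b - J a - inner ℝ (g a) (b - a) ≤ M * ‖b - a‖ ^ 2)
    (hp : ∀ n, IsProjection S (p n - γ • g (p n)) (p (n + 1))) (hpS : ∀ n, p n ∈ S) (n : ℕ) :
    ‖x - p n‖ ≤ √(1 - 2 * γ * c) ^ n * ‖x - p 0‖ := by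
  induction n with
  | zero => rw [pow_zero, one_mul]
  | succ n ih =>
    have hsq := norm_sub_projection_sq_le hS hγ hM hx hmin (hp n) (hlow _ (hpS n) _ hx)
      (hup _ (hpS n) _ (hpS (n + 1)))
    calc ‖x - p (n + 1)‖ ≤ √((1 - 2 * γ * c) * ‖x - p n‖ ^ 2) := Real.le_sqrt_of_sq_le hsq
      _ = √(1 - 2 * γ * c) * ‖x - p n‖ := by
          rw [Real.sqrt_mul' _ (sq_nonneg _), Real.sqrt_sq (norm_nonneg _)]
      _ ≤ √(1 - 2 * γ * c) * (√(1 - 2 * γ * c) ^ n * ‖x - p 0‖) :=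
          mul_le_mul_of_nonneg_left ih (Real.sqrt_nonneg _)
      _ = √(1 - 2 * γ * c) ^ (n + 1) * ‖x - p 0‖ := by ring

end Gradient

end Minimization

section Normed

variable {E F : Type*} [NormedAddCommGroup E]

theorem half_norm_sq_sub_norm_sq_le_norm_add_sq (a b : E) :
    ‖a‖ ^ 2 / 2 - ‖b‖ ^ 2 ≤ ‖a + b‖ ^ 2 := by
  have htri : ‖a‖ ≤ ‖a + b‖ + ‖b‖ := by simpa using norm_sub_le (a + b) b
  have hsq := pow_le_pow_left₀ (norm_nonneg a) htri 2
  linarith [sq_nonneg (‖a + b‖ - ‖b‖), add_sq ‖a + b‖ ‖b‖, sub_sq ‖a + b‖ ‖b‖]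

theorem hasFDerivAt_add_bilinear [NormedSpace ℝ E] [NormedAddCommGroup F] [NormedSpace ℝ F]
    (A : E →L[ℝ] F) (B : E →L[ℝ] E →L[ℝ] F) (x : E) :
    HasFDerivAt (fun y => A y + B y y) (A + (B x + B.flip x)) x := by
  have h := (A.hasFDerivAt (x := x)).fun_add
    (B.hasFDerivAt_of_bilinear (hasFDerivAt_id x) (hasFDerivAt_id x))
  refine h.congr_fderiv (ContinuousLinearMap.ext fun y => ?_)
  simp

end Normed

theorem exp_sq (t : ℝ) : Real.exp t ^ 2 = Real.exp (2 * t) := by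
  rw [← Real.exp_nat_mul, Nat.cast_ofNat]

namespace Config

variable {D : Config}

theorem carlemanConst_sq {lam : ℝ} (hl : 0 ≤ lam) :
    D.carlemanConst lam ^ 2 = D.len / (2 * lam) :=
  Real.sq_sqrt (div_nonneg len_pos.le (by positivity))

-- With `λ` large, the lower order terms cost at most half of what `u_zz` contributes.
theorem le_half_weightedZZNorm_sq_sub {K : Type} [MeasurableSpace K] {ν : Measure K}
    [IsFiniteMeasure ν] {u : D.Jet 2 ν} (hu : u ∈ D.H0 ν) {lam C : ℝ} (hl : D.len ≤ lam)
    (hC : 2 * C * D.len ≤ lam) :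
    1 / (4 * D.jetCard) * ‖u‖ ^ 2 ≤ weightedZZNorm lam u ^ 2 / 2
      - C * (D.carlemanConst lam * weightedZZNorm lam u) ^ 2 := by
  have hlam : 0 < lam := len_pos.trans_le hl
  have hcard := jetCard_pos (D := D)
  have hcoeff : C * (D.len / (2 * lam)) ≤ 1 / 4 := by
    rw [← mul_div_assoc, div_le_div_iff₀ (by positivity) (by norm_num)]
    linarith
  have habsorb := mul_le_mul_of_nonneg_right hcoeff (sq_nonneg (weightedZZNorm lam u))
  have hnorm : 1 / (4 * D.jetCard) * ‖u‖ ^ 2 ≤ weightedZZNorm lam u ^ 2 / 4 := by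
    rw [div_mul_eq_mul_div, one_mul, div_le_div_iff₀ (by positivity) (by norm_num)]
    linarith [norm_sq_le_weightedZZNorm hu hl]
  rw [mul_pow, carlemanConst_sq hlam.le]
  linarith

/-- The Fréchet derivative of `lhPair i`. -/
def lhPairDeriv (i : D.Inner) (x : Pairs D) : Pairs D →L[ℝ] Lp ℂ 2 (D.cylMeas D.kMeas) :=
  linPart i + (quadPart i x + (quadPart i).flip x)

theorem hasFDerivAt_lhPair (i : D.Inner) (x : Pairs D) :
    HasFDerivAt (lhPair i) (lhPairDeriv i x) x :=
  hasFDerivAt_add_bilinear (linPart i) (quadPart i) x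

theorem lhPairDeriv_apply (i : D.Inner) (x y : Pairs D) :
    lhPairDeriv i x y = linPart i y + (quadPart i x y + quadPart i y x) := rfl

theorem lhPair_zero (i : D.Inner) : lhPair i (0 : Pairs D) = 0 := by
  simp only [lhPair, map_zero, add_zero]

theorem lhPair_add (i : D.Inner) (x y : Pairs D) :
    lhPair i (x + y) = lhPair i x + (lhPairDeriv i x y + quadPart i y y) := by
  simp only [lhPair, lhPairDeriv_apply, map_add, _root_.add_apply]
  abel

theorem lhPair_sub (i : D.Inner) (x y : Pairs D) : lhPair i x - lhPair i y
    = linPart i (x - y) + (quadPart i x (x - y) + quadPart i (x - y) y) := by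
  simp only [lhPair, map_sub, _root_.sub_apply]
  abel

/-- The Lipschitz constant of `lhPair i` on the ball of radius `ρ`. -/
def lipConst (D : Config) (ρ : ℝ) : ℝ := D.opConst + 6 * D.opConst ^ 2 * ρ

section Ball

variable {ρ : ℝ}

theorem lipConst_nonneg (hρ : 0 ≤ ρ) : 0 ≤ D.lipConst ρ := by
  have := opConst_nonneg (D := D)
  unfold lipConst
  positivity

theorem norm_lhPair_sub_le (i : D.Inner) {x y : Pairs D} (hx : ‖x‖ ≤ ρ) (hy : ‖y‖ ≤ ρ) :
    ‖lhPair i x - lhPair i y‖ ≤ D.lipConst ρ * ‖x - y‖ := by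
  have hright : ‖quadPart i x (x - y)‖ ≤ 3 * D.opConst ^ 2 * (ρ * ‖x - y‖) :=
    (norm_quadPart_le i x (x - y)).trans (by gcongr)
  have hleft : ‖quadPart i (x - y) y‖ ≤ 3 * D.opConst ^ 2 * (‖x - y‖ * ρ) :=
    (norm_quadPart_le i (x - y) y).trans (by gcongr)
  rw [lhPair_sub]
  calc _ ≤ D.opConst * ‖x - y‖ + (3 * D.opConst ^ 2 * (ρ * ‖x - y‖)
        + 3 * D.opConst ^ 2 * (‖x - y‖ * ρ)) :=
        norm_add_le_of_le (norm_linPart_le i _) (norm_add_le_of_le hright hleft)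
    _ = _ := by rw [lipConst]; ring

theorem norm_lhPair_le (i : D.Inner) {x : Pairs D} (hx : ‖x‖ ≤ ρ) :
    ‖lhPair i x‖ ≤ D.lipConst ρ * ρ := by
  have hρ : 0 ≤ ρ := (norm_nonneg x).trans hx
  have h := norm_lhPair_sub_le i hx (norm_zero.trans_le hρ)
  rw [lhPair_zero, sub_zero, sub_zero] at h
  exact h.trans (mul_le_mul_of_nonneg_left hx (lipConst_nonneg hρ))

/-- The part of the increment of `lhPair i` which contains no second `z`-derivative. -/
def lowIncr (i : D.Inner) (x : Pairs D) (r : D.H0 D.kMeas) : Lp ℂ 2 (D.cylMeas D.kMeas) :=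
  linLowPart i (incl D r) + (quadPart i (x + incl D r) (incl D r) + quadPart i (incl D r) x)

theorem lhPair_add_incl_sub (i : D.Inner) (x : Pairs D) (r : D.H0 D.kMeas) :
    lhPair i (x + incl D r) - lhPair i x
      = (r : D.Jet 2 D.kMeas) (ctr i, 2) + lowIncr i x r := by
  rw [lhPair_sub, add_sub_cancel_left, linPart_apply, incl_snd, add_assoc, lowIncr]

theorem norm_mulWeight_lowIncr_le {lam : ℝ} (hl : D.len ≤ lam) (i : D.Inner) {x : Pairs D}
    {r : D.H0 D.kMeas} (hx : ‖x‖ ≤ ρ) (hy : ‖x + incl D r‖ ≤ ρ) :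
    ‖D.mulWeight D.kMeas 2 lam (lowIncr i x r)‖ ≤ D.lipConst ρ * lowSize lam r := by
  have hs := lowSize_nonneg (lam := lam) r
  have hright : ‖D.mulWeight D.kMeas 2 lam (quadPart i (x + incl D r) (incl D r))‖
      ≤ 3 * D.opConst ^ 2 * (ρ * lowSize lam r) :=
    (norm_mulWeight_quadPart_right_le r hl i _).trans (by gcongr)
  have hleft : ‖D.mulWeight D.kMeas 2 lam (quadPart i (incl D r) x)‖
      ≤ 3 * D.opConst ^ 2 * (lowSize lam r * ρ) :=
    (norm_mulWeight_quadPart_left_le r hl i x).trans (by gcongr)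
  rw [lowIncr, map_add, map_add]
  calc _ ≤ D.opConst * lowSize lam r + (3 * D.opConst ^ 2 * (ρ * lowSize lam r)
        + 3 * D.opConst ^ 2 * (lowSize lam r * ρ)) :=
        norm_add_le_of_le (norm_mulWeight_linLowPart_le r hl i)
          (norm_add_le_of_le hright hleft)
    _ = _ := by rw [lipConst]; ring

/-- The functional `J_λ` as a function of the pair `(V, q)`, `q = p + F`. -/
def costPair (lam : ℝ) (x : Pairs D) : ℝ :=
  ∑ i : D.Inner, ‖D.mulWeight D.kMeas 2 lam (lhPair i x)‖ ^ 2

/-- The Fréchet derivative of `costPair lam`. -/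
def costPairDeriv (lam : ℝ) (x : Pairs D) : Pairs D →L[ℝ] ℝ :=
  ∑ i : D.Inner, (2 : ℝ) • (innerSL ℝ (D.mulWeight D.kMeas 2 lam (lhPair i x))).comp
    ((D.mulWeight D.kMeas 2 lam).comp (lhPairDeriv i x))

theorem costPairDeriv_apply (lam : ℝ) (x y : Pairs D) :
    costPairDeriv lam x y = ∑ i : D.Inner, 2 * inner ℝ (D.mulWeight D.kMeas 2 lam (lhPair i x))
      (D.mulWeight D.kMeas 2 lam (lhPairDeriv i x y)) := by
  simp only [costPairDeriv, _root_.sum_apply]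
  rfl

theorem hasFDerivAt_costPair (lam : ℝ) (x : Pairs D) :
    HasFDerivAt (costPair lam) (costPairDeriv lam x) x := by
  refine HasFDerivAt.fun_sum fun i _ => ?_
  have h := ((D.mulWeight D.kMeas 2 lam).hasFDerivAt.comp x (hasFDerivAt_lhPair i x)).norm_sq
  exact h.congr_fderiv (by rw [← Nat.cast_smul_eq_nsmul ℝ 2, Nat.cast_ofNat]; rfl)

/-- The second order Taylor remainder of `costPair lam`. -/
def costPairRemainder (lam : ℝ) (x y : Pairs D) : ℝ :=
  costPair lam (x + y) - costPair lam x - costPairDeriv lam x y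

theorem costPairRemainder_eq (lam : ℝ) (x y : Pairs D) :
    costPairRemainder lam x y = ∑ i : D.Inner,
      (‖D.mulWeight D.kMeas 2 lam (lhPair i (x + y) - lhPair i x)‖ ^ 2
        + 2 * inner ℝ (D.mulWeight D.kMeas 2 lam (lhPair i x))
          (D.mulWeight D.kMeas 2 lam (quadPart i y y))) := by
  rw [costPairRemainder, costPairDeriv_apply, costPair, costPair, ← Finset.sum_sub_distrib,
    ← Finset.sum_sub_distrib]
  refine Finset.sum_congr rfl fun i _ => ?_
  rw [lhPair_add, add_sub_cancel_left, map_add (D.mulWeight D.kMeas 2 lam) (lhPair i x),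
    norm_add_sq_real, map_add (D.mulWeight D.kMeas 2 lam) (lhPairDeriv i x y), inner_add_right]
  ring

/-- The number of interior nodes. -/
def innerCard (D : Config) : ℝ := Fintype.card D.Inner

theorem innerCard_nonneg : 0 ≤ D.innerCard := Nat.cast_nonneg _

theorem sum_inner_const (c : ℝ) : ∑ _i : D.Inner, c = D.innerCard * c := by
  rw [Finset.sum_const, nsmul_eq_mul, Finset.card_univ, innerCard]

/-- The constant in the two-sided estimate of `costPairRemainder`. -/
def remainderConst (D : Config) (ρ : ℝ) : ℝ :=
  D.innerCard * (D.lipConst ρ ^ 2 + 2 * (3 * D.opConst ^ 2 * (D.lipConst ρ * ρ)))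

theorem remainderConst_nonneg (hρ : 0 ≤ ρ) : 0 ≤ D.remainderConst ρ := by
  have h1 := lipConst_nonneg (D := D) hρ
  have h2 := innerCard_nonneg (D := D)
  unfold remainderConst
  positivity

theorem costPairRemainder_le (lam : ℝ) {x : Pairs D} {r : D.H0 D.kMeas} (hx : ‖x‖ ≤ ρ)
    (hy : ‖x + incl D r‖ ≤ ρ) :
    costPairRemainder lam x (incl D r)
      ≤ D.remainderConst ρ * Real.exp (2 * (|lam| * D.len)) * ‖r‖ ^ 2 := by
  have hρ : 0 ≤ ρ := (norm_nonneg x).trans hx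
  have hL := lipConst_nonneg (D := D) hρ
  set W := Real.exp (|lam| * D.len) with hW
  have hweight : ∀ {f : Lp ℂ 2 (D.cylMeas D.kMeas)} {t : ℝ}, ‖f‖ ≤ t →
      ‖D.mulWeight D.kMeas 2 lam f‖ ≤ W * t := fun h =>
    (norm_mulWeight_le _ _).trans (mul_le_mul_of_nonneg_left h (Real.exp_pos _).le)
  rw [costPairRemainder_eq]
  calc _ ≤ ∑ _i : D.Inner, ((W * (D.lipConst ρ * ‖r‖)) ^ 2
      + 2 * ((W * (D.lipConst ρ * ρ)) * (W * (3 * D.opConst ^ 2 * (‖r‖ * ‖r‖))))) := by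
        refine Finset.sum_le_sum fun i _ => add_le_add ?_ ?_
        · have hincr := norm_lhPair_sub_le i hy hx
          rw [add_sub_cancel_left, norm_incl] at hincr
          exact pow_le_pow_left₀ (norm_nonneg _) (hweight hincr) 2
        · have hquad := norm_quadPart_le i (incl D r) (incl D r)
          rw [norm_incl] at hquad
          exact mul_le_mul_of_nonneg_left ((real_inner_le_norm _ _).trans
            (mul_le_mul (hweight (norm_lhPair_le i hx)) (hweight hquad) (norm_nonneg _)
              (by positivity))) zero_le_two
    _ = _ := by
        rw [sum_inner_const, ← exp_sq, ← hW, remainderConst]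
        ring

theorem le_node_remainder {lam : ℝ} (hl : D.len ≤ lam) {x : Pairs D} {r : D.H0 D.kMeas}
    (hx : ‖x‖ ≤ ρ) (hy : ‖x + incl D r‖ ≤ ρ) (i : D.Inner) :
    ‖D.mulWeight D.kMeas 2 lam ((r : D.Jet 2 D.kMeas) (ctr i, 2))‖ ^ 2 / 2
        - (D.lipConst ρ ^ 2 + 2 * (3 * D.opConst ^ 2 * (D.lipConst ρ * ρ))) * lowSize lam r ^ 2
      ≤ ‖D.mulWeight D.kMeas 2 lam (lhPair i (x + incl D r) - lhPair i x)‖ ^ 2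
        + 2 * inner ℝ (D.mulWeight D.kMeas 2 lam (lhPair i x))
          (D.mulWeight D.kMeas 2 lam (quadPart i (incl D r) (incl D r))) := by
  have hsplit := half_norm_sq_sub_norm_sq_le_norm_add_sq
    (D.mulWeight D.kMeas 2 lam ((r : D.Jet 2 D.kMeas) (ctr i, 2)))
    (D.mulWeight D.kMeas 2 lam (lowIncr i x r))
  have hlow := pow_le_pow_left₀ (norm_nonneg _) (norm_mulWeight_lowIncr_le hl i hx hy) 2
  have hinner := (abs_le.1 (abs_inner_mulWeight_quadPart_le r hl i (lhPair i x))).1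
  have hquad : 3 * D.opConst ^ 2 * (‖lhPair i x‖ * lowSize lam r ^ 2)
      ≤ 3 * D.opConst ^ 2 * (D.lipConst ρ * ρ * lowSize lam r ^ 2) := by
    have := norm_lhPair_le i hx
    gcongr
  rw [lhPair_add_incl_sub, map_add]
  linarith

theorem le_costPairRemainder {lam : ℝ} (hl : D.len ≤ lam)
    (hl' : 2 * D.remainderConst ρ * D.len ≤ lam) {x : Pairs D} {r : D.H0 D.kMeas}
    (hx : ‖x‖ ≤ ρ) (hy : ‖x + incl D r‖ ≤ ρ) :
    1 / (4 * D.jetCard) * ‖r‖ ^ 2 ≤ costPairRemainder lam x (incl D r) := by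
  rw [costPairRemainder_eq]
  refine (le_half_weightedZZNorm_sq_sub r.2 hl hl').trans (le_trans (le_of_eq ?_)
    (Finset.sum_le_sum fun i _ => le_node_remainder hl hx hy i))
  rw [Finset.sum_sub_distrib, ← Finset.sum_div, ← weightedZZNorm_sq, sum_inner_const, lowSize,
    remainderConst]
  ring

end Ball

end Config

namespace Config

variable {D : Config} {K : Type} [MeasurableSpace K] {ν : Measure K}

theorem trunc_sub (F G : D.Jet 3 ν) : trunc F - trunc G = trunc (F - G) := rfl

theorem norm_trunc_le (F : D.Jet 3 ν) : ‖trunc F‖ ≤ ‖F‖ := by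
  refine (sq_le_sq₀ (norm_nonneg _) (norm_nonneg _)).1 ?_
  rw [PiLp.norm_sq_eq_of_L2, PiLp.norm_sq_eq_of_L2]
  have hnode : ∀ n : D.Node, ∑ r : Fin 3, ‖trunc F (n, r)‖ ^ 2 ≤ ∑ r : Fin 4, ‖F (n, r)‖ ^ 2 := by
    intro n
    rw [Fin.sum_univ_castSucc (n := 3)]
    exact le_add_of_nonneg_right (sq_nonneg ‖F (n, Fin.last 3)‖)
  exact (Fintype.sum_prod_type fun p : D.Node × Fin 3 => ‖trunc F p‖ ^ 2).trans_le
    ((Finset.sum_le_sum fun n _ => hnode n).trans_eq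
      (Fintype.sum_prod_type fun p : D.Node × Fin 4 => ‖F p‖ ^ 2).symm)

theorem lapCLM_eq_zero_of_ae {V : D.Jet 2 ν} {i : D.Inner}
    (hV : ∀ᵐ w ∂D.cylMeas ν, lapH V i w = 0) : lapCLM ν i V = 0 := by
  rw [Lp.ext_iff]
  filter_upwards [coeFn_lapCLM i V, hV, Lp.coeFn_zero ℂ 2 (D.cylMeas ν)] with w hlap heq hzero
  rw [hlap, heq, hzero, Pi.zero_apply]

variable [IsFiniteMeasure ν]

theorem trunc_mem {F : D.Jet 3 ν} (hF : F ∈ D.H 3 ν) : trunc F ∈ D.H 2 ν :=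
  fun n r => hF n r.castSucc

theorem sub_mem_H0 {f g : D.Jet 2 ν} {φ₀ φ₁ : D.Inner → K → ℂ} (hf : f ∈ D.H 2 ν)
    (hg : g ∈ D.H 2 ν) (bf : HasBC f φ₀ φ₁) (bg : HasBC g φ₀ φ₁) : f - g ∈ D.H0 ν := by
  refine ⟨(D.H 2 ν).sub_mem hf hg, fun n hn => ?_, fun i => ?_, fun i => ?_, fun i => ?_⟩
  · rw [PiLp.sub_apply, bf.lateral n hn, bg.lateral n hn, sub_zero]
  · simpa using HasTrace.sub left_mem (bf.bottom i) (bg.bottom i)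
  · simpa using HasTrace.sub left_mem (bf.bottom_z i) (bg.bottom_z i)
  · simpa using HasTrace.sub right_mem (bf.top i) (bg.top i)

theorem exp_mul_integral_eq (lam : ℝ) (f : Lp ℂ 2 (D.cylMeas ν)) {F : K × ℝ → ℂ}
    (h : ∀ᵐ w ∂D.cylMeas ν, f w = F w) :
    Real.exp (2 * lam * D.d) * ∫ w, ‖F w‖ ^ 2 * cwf lam w.2 ∂D.cylMeas ν
      = ‖D.mulWeight ν 2 lam f‖ ^ 2 := by
  rw [← real_inner_self_eq_norm_sq, L2.inner_def, ← integral_const_mul]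
  refine integral_congr_ae ?_
  filter_upwards [h, coeFn_mulWeight lam f] with w hw hmul
  rw [real_inner_self_eq_norm_sq, hmul, hw, norm_mul, norm_weight, mul_pow, exp_sq, cwf,
    mul_left_comm, ← Real.exp_add, mul_comm]
  congr 2
  ring

/-- The functional `J_λ` for an extension `F` of the boundary data which is merely in `H_2^h`. -/
def fieldCost (V : D.Jet 2 unitMeas) (F : D.Jet 2 D.kMeas) (lam : ℝ) (p : D.H0 D.kMeas) : ℝ :=
  Real.exp (2 * lam * D.d) *
    ∑ i : D.Inner, ∫ w, ‖Lh V ((p : D.Jet 2 D.kMeas) + F) i w‖ ^ 2 * cwf lam w.2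
      ∂D.cylMeas D.kMeas

theorem fieldCost_eq (x : Pairs D) (lam : ℝ) (p : D.H0 D.kMeas) :
    fieldCost (x.1 : D.Jet 2 unitMeas) (x.2 : D.Jet 2 D.kMeas) lam p
      = costPair lam (x + incl D p) := by
  rw [fieldCost, costPair, Finset.mul_sum]
  refine Finset.sum_congr rfl fun i _ => exp_mul_integral_eq lam _ ?_
  have h := coeFn_lhPair i (x + incl D p)
  rwa [coe_fst_add_incl, coe_snd_add_incl] at h

theorem le_sum_mulWeight_lapCLM {lam : ℝ} (hl : D.len ≤ lam)
    (hl' : 2 * (D.innerCard * D.gridConst ^ 2) * D.len ≤ lam) (r : D.H0 ν) :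
    1 / (4 * D.jetCard) * ‖r‖ ^ 2
      ≤ ∑ i : D.Inner, ‖D.mulWeight ν 2 lam (lapCLM ν i (r : D.Jet 2 ν))‖ ^ 2 := by
  have hnode : ∀ i : D.Inner, ‖D.mulWeight ν 2 lam ((r : D.Jet 2 ν) (ctr i, 2))‖ ^ 2 / 2
      - (D.gridConst * (D.carlemanConst lam * weightedZZNorm lam (r : D.Jet 2 ν))) ^ 2
      ≤ ‖D.mulWeight ν 2 lam (lapCLM ν i (r : D.Jet 2 ν))‖ ^ 2 := fun i => by
    have hlow := pow_le_pow_left₀ (norm_nonneg _) (norm_mulWeight_lapLowCLM_le r.2 hl i) 2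
    have hsplit : lapCLM ν i (r : D.Jet 2 ν)
      = (r : D.Jet 2 ν) (ctr i, 2) + lapLowCLM ν i (r : D.Jet 2 ν) := rfl
    rw [hsplit, map_add]
    exact (sub_le_sub_left hlow _).trans (half_norm_sq_sub_norm_sq_le_norm_add_sq _ _)
  refine (le_half_weightedZZNorm_sq_sub r.2 hl hl').trans
    (le_trans (le_of_eq ?_) (Finset.sum_le_sum fun i _ => hnode i))
  rw [Finset.sum_sub_distrib, ← Finset.sum_div, ← weightedZZNorm_sq, sum_inner_const]
  ring

theorem tailCost_eq (Q : D.Jet 2 unitMeas) (mu : ℝ) (W : D.H0 unitMeas) :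
    tailCost Q mu W = ∑ i : D.Inner,
      ‖D.mulWeight unitMeas 2 mu (lapCLM unitMeas i ((W : D.Jet 2 unitMeas) + Q))‖ ^ 2 := by
  rw [tailCost, Finset.mul_sum]
  exact Finset.sum_congr rfl fun i _ => exp_mul_integral_eq mu _ (coeFn_lapCLM i _)

theorem tailCost_nonneg (Q : D.Jet 2 unitMeas) (mu : ℝ) (W : D.H0 unitMeas) :
    0 ≤ tailCost Q mu W := by
  rw [tailCost_eq]
  positivity

theorem continuous_tailCost (Q : D.Jet 2 unitMeas) (mu : ℝ) : Continuous (tailCost Q mu) := by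
  rw [funext (tailCost_eq Q mu)]
  fun_prop

theorem tailCost_midpoint (Q : D.Jet 2 unitMeas) (mu : ℝ) (W W' : D.H0 unitMeas) :
    tailCost Q mu W + tailCost Q mu W' - 2 * tailCost Q mu (midpoint ℝ W W')
      = 1 / 2 * ∑ i : D.Inner, ‖D.mulWeight unitMeas 2 mu
          (lapCLM unitMeas i ((W - W' : D.H0 unitMeas) : D.Jet 2 unitMeas))‖ ^ 2 := by
  simp only [tailCost_eq, Finset.mul_sum]
  rw [← Finset.sum_add_distrib, ← Finset.sum_sub_distrib]
  refine Finset.sum_congr rfl fun i _ => ?_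
  set T : D.Jet 2 unitMeas →L[ℝ] Lp ℂ 2 (D.cylMeas unitMeas) :=
    (D.mulWeight unitMeas 2 mu).comp (lapCLM unitMeas i)
  change ‖T (W + Q)‖ ^ 2 + ‖T (W' + Q)‖ ^ 2 - 2 * ‖T ((midpoint ℝ W W' : D.H0 unitMeas) + Q)‖ ^ 2
    = 1 / 2 * ‖T (W - W')‖ ^ 2
  have hdiff : T (W - W') = T (W + Q) - T (W' + Q) := by
    rw [← map_sub, add_sub_add_right_eq_sub]
  have hmid : T ((midpoint ℝ W W' : D.H0 unitMeas) + Q) = midpoint ℝ (T (W + Q)) (T (W' + Q)) := by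
    rw [midpoint_eq_smul_add, midpoint_eq_smul_add, invOf_eq_inv, ← map_add, ← map_smul,
      Submodule.coe_smul, Submodule.coe_add]
    congr 1
    module
  rw [hdiff, hmid, norm_sq_add_norm_sq_sub_two_mul_midpoint]

theorem exists_tailCost_growth {mu : ℝ} (hl : D.len ≤ mu)
    (hl' : 2 * (D.innerCard * D.gridConst ^ 2) * D.len ≤ mu) (Q : D.Jet 2 unitMeas) :
    ∃ W : D.H0 unitMeas, ∀ W' : D.H0 unitMeas,
      tailCost Q mu W + 1 / (8 * D.jetCard) * ‖W - W'‖ ^ 2 ≤ tailCost Q mu W' := by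
  have hcard := jetCard_pos (D := D)
  obtain ⟨W, -, hW⟩ := exists_add_mul_norm_sub_sq_le_of_midpoint isClosed_univ convex_univ
    Set.univ_nonempty (continuous_tailCost Q mu)
    ⟨0, Set.forall_mem_image.2 fun W _ => tailCost_nonneg Q mu W⟩
    (c := 1 / (8 * D.jetCard)) (by positivity) fun W _ W' _ => by
      rw [tailCost_midpoint]
      calc 1 / (8 * D.jetCard) * ‖W - W'‖ ^ 2
          = 1 / 2 * (1 / (4 * D.jetCard) * ‖W - W'‖ ^ 2) := by field_simp; ring
        _ ≤ _ := mul_le_mul_of_nonneg_left (le_sum_mulWeight_lapCLM hl hl' (W - W')) (by norm_num)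
  exact ⟨W, fun W' => hW W' trivial⟩

theorem tailCost_le_of_lapCLM_eq_zero {mu δ : ℝ} (hδ : 0 < δ) (hmu : 0 ≤ mu)
    (hexp : Real.exp (2 * (mu * D.len)) = 1 / δ) {V Qs Q : D.Jet 2 unitMeas}
    (hV : ∀ i, lapCLM unitMeas i V = 0) (hQ : ‖Q - Qs‖ < δ) {W : D.H0 unitMeas}
    (hW : (W : D.Jet 2 unitMeas) = V - Qs) :
    tailCost Q mu W ≤ D.innerCard * D.gridConst ^ 2 * δ := by
  have hnode : ∀ i : D.Inner, ‖D.mulWeight unitMeas 2 mu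
      (lapCLM unitMeas i ((W : D.Jet 2 unitMeas) + Q))‖ ^ 2 ≤ D.gridConst ^ 2 * δ := fun i => by
    have hlap : ‖lapCLM unitMeas i (Q - Qs)‖ ≤ D.gridConst * δ :=
      (norm_lapCLM_le i _).trans (mul_le_mul_of_nonneg_left hQ.le gridConst_nonneg)
    have hsplit : (W : D.Jet 2 unitMeas) + Q = V + (Q - Qs) := by
      rw [hW]
      abel
    rw [hsplit, map_add, hV, zero_add]
    calc _ ≤ (Real.exp (mu * D.len) * (D.gridConst * δ)) ^ 2 := by
          have hweight := norm_mulWeight_le mu (lapCLM unitMeas i (Q - Qs))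
          rw [abs_of_nonneg hmu] at hweight
          exact pow_le_pow_left₀ (norm_nonneg _)
            (hweight.trans (mul_le_mul_of_nonneg_left hlap (Real.exp_pos _).le)) 2
      _ = _ := by
          rw [mul_pow, exp_sq, hexp]
          field_simp
  rw [tailCost_eq, mul_assoc, ← sum_inner_const]
  exact Finset.sum_le_sum fun i _ => hnode i

/-- The constant in the error estimate of the tail function. -/
def tailConst (D : Config) : ℝ := √(8 * D.jetCard * (D.innerCard * D.gridConst ^ 2)) + 1

theorem one_le_tailConst : 1 ≤ D.tailConst :=
  le_add_of_nonneg_left (Real.sqrt_nonneg _)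

theorem tailConst_nonneg : 0 ≤ D.tailConst := zero_le_one.trans one_le_tailConst

theorem exists_tail {mu δ : ℝ} (hδ : 0 < δ) (hδ1 : δ ≤ 1)
    (hexp : Real.exp (2 * (mu * D.len)) = 1 / δ) (hl : D.len ≤ mu)
    (hl' : 2 * (D.innerCard * D.gridConst ^ 2) * D.len ≤ mu)
    {Vs Qs Q : D.Jet 2 unitMeas} (hVQ : Vs - Qs ∈ D.H0 unitMeas)
    (hV : ∀ i, ∀ᵐ w ∂D.cylMeas unitMeas, lapH Vs i w = 0) (hQ : ‖Q - Qs‖ < δ) :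
    ∃ W : D.H0 unitMeas, IsUniqueMinOn (tailCost Q mu) Set.univ W ∧
      ‖(W : D.Jet 2 unitMeas) + Q - Vs‖ ≤ D.tailConst * √δ := by
  have hcard := jetCard_pos (D := D)
  obtain ⟨W, hgrowth⟩ := exists_tailCost_growth hl hl' Q
  refine ⟨W, isUniqueMinOn_of_add_mul_norm_sub_sq_le (c := 1 / (8 * D.jetCard)) (by positivity)
    trivial fun W' _ => hgrowth W', ?_⟩
  set Ws : D.H0 unitMeas := ⟨Vs - Qs, hVQ⟩ with hWs
  have hcost := tailCost_le_of_lapCLM_eq_zero hδ (len_pos.le.trans hl) hexp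
    (fun i => lapCLM_eq_zero_of_ae (hV i)) hQ (W := Ws) rfl
  have hsq : ‖W - Ws‖ ^ 2 ≤ 8 * D.jetCard * (D.innerCard * D.gridConst ^ 2) * δ := by
    have h : 1 / (8 * D.jetCard) * ‖W - Ws‖ ^ 2 ≤ D.innerCard * D.gridConst ^ 2 * δ := by
      linarith [hgrowth Ws, tailCost_nonneg Q mu W]
    rw [div_mul_eq_mul_div, one_mul, div_le_iff₀ (by positivity)] at h
    linarith
  have hnorm : ‖W - Ws‖ ≤ √(8 * D.jetCard * (D.innerCard * D.gridConst ^ 2)) * √δ := by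
    rw [← Real.sqrt_mul' _ hδ.le]
    exact Real.le_sqrt_of_sq_le hsq
  have hsqrt : δ ≤ √δ := Real.le_sqrt_of_sq_le (by nlinarith)
  have hsplit : (W : D.Jet 2 unitMeas) + Q - Vs
      = ((W - Ws : D.H0 unitMeas) : D.Jet 2 unitMeas) + (Q - Qs) := by
    rw [Submodule.coe_sub, hWs]
    module
  rw [hsplit, tailConst, add_mul, one_mul]
  exact norm_add_le_of_le hnorm (hQ.le.trans hsqrt)

end Config

theorem two_mul_ofReal (a : ℝ) : 2 * ENNReal.ofReal a = ENNReal.ofReal (2 * a) := by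
  rw [ENNReal.ofReal_mul zero_le_two, ENNReal.ofReal_ofNat]

theorem norm_dotProduct_self_sub_le {ι R : Type*} [Fintype ι] [NormedCommRing R] {a b : ι → R}
    {s t : ℝ} (ha : ∀ m, ‖a m‖ ≤ s) (hb : ∀ m, ‖b m‖ ≤ s) (hab : ∀ m, ‖a m - b m‖ ≤ t) :
    ‖a ⬝ᵥ a - b ⬝ᵥ b‖ ≤ Fintype.card ι * (2 * s * t) := by
  have hfactor : a ⬝ᵥ a - b ⬝ᵥ b = ∑ m, (a m + b m) * (a m - b m) := by
    simp only [dotProduct, ← Finset.sum_sub_distrib]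
    exact Finset.sum_congr rfl fun m _ => by ring
  have hterm : ∀ m, ‖(a m + b m) * (a m - b m)‖ ≤ 2 * s * t := fun m => by
    have hsum : ‖a m + b m‖ ≤ 2 * s := (norm_add_le _ _).trans (by linarith [ha m, hb m])
    exact (norm_mul_le _ _).trans
      (mul_le_mul hsum (hab m) (norm_nonneg _) ((norm_nonneg _).trans hsum))
  calc ‖a ⬝ᵥ a - b ⬝ᵥ b‖ ≤ ∑ m, ‖(a m + b m) * (a m - b m)‖ := hfactor ▸ norm_sum_le _ _
    _ ≤ ∑ _m : ι, 2 * s * t := Finset.sum_le_sum fun m _ => hterm m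
    _ = Fintype.card ι * (2 * s * t) := by
        rw [Finset.sum_const, Finset.card_univ, nsmul_eq_mul]

namespace Config

variable {D : Config}

theorem tailInt_sub (T : (D.Jet 2 unitMeas) →L[ℝ] Lp ℂ 2 (D.cylMeas unitMeas))
    (T' : (D.Jet 2 D.kMeas) →L[ℝ] Lp ℂ 2 (D.cylMeas D.kMeas)) (x y : Pairs D) :
    ∀ᵐ z ∂D.zMeas, ∀ k ∈ Set.Icc D.kmin D.kmax,
      tailInt (T x.1.1) (T' x.2.1) k z - tailInt (T y.1.1) (T' y.2.1) k z
        = tailInt (T (x - y).1.1) (T' (x - y).2.1) k z := by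
  filter_upwards [tailInt_add (T (x - y).1.1) (T y.1.1) (T' (x - y).2.1) (T' y.2.1)] with z hz k hk
  have h := hz k hk
  rw [← map_add, ← map_add] at h
  have e1 : ((x - y).1 : D.Jet 2 unitMeas) + y.1 = x.1 := by simp
  have e2 : ((x - y).2 : D.Jet 2 D.kMeas) + y.2 = x.2 := by simp
  rw [e1, e2] at h
  rw [h, add_sub_cancel_right]

theorem gradV_sub (i : D.Inner) (m : Fin 3) (x y : Pairs D) :
    ∀ᵐ z ∂D.zMeas, ∀ k ∈ Set.Icc D.kmin D.kmax,
      gradV x.1.1 x.2.1 i k z m - gradV y.1.1 y.2.1 i k z m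
        = gradV (x - y).1.1 (x - y).2.1 i k z m := by
  filter_upwards [tailInt_sub (gradCLM unitMeas 0 i m) (gradCLM D.kMeas 0 i m) x y,
    gradV_eq_tailInt x.1.1 x.2.1 i m, gradV_eq_tailInt y.1.1 y.2.1 i m,
    gradV_eq_tailInt (x - y).1.1 (x - y).2.1 i m] with z h h1 h2 h3 k hk
  rw [h1 k hk, h2 k hk, h3 k hk, h k hk]

theorem lapV_sub (i : D.Inner) (x y : Pairs D) :
    ∀ᵐ z ∂D.zMeas, ∀ k ∈ Set.Icc D.kmin D.kmax,
      lapV x.1.1 x.2.1 i k z - lapV y.1.1 y.2.1 i k z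
        = tailInt (lapCLM unitMeas i (x - y).1.1) (lapCLM D.kMeas i (x - y).2.1) k z := by
  filter_upwards [tailInt_sub (lapCLM unitMeas i) (lapCLM D.kMeas i) x y,
    lapV_eq_tailInt x.1.1 x.2.1 i, lapV_eq_tailInt y.1.1 y.2.1 i] with z h h1 h2 k hk
  rw [h1 k hk, h2 k hk, h k hk]

/-- The Lipschitz constant, on the ball of radius `ρ`, of the terms of the coefficient other than
`Δ^h v`. -/
def coeffLowConst (D : Config) (ρ : ℝ) : ℝ :=
  6 * D.kmax ^ 2 * D.gradConst ^ 2 * ρ + 2 * D.kmax * D.gradConst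

theorem coeffLowConst_nonneg {ρ : ℝ} (hρ : 0 ≤ ρ) : 0 ≤ D.coeffLowConst ρ := by
  have h1 := kmax_pos (D := D)
  have h2 := gradConst_nonneg (D := D)
  unfold coeffLowConst
  positivity

theorem norm_coeff_sub_coeff_le (V V' : D.Jet 2 unitMeas) (q q' : D.Jet 2 D.kMeas) {k : ℝ}
    (hk : 0 ≤ k) (i : D.Inner) (z : ℝ) (rule : Rule) :
    ‖coeff V q k i z rule - coeff V' q' k i z rule‖
      ≤ ‖lapV V q i k z - lapV V' q' i k z‖
        + k ^ 2 * ‖gradV V q i k z ⬝ᵥ gradV V q i k z - gradV V' q' i k z ⬝ᵥ gradV V' q' i k z‖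
        + 2 * k * ‖gradV V q i k z 2 - gradV V' q' i k z 2‖ := by
  set a := gradV V q i k z
  set b := gradV V' q' i k z
  set l := lapV V q i k z
  set l' := lapV V' q' i k z
  have hquad : ‖(k : ℂ) ^ 2 * (a ⬝ᵥ a - b ⬝ᵥ b)‖ = k ^ 2 * ‖a ⬝ᵥ a - b ⬝ᵥ b‖ := by
    rw [norm_mul, norm_pow, Complex.norm_real, Real.norm_of_nonneg hk]
  have hlin : ‖2 * Complex.I * (k : ℂ) * (a 2 - b 2)‖ = 2 * k * ‖a 2 - b 2‖ := by
    rw [norm_mul, norm_mul, norm_mul, Complex.norm_I, mul_one, Complex.norm_ofNat,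
      Complex.norm_real, Real.norm_of_nonneg hk]
  rw [← hquad, ← hlin]
  cases rule with
  | total =>
    calc ‖-(l + (k : ℂ) ^ 2 * (a ⬝ᵥ a)) - -(l' + (k : ℂ) ^ 2 * (b ⬝ᵥ b))‖
        = ‖(l - l') + (k : ℂ) ^ 2 * (a ⬝ᵥ a - b ⬝ᵥ b)‖ := by rw [← norm_neg]; ring_nf
      _ ≤ ‖l - l'‖ + ‖(k : ℂ) ^ 2 * (a ⬝ᵥ a - b ⬝ᵥ b)‖ := norm_add_le _ _
      _ ≤ _ := le_add_of_nonneg_right (norm_nonneg _)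
  | ratio =>
    calc ‖1 - (l + (k : ℂ) ^ 2 * (a ⬝ᵥ a) + 2 * Complex.I * (k : ℂ) * a 2)
          - (1 - (l' + (k : ℂ) ^ 2 * (b ⬝ᵥ b) + 2 * Complex.I * (k : ℂ) * b 2))‖
        = ‖(l - l') + (k : ℂ) ^ 2 * (a ⬝ᵥ a - b ⬝ᵥ b)
            + 2 * Complex.I * (k : ℂ) * (a 2 - b 2)‖ := by rw [← norm_neg]; ring_nf
      _ ≤ _ := norm_add₃_le

theorem norm_coeff_sub_le (i : D.Inner) {ρ : ℝ} {x y : Pairs D} (hx : ‖x‖ ≤ ρ) (hy : ‖y‖ ≤ ρ) :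
    ∀ᵐ z ∂D.zMeas, ∀ k ∈ Set.Icc D.kmin D.kmax, ∀ rule : Rule,
      ‖coeff x.1.1 x.2.1 k i z rule - coeff y.1.1 y.2.1 k i z rule‖
        ≤ ‖tailInt (lapCLM unitMeas i (x - y).1.1) (lapCLM D.kMeas i (x - y).2.1) k z‖
          + D.coeffLowConst ρ * ‖x - y‖ := by
  have hG := gradConst_nonneg (D := D)
  filter_upwards [lapV_sub i x y, ae_all_iff.2 fun m => gradV_sub i m x y,
    ae_all_iff.2 fun m => norm_gradV_le i m x, ae_all_iff.2 fun m => norm_gradV_le i m y,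
    ae_all_iff.2 fun m => norm_gradV_le i m (x - y)] with z hlap hsub hgx hgy hgsub k hk rule
  have hk0 : 0 ≤ k := D.kmin_pos.le.trans hk.1
  have hgrad : ∀ m, ‖gradV x.1.1 x.2.1 i k z m - gradV y.1.1 y.2.1 i k z m‖
      ≤ D.gradConst * ‖x - y‖ := fun m => by
    rw [hsub m k hk]
    exact hgsub m k hk
  have hdot := norm_dotProduct_self_sub_le
    (fun m => (hgx m k hk).trans (mul_le_mul_of_nonneg_left hx hG))
    (fun m => (hgy m k hk).trans (mul_le_mul_of_nonneg_left hy hG)) hgrad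
  rw [Fintype.card_fin] at hdot
  have hquad := mul_le_mul (pow_le_pow_left₀ hk0 hk.2 2) hdot (norm_nonneg _) (sq_nonneg _)
  have hlin := mul_le_mul (mul_le_mul_of_nonneg_left hk.2 zero_le_two) (hgrad 2) (norm_nonneg _)
    (mul_nonneg zero_le_two kmax_pos.le)
  have hcoeff := norm_coeff_sub_coeff_le x.1.1 y.1.1 x.2.1 y.2.1 hk0 i z rule
  rw [hlap k hk] at hcoeff
  refine hcoeff.trans ?_
  rw [add_assoc]
  refine add_le_add_right ((add_le_add hquad hlin).trans_eq ?_) _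
  unfold coeffLowConst
  push_cast
  ring

theorem lintegral_tailInt_le (f : Lp ℂ 2 (D.cylMeas unitMeas)) (g : Lp ℂ 2 (D.cylMeas D.kMeas))
    {k : ℝ} (hk : k ∈ Set.Icc D.kmin D.kmax) :
    ENNReal.ofReal (D.h ^ 2) * ∫⁻ z, ‖tailInt f g k z‖ₑ ^ 2 ∂D.zMeas
      ≤ 2 * (‖f‖ₑ ^ 2 + ENNReal.ofReal (D.kmax - D.kmin) * ‖g‖ₑ ^ 2) := by
  have hm : Measurable fun z => ‖f ((), z)‖ₑ ^ 2 :=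
    (stronglyMeasurable_slice f ()).enorm.pow_const 2
  have hg : Measurable fun z => ∫⁻ κ, ‖g (κ, z)‖ₑ ^ 2 ∂D.kMeas :=
    (measurable_enorm_sq g).lintegral_prod_left'
  calc _ ≤ ENNReal.ofReal (D.h ^ 2) * ∫⁻ z, 2 * (‖f ((), z)‖ₑ ^ 2
        + ENNReal.ofReal (D.kmax - D.kmin) * ∫⁻ κ, ‖g (κ, z)‖ₑ ^ 2 ∂D.kMeas) ∂D.zMeas := by
        refine mul_le_mul' le_rfl (lintegral_mono fun z => ?_)
        rw [tailInt, sub_eq_add_neg]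
        refine (enorm_add_sq_le _ _).trans ?_
        rw [enorm_neg]
        gcongr
        exact enorm_integral_k_sq_le g hk z
    _ = _ := by
        rw [lintegral_const_mul' _ _ (by simp), lintegral_add_left hm,
          lintegral_const_mul _ hg,
          ← lintegral_lintegral_swap (measurable_enorm_sq g).aemeasurable, lintegral_unit,
          lintegral_lintegral_eq]
        have hc : ENNReal.ofReal (D.h ^ 2) * (ENNReal.ofReal (D.h ^ 2))⁻¹ = 1 :=
          ENNReal.mul_inv_cancel h_sq_ne_zero ENNReal.ofReal_ne_top
        calc _ = 2 * ((ENNReal.ofReal (D.h ^ 2) * (ENNReal.ofReal (D.h ^ 2))⁻¹) * ‖f‖ₑ ^ 2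
            + ENNReal.ofReal (D.kmax - D.kmin) *
              ((ENNReal.ofReal (D.h ^ 2) * (ENNReal.ofReal (D.h ^ 2))⁻¹) * ‖g‖ₑ ^ 2)) := by ring
          _ = _ := by rw [hc, one_mul, one_mul]

/-- The square of the Lipschitz constant of the reconstruction, for one node. -/
def coeffNodeConst (D : Config) (ρ : ℝ) : ℝ :=
  4 * (1 + (D.kmax - D.kmin)) * D.gridConst ^ 2 + 2 * D.h ^ 2 * D.len * D.coeffLowConst ρ ^ 2

theorem coeffNodeConst_nonneg (ρ : ℝ) : 0 ≤ D.coeffNodeConst ρ := by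
  have hK : 0 < D.kmax - D.kmin := sub_pos.2 D.k_lt
  have := len_pos (D := D)
  unfold coeffNodeConst
  positivity

/-- The Lipschitz constant, on the ball of radius `ρ` and in the norm of `L_2^h`, of the
reconstruction of the coefficient. -/
def coeffConst (D : Config) (ρ : ℝ) : ℝ := √(D.innerCard * D.coeffNodeConst ρ)

theorem coeffConst_nonneg (ρ : ℝ) : 0 ≤ D.coeffConst ρ := Real.sqrt_nonneg _

theorem lintegral_tailInt_lapCLM_le (i : D.Inner) (x : Pairs D) {k : ℝ}
    (hk : k ∈ Set.Icc D.kmin D.kmax) :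
    ENNReal.ofReal (D.h ^ 2) *
        ∫⁻ z, ‖tailInt (lapCLM unitMeas i x.1.1) (lapCLM D.kMeas i x.2.1) k z‖ₑ ^ 2 ∂D.zMeas
      ≤ ENNReal.ofReal (2 * (1 + (D.kmax - D.kmin)) * D.gridConst ^ 2 * ‖x‖ ^ 2) := by
  have hK : 0 < D.kmax - D.kmin := sub_pos.2 D.k_lt
  have hfst : ‖lapCLM unitMeas i x.1.1‖ ≤ D.gridConst * ‖x‖ := (norm_lapCLM_le i _).trans
    (mul_le_mul_of_nonneg_left (norm_fst_le x) gridConst_nonneg)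
  have hsnd : ‖lapCLM D.kMeas i x.2.1‖ ≤ D.gridConst * ‖x‖ := (norm_lapCLM_le i _).trans
    (mul_le_mul_of_nonneg_left (norm_snd_le x) gridConst_nonneg)
  refine (lintegral_tailInt_le _ _ hk).trans ?_
  rw [enorm_sq_eq_ofReal, enorm_sq_eq_ofReal, ← ENNReal.ofReal_mul hK.le,
    ← ENNReal.ofReal_add (by positivity) (by positivity), two_mul_ofReal]
  refine ENNReal.ofReal_le_ofReal ?_
  calc _ ≤ 2 * ((D.gridConst * ‖x‖) ^ 2 + (D.kmax - D.kmin) * (D.gridConst * ‖x‖) ^ 2) := by gcongr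
    _ = _ := by ring

section

variable {ρ : ℝ} {x y : Pairs D} (hx : ‖x‖ ≤ ρ) (hy : ‖y‖ ≤ ρ) (rule : Rule) {k : ℝ}
  (hk : k ∈ Set.Icc D.kmin D.kmax)

include hx hy hk

theorem lintegral_coeff_sub_le (i : D.Inner) :
    ENNReal.ofReal (D.h ^ 2) *
        ∫⁻ z, ‖coeff x.1.1 x.2.1 k i z rule - coeff y.1.1 y.2.1 k i z rule‖ₑ ^ 2 ∂D.zMeas
      ≤ ENNReal.ofReal (D.coeffNodeConst ρ * ‖x - y‖ ^ 2) := by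
  have hlen := len_pos (D := D)
  have hlow := mul_nonneg (coeffLowConst_nonneg (D := D) ((norm_nonneg x).trans hx))
    (norm_nonneg (x - y))
  have hK : 0 < D.kmax - D.kmin := sub_pos.2 D.k_lt
  set T := tailInt (lapCLM unitMeas i (x - y).1.1) (lapCLM D.kMeas i (x - y).2.1) k
  set low := D.coeffLowConst ρ * ‖x - y‖ with hlow_eq
  have hmeas : Measurable fun z => ‖T z‖ₑ ^ 2 :=
    ((stronglyMeasurable_tailInt _ _).comp_measurable
      (measurable_prodMk_left (x := k))).enorm.pow_const 2
  have hpointwise : ∀ᵐ z ∂D.zMeas,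
      ‖coeff x.1.1 x.2.1 k i z rule - coeff y.1.1 y.2.1 k i z rule‖ₑ ^ 2
        ≤ 2 * (‖T z‖ₑ ^ 2 + ENNReal.ofReal (low ^ 2)) := by
    filter_upwards [norm_coeff_sub_le i hx hy] with z hz
    rw [enorm_sq_eq_ofReal, enorm_sq_eq_ofReal, ← ENNReal.ofReal_add (sq_nonneg _) (sq_nonneg _),
      two_mul_ofReal]
    refine ENNReal.ofReal_le_ofReal ?_
    exact (pow_le_pow_left₀ (norm_nonneg _) (hz k hk rule) 2).trans add_sq_le
  calc _ ≤ ENNReal.ofReal (D.h ^ 2) *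
        ∫⁻ z, 2 * (‖T z‖ₑ ^ 2 + ENNReal.ofReal (low ^ 2)) ∂D.zMeas :=
        mul_le_mul_right (lintegral_mono_ae hpointwise) _
    _ = 2 * (ENNReal.ofReal (D.h ^ 2) * ∫⁻ z, ‖T z‖ₑ ^ 2 ∂D.zMeas)
        + 2 * (ENNReal.ofReal (D.h ^ 2) * (ENNReal.ofReal (low ^ 2) * ENNReal.ofReal D.len)) := by
        rw [lintegral_const_mul' _ _ ENNReal.ofNat_ne_top, lintegral_add_left hmeas,
          lintegral_const, zMeas_univ]
        ring
    _ ≤ 2 * ENNReal.ofReal (2 * (1 + (D.kmax - D.kmin)) * D.gridConst ^ 2 * ‖x - y‖ ^ 2)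
        + 2 * (ENNReal.ofReal (D.h ^ 2) * (ENNReal.ofReal (low ^ 2) * ENNReal.ofReal D.len)) := by
        gcongr
        exact lintegral_tailInt_lapCLM_le i (x - y) hk
    _ = ENNReal.ofReal (D.coeffNodeConst ρ * ‖x - y‖ ^ 2) := by
        rw [← ENNReal.ofReal_mul (sq_nonneg _), ← ENNReal.ofReal_mul (sq_nonneg _), two_mul_ofReal,
          two_mul_ofReal, ← ENNReal.ofReal_add (by positivity) (by positivity), hlow_eq,
          coeffNodeConst]
        congr 1
        ring

theorem l2h_coeff_sub_le {cs : D.Inner → ℝ → ℂ}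
    (hcs : ∀ i, ∀ᵐ z ∂D.zMeas, cs i z = coeff x.1.1 x.2.1 k i z rule) :
    l2h (fun i z => cs i z - coeff y.1.1 y.2.1 k i z rule)
      ≤ ENNReal.ofReal (D.coeffConst ρ * ‖x - y‖) := by
  have hnode : ∀ i : D.Inner, ENNReal.ofReal (D.h ^ 2) *
      ∫⁻ z, ‖cs i z - coeff y.1.1 y.2.1 k i z rule‖ₑ ^ 2 ∂D.zMeas
      ≤ ENNReal.ofReal (D.coeffNodeConst ρ * ‖x - y‖ ^ 2) := fun i => by
    rw [lintegral_congr_ae ((hcs i).mono fun z hz => by rw [hz])]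
    exact lintegral_coeff_sub_le hx hy rule hk i
  rw [l2h]
  calc _ ≤ (∑ _i : D.Inner, ENNReal.ofReal (D.coeffNodeConst ρ * ‖x - y‖ ^ 2)) ^ (1 / 2 : ℝ) :=
        ENNReal.rpow_le_rpow (Finset.sum_le_sum fun i _ => hnode i) (by norm_num)
    _ = ENNReal.ofReal (D.innerCard * D.coeffNodeConst ρ * ‖x - y‖ ^ 2) ^ (1 / 2 : ℝ) := by
        rw [Finset.sum_const, nsmul_eq_mul, Finset.card_univ, mul_assoc,
          ENNReal.ofReal_mul innerCard_nonneg, innerCard, ENNReal.ofReal_natCast]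
    _ = _ := by
        have h0 := mul_nonneg (innerCard_nonneg (D := D)) (coeffNodeConst_nonneg (D := D) ρ)
        rw [ENNReal.ofReal_rpow_of_nonneg (by positivity) (by norm_num), ← Real.sqrt_eq_rpow,
          Real.sqrt_mul h0, Real.sqrt_sq (norm_nonneg _), coeffConst]

end

end Config

section Quarter

variable {δ : ℝ}

theorem rpow_quarter_sq (hδ : 0 ≤ δ) : (δ ^ (1 / 4 : ℝ)) ^ 2 = √δ := by
  rw [← Real.rpow_natCast, ← Real.rpow_mul hδ, Real.sqrt_eq_rpow]
  norm_num

theorem sqrt_le_rpow_quarter (hδ : 0 ≤ δ) (hδ1 : δ ≤ 1) : √δ ≤ δ ^ (1 / 4 : ℝ) := by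
  rw [← rpow_quarter_sq hδ]
  exact pow_le_of_le_one (Real.rpow_nonneg hδ _) (Real.rpow_le_one hδ hδ1 (by norm_num))
    two_ne_zero

end Quarter

namespace Config

variable {D : Config}

/-- The derivative of `J_λ`, as an element of `H_{0,2}^h`, for the pair `x = (V, F)`. -/
def costGrad (x : Pairs D) (lam : ℝ) (p : D.H0 D.kMeas) : D.H0 D.kMeas :=
  (InnerProductSpace.toDual ℝ (D.H0 D.kMeas)).symm
    ((costPairDeriv lam (x + incl D p)).comp (incl D))

theorem inner_costGrad (x : Pairs D) (lam : ℝ) (p r : D.H0 D.kMeas) :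
    inner ℝ (costGrad x lam p) r = costPairDeriv lam (x + incl D p) (incl D r) := by
  rw [costGrad, InnerProductSpace.toDual_symm_apply, ContinuousLinearMap.comp_apply]

theorem hasFDerivAt_fieldCost (x : Pairs D) (lam : ℝ) (p : D.H0 D.kMeas) :
    HasFDerivAt (fieldCost (x.1 : D.Jet 2 unitMeas) (x.2 : D.Jet 2 D.kMeas) lam)
      (innerSL ℝ (costGrad x lam p)) p := by
  rw [funext (fieldCost_eq x lam)]
  refine ((hasFDerivAt_costPair lam (x + incl D p)).comp p
    ((incl D).hasFDerivAt.const_add x)).congr_fderiv (ContinuousLinearMap.ext fun r => ?_)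
  rw [innerSL_apply_apply, inner_costGrad]
  rfl

theorem add_incl_add_incl_sub (x : Pairs D) (a b : D.H0 D.kMeas) :
    x + incl D a + incl D (b - a) = x + incl D b := by
  rw [add_assoc, ← map_add, add_sub_cancel]

theorem fieldCost_sub_sub_inner_costGrad (x : Pairs D) (lam : ℝ) (a b : D.H0 D.kMeas) :
    fieldCost (x.1 : D.Jet 2 unitMeas) (x.2 : D.Jet 2 D.kMeas) lam b
        - fieldCost (x.1 : D.Jet 2 unitMeas) (x.2 : D.Jet 2 D.kMeas) lam a
        - inner ℝ (costGrad x lam a) (b - a)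
      = costPairRemainder lam (x + incl D a) (incl D (b - a)) := by
  rw [fieldCost_eq, fieldCost_eq, inner_costGrad, costPairRemainder,
    add_incl_add_incl_sub]

theorem fieldCost_nonneg (x : Pairs D) (lam : ℝ) (p : D.H0 D.kMeas) :
    0 ≤ fieldCost (x.1 : D.Jet 2 unitMeas) (x.2 : D.Jet 2 D.kMeas) lam p := by
  rw [fieldCost_eq, costPair]
  positivity

theorem lhPair_eq_zero_of_ae {x : Pairs D} {i : D.Inner}
    (h : ∀ᵐ w ∂D.cylMeas D.kMeas, Lh x.1.1 x.2.1 i w = 0) : lhPair i x = 0 := by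
  rw [Lp.ext_iff]
  filter_upwards [coeFn_lhPair i x, h, Lp.coeFn_zero ℂ 2 (D.cylMeas D.kMeas)]
    with w hlh heq hzero
  rw [hlh, heq, hzero, Pi.zero_apply]

variable {x xs : Pairs D} {lam R ρ : ℝ}

theorem norm_add_incl_le (hx : ‖x‖ + R ≤ ρ) {p : D.H0 D.kMeas}
    (hp : p ∈ Metric.closedBall (0 : D.H0 D.kMeas) R) : ‖x + incl D p‖ ≤ ρ := by
  rw [mem_closedBall_zero_iff] at hp
  have h := norm_add_le x (incl D p)
  rw [norm_incl] at h
  linarith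

theorem le_fieldCost_sub_sub_inner (hx : ‖x‖ + R ≤ ρ) (hl : D.len ≤ lam)
    (hl' : 2 * D.remainderConst ρ * D.len ≤ lam) :
    ∀ a ∈ Metric.closedBall (0 : D.H0 D.kMeas) R, ∀ b ∈ Metric.closedBall (0 : D.H0 D.kMeas) R,
      1 / (4 * D.jetCard) * ‖b - a‖ ^ 2
        ≤ fieldCost (x.1 : D.Jet 2 unitMeas) (x.2 : D.Jet 2 D.kMeas) lam b
          - fieldCost (x.1 : D.Jet 2 unitMeas) (x.2 : D.Jet 2 D.kMeas) lam a
          - inner ℝ (costGrad x lam a) (b - a) := fun a ha b hb => by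
  rw [fieldCost_sub_sub_inner_costGrad]
  refine le_costPairRemainder hl hl' (norm_add_incl_le hx ha) ?_
  rw [add_incl_add_incl_sub]
  exact norm_add_incl_le hx hb

theorem fieldCost_sub_sub_inner_le (hx : ‖x‖ + R ≤ ρ) (lam : ℝ) :
    ∀ a ∈ Metric.closedBall (0 : D.H0 D.kMeas) R, ∀ b ∈ Metric.closedBall (0 : D.H0 D.kMeas) R,
      fieldCost (x.1 : D.Jet 2 unitMeas) (x.2 : D.Jet 2 D.kMeas) lam b
          - fieldCost (x.1 : D.Jet 2 unitMeas) (x.2 : D.Jet 2 D.kMeas) lam a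
          - inner ℝ (costGrad x lam a) (b - a)
        ≤ D.remainderConst ρ * Real.exp (2 * (|lam| * D.len)) * ‖b - a‖ ^ 2 :=
    fun a ha b hb => by
  rw [fieldCost_sub_sub_inner_costGrad]
  refine costPairRemainder_le lam (norm_add_incl_le hx ha) ?_
  rw [add_incl_add_incl_sub]
  exact norm_add_incl_le hx hb

theorem exists_fieldCost_growth (hR : 0 ≤ R) (hx : ‖x‖ + R ≤ ρ) (hl : D.len ≤ lam)
    (hl' : 2 * D.remainderConst ρ * D.len ≤ lam) :
    ∃ a ∈ Metric.closedBall (0 : D.H0 D.kMeas) R, ∀ b ∈ Metric.closedBall (0 : D.H0 D.kMeas) R,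
      fieldCost (x.1 : D.Jet 2 unitMeas) (x.2 : D.Jet 2 D.kMeas) lam a
          + 1 / (8 * D.jetCard) * ‖a - b‖ ^ 2
        ≤ fieldCost (x.1 : D.Jet 2 unitMeas) (x.2 : D.Jet 2 D.kMeas) lam b := by
  have hcard := jetCard_pos (D := D)
  have hhalf : 1 / (8 * D.jetCard) = 1 / (4 * D.jetCard) / 2 := by
    field_simp
    norm_num
  rw [hhalf]
  exact exists_add_mul_norm_sub_sq_le_of_gradient Metric.isClosed_closedBall
    (convex_closedBall _ _) (Metric.nonempty_closedBall.2 hR)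
    (continuous_iff_continuousAt.2 fun p => (hasFDerivAt_fieldCost x lam p).continuousAt)
    ⟨0, Set.forall_mem_image.2 fun p _ => fieldCost_nonneg x lam p⟩ (by positivity)
    (le_fieldCost_sub_sub_inner hx hl hl')

theorem fieldCost_le_of_lhPair_eq_zero (hl : 0 ≤ lam) {p : D.H0 D.kMeas}
    (hx : ‖x + incl D p‖ ≤ ρ) (hxs : ‖xs‖ ≤ ρ) (h0 : ∀ i, lhPair i xs = 0) :
    fieldCost (x.1 : D.Jet 2 unitMeas) (x.2 : D.Jet 2 D.kMeas) lam p
      ≤ D.innerCard * (Real.exp (2 * (lam * D.len))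
        * (D.lipConst ρ * ‖xs - (x + incl D p)‖) ^ 2) := by
  rw [fieldCost_eq, costPair, ← sum_inner_const]
  refine Finset.sum_le_sum fun i _ => ?_
  have hlip := norm_lhPair_sub_le i hxs hx
  rw [h0 i, zero_sub, norm_neg] at hlip
  have hweight := norm_mulWeight_le lam (lhPair i (x + incl D p))
  rw [abs_of_nonneg hl] at hweight
  rw [← exp_sq, ← mul_pow]
  exact pow_le_pow_left₀ (norm_nonneg _)
    (hweight.trans (mul_le_mul_of_nonneg_left hlip (Real.exp_pos _).le)) 2

/-- The parameter `λ(δ)` of the Carleman weight; the tail function is computed with the parameter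
`μ(δ) = 2 λ(δ)`. -/
def carlemanParam (D : Config) (δ : ℝ) : ℝ := -Real.log δ / (4 * D.len)

section CarlemanParam

variable {δ : ℝ}

theorem log_rpow_eq_carlemanParam (hδ : 0 < δ) :
    Real.log (δ ^ (-(1 / (4 * (D.d + D.ξ))))) = D.carlemanParam δ := by
  rw [Real.log_rpow hδ, carlemanParam, ← len]
  ring

theorem log_rpow_eq_two_mul_carlemanParam (hδ : 0 < δ) :
    Real.log (δ ^ (-(1 / (2 * (D.d + D.ξ))))) = 2 * D.carlemanParam δ := by
  rw [Real.log_rpow hδ, carlemanParam, ← len]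
  ring

theorem exp_carlemanParam (hδ : 0 < δ) :
    Real.exp (2 * (D.carlemanParam δ * D.len)) = (√δ)⁻¹ := by
  have hlen := len_pos (D := D)
  have harg : 2 * (D.carlemanParam δ * D.len) = -(Real.log δ / 2) := by
    rw [carlemanParam]
    field_simp
    ring
  rw [harg, Real.exp_neg, Real.exp_half, Real.exp_log hδ]

theorem exp_two_mul_carlemanParam (hδ : 0 < δ) :
    Real.exp (2 * (2 * D.carlemanParam δ * D.len)) = 1 / δ := by
  rw [mul_assoc 2 (D.carlemanParam δ), ← exp_sq, exp_carlemanParam hδ, inv_pow, Real.sq_sqrt hδ.le,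
    one_div]

theorem lt_carlemanParam {l : ℝ} (hδ : δ ∈ Set.Ioo 0 (Real.exp (-4 * (D.d + D.ξ) * l))) :
    l < D.carlemanParam δ := by
  have hlen := len_pos (D := D)
  rw [carlemanParam, lt_div_iff₀ (by positivity), len]
  linarith [(Real.log_lt_iff_lt_exp hδ.1).2 hδ.2]

end CarlemanParam

end Config

theorem le_mul_rpow_quarter_of_sq_le {c n L t δ : ℝ} (hc : 0 < c) (hn : 0 ≤ n) (hL : 0 ≤ L)
    (hδ : 0 < δ) (h : 1 / (8 * c) * t ^ 2 ≤ n * ((√δ)⁻¹ * (L * √δ) ^ 2)) :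
    t ≤ √(8 * c * n) * L * δ ^ (1 / 4 : ℝ) := by
  have _ := Real.sqrt_pos.2 hδ
  refine le_of_sq_le_sq ?_ (by positivity)
  rw [mul_pow, mul_pow, Real.sq_sqrt (by positivity), rpow_quarter_sq hδ.le]
  calc t ^ 2 = 8 * c * (1 / (8 * c) * t ^ 2) := by field_simp
    _ ≤ 8 * c * (n * ((√δ)⁻¹ * (L * √δ) ^ 2)) := mul_le_mul_of_nonneg_left h (by positivity)
    _ = 8 * c * n * L ^ 2 * √δ := by field_simp

theorem forall_mem_of_isProjection {X : Type} [NormedAddCommGroup X] {S : Set X} {y p : ℕ → X}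
    (h0 : p 0 ∈ S) (hp : ∀ n, IsProjection S (y n) (p (n + 1))) : ∀ n, p n ∈ S
  | 0 => h0
  | n + 1 => (hp n).1

theorem IsUniqueMinOn.le {X : Type} {f : X → ℝ} {S : Set X} {x : X} (h : IsUniqueMinOn f S x) :
    ∀ y ∈ S, f x ≤ f y := fun y hy => by
  rcases eq_or_ne y x with rfl | hne
  exacts [le_rfl, (h.2 y hy hne).le]

namespace Config

variable {D : Config}

/-- The constant in the stability estimate of the minimizer of `J_λ`. -/
def stabConst (D : Config) (ρ : ℝ) : ℝ :=
  √(8 * D.jetCard * D.innerCard) * (D.lipConst ρ * D.tailConst)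

/-- The constant `C₂` in the error estimates. -/
def errConst (D : Config) (ρ : ℝ) : ℝ :=
  1 + D.stabConst ρ + D.coeffConst ρ * (D.tailConst + D.stabConst ρ) + D.coeffConst ρ

/-- The threshold `λ₁` for the parameter of the Carleman weight. -/
def lamBound (D : Config) (ρ : ℝ) : ℝ :=
  2 + D.len + 2 * D.remainderConst ρ * D.len + 2 * (D.innerCard * D.gridConst ^ 2) * D.len

/-- The bound `γ₀(λ)` for the step size of the gradient projection method. -/
def stepBound (D : Config) (ρ lam : ℝ) : ℝ :=
  min (1 / 2) (min (1 / (2 * (D.remainderConst ρ * Real.exp (2 * (|lam| * D.len)) + 1))) D.jetCard)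

/-- The convergence rate `θ` of the gradient projection method with step size `γ`. -/
def stepRate (D : Config) (γ : ℝ) : ℝ := √(1 - 2 * γ * (1 / (4 * D.jetCard)))

/-- A radius for all the pairs `(V, q)` which occur in the convergence analysis. -/
def radius (D : Config) (R A B : ℝ) : ℝ := |A| + |B| + R + D.tailConst + 1

theorem mem_Ioc_of_lt_exp {l δ : ℝ} (hl : 0 ≤ l)
    (hδ : δ ∈ Set.Ioo 0 (Real.exp (-4 * (D.d + D.ξ) * l))) : δ ∈ Set.Ioc 0 1 := by
  have hlen : 0 ≤ (D.d + D.ξ) * l := mul_nonneg len_pos.le hl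
  exact ⟨hδ.1, hδ.2.le.trans (Real.exp_le_one_iff.2 (by linarith))⟩

section Constants

variable {R ρ lam γ : ℝ}

theorem radius_nonneg (hR : 0 ≤ R) (A B : ℝ) : 0 ≤ D.radius R A B := by
  have := tailConst_nonneg (D := D)
  unfold radius
  positivity

theorem stabConst_nonneg (hρ : 0 ≤ ρ) : 0 ≤ D.stabConst ρ :=
  mul_nonneg (Real.sqrt_nonneg _) (mul_nonneg (lipConst_nonneg hρ) tailConst_nonneg)

theorem errConst_pos (hρ : 0 ≤ ρ) : 0 < D.errConst ρ := by
  have h1 := stabConst_nonneg (D := D) hρ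
  have h2 := coeffConst_nonneg (D := D) ρ
  have h3 := tailConst_nonneg (D := D)
  unfold errConst
  positivity

theorem stabConst_le_errConst (hρ : 0 ≤ ρ) : D.stabConst ρ ≤ D.errConst ρ := by
  have h1 := stabConst_nonneg (D := D) hρ
  have h2 := coeffConst_nonneg (D := D) ρ
  have h3 := mul_nonneg h2 (add_nonneg (tailConst_nonneg (D := D)) h1)
  unfold errConst
  linarith

theorem coeffConst_mul_le_errConst (hρ : 0 ≤ ρ) :
    D.coeffConst ρ * (D.tailConst + D.stabConst ρ) ≤ D.errConst ρ := by
  have h1 := stabConst_nonneg (D := D) hρ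
  have h2 := coeffConst_nonneg (D := D) ρ
  unfold errConst
  linarith

theorem coeffConst_le_errConst (hρ : 0 ≤ ρ) : D.coeffConst ρ ≤ D.errConst ρ := by
  have h1 := stabConst_nonneg (D := D) hρ
  have h2 := mul_nonneg (coeffConst_nonneg (D := D) ρ) (add_nonneg (tailConst_nonneg (D := D)) h1)
  unfold errConst
  linarith

theorem one_lt_lamBound (hρ : 0 ≤ ρ) : 1 < D.lamBound ρ := by
  have h1 := len_pos (D := D)
  have h2 := remainderConst_nonneg (D := D) hρ
  have h3 := innerCard_nonneg (D := D)
  have h4 : 0 ≤ D.len + 2 * D.remainderConst ρ * D.len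
    + 2 * (D.innerCard * D.gridConst ^ 2) * D.len := by positivity
  unfold lamBound
  linarith

theorem len_le_lamBound (hρ : 0 ≤ ρ) : D.len ≤ D.lamBound ρ := by
  have h1 := len_pos (D := D)
  have h2 := remainderConst_nonneg (D := D) hρ
  have h3 := innerCard_nonneg (D := D)
  have h4 : 0 ≤ 2 * D.remainderConst ρ * D.len
    + 2 * (D.innerCard * D.gridConst ^ 2) * D.len := by positivity
  unfold lamBound
  linarith

theorem two_mul_remainderConst_mul_len_le_lamBound :
    2 * D.remainderConst ρ * D.len ≤ D.lamBound ρ := by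
  have h1 := len_pos (D := D)
  have h3 := innerCard_nonneg (D := D)
  have h4 : 0 ≤ 2 * (D.innerCard * D.gridConst ^ 2) * D.len := by positivity
  unfold lamBound
  linarith

theorem two_mul_gridConst_sq_mul_len_le_lamBound (hρ : 0 ≤ ρ) :
    2 * (D.innerCard * D.gridConst ^ 2) * D.len ≤ D.lamBound ρ := by
  have h1 := len_pos (D := D)
  have h2 := remainderConst_nonneg (D := D) hρ
  have h4 : 0 ≤ 2 * D.remainderConst ρ * D.len := by positivity
  unfold lamBound
  linarith

theorem stepBound_mem_Ioo (hρ : 0 ≤ ρ) (lam : ℝ) : D.stepBound ρ lam ∈ Set.Ioo 0 1 := by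
  have h1 := remainderConst_nonneg (D := D) hρ
  have h2 := jetCard_pos (D := D)
  exact ⟨lt_min (by norm_num) (lt_min (by positivity) h2),
    (min_le_left _ _).trans_lt (by norm_num)⟩

theorem two_mul_step_mul_remainderConst_le_one (hρ : 0 ≤ ρ)
    (hγ : γ ∈ Set.Ioo 0 (D.stepBound ρ lam)) :
    2 * γ * (D.remainderConst ρ * Real.exp (2 * (|lam| * D.len))) ≤ 1 := by
  have h1 := mul_nonneg (remainderConst_nonneg (D := D) hρ) (Real.exp_pos (2 * (|lam| * D.len))).le
  have h2 := hγ.2.le.trans ((min_le_right _ _).trans (min_le_left _ _))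
  rw [le_div_iff₀ (by positivity)] at h2
  linarith [hγ.1]

theorem stepRate_nonneg (γ : ℝ) : 0 ≤ D.stepRate γ := Real.sqrt_nonneg _

theorem stepRate_mem_Ioo (hγ : γ ∈ Set.Ioo 0 (D.stepBound ρ lam)) :
    D.stepRate γ ∈ Set.Ioo 0 1 := by
  have hcard := jetCard_pos (D := D)
  have hlt := hγ.2.trans_le ((min_le_right _ _).trans (min_le_right _ _))
  have hrate : 2 * γ * (1 / (4 * D.jetCard)) = 1 / 2 * (γ / D.jetCard) := by
    field_simp
    ring
  have hratio : γ / D.jetCard < 1 := (div_lt_one hcard).2 hlt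
  have hratio' : 0 < γ / D.jetCard := div_pos hγ.1 hcard
  rw [stepRate, hrate]
  exact ⟨Real.sqrt_pos.2 (by linarith), (Real.sqrt_lt' one_pos).2 (by linarith)⟩

end Constants

/-- `xs = (V_*, q_*)` is an exact solution with `p_* = ps ∈ B(R)`, and `x = (V, F)` consists of the
computed tail function and the extension of the noisy data; `ρ` bounds all the pairs in question. -/
structure IsNoisyData (R ρ δ : ℝ) (xs x : Pairs D) (ps : D.H0 D.kMeas) : Prop where
  norm_exact_le : ‖xs‖ ≤ ρ
  norm_noisy_add_le : ‖x‖ + R ≤ ρ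
  mem_ball : ps ∈ Metric.ball (0 : D.H0 D.kMeas) R
  lhPair_exact : ∀ i, lhPair i xs = 0
  norm_sub_le : ‖xs - (x + incl D ps)‖ ≤ D.tailConst * √δ

theorem norm_sub_add_incl_le (xs x : Pairs D) (ps p : D.H0 D.kMeas) :
    ‖xs - (x + incl D p)‖ ≤ ‖xs - (x + incl D ps)‖ + ‖ps - p‖ := by
  rw [← norm_incl (ps - p)]
  refine (norm_add_le _ _).trans_eq' (congrArg _ ?_)
  rw [map_sub]
  abel

theorem coe_snd_sub_add_incl (xs x : Pairs D) (p : D.H0 D.kMeas) :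
    ((xs - (x + incl D p)).2 : D.Jet 2 D.kMeas) = xs.2 - (p + x.2) := by
  rw [Prod.snd_sub, Submodule.coe_sub, coe_snd_add_incl]

theorem isNoisyData_of_norm_sub_le {R A B δ : ℝ} (hδ : δ ∈ Set.Ioc 0 1) {Vs V : D.H 2 unitMeas}
    {qs F : D.H 2 D.kMeas} {Fs : D.Jet 2 D.kMeas} (hB : ‖Vs‖ ≤ B) (hA : ‖Fs‖ ≤ A)
    (hqF : (qs : D.Jet 2 D.kMeas) - Fs ∈ D.H0 D.kMeas) (hR : ‖(qs : D.Jet 2 D.kMeas) - Fs‖ < R)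
    (heq : ∀ i, ∀ᵐ w ∂D.cylMeas D.kMeas, Lh (Vs : D.Jet 2 unitMeas) (qs : D.Jet 2 D.kMeas) i w = 0)
    (hV : ‖V - Vs‖ ≤ D.tailConst * √δ) (hF : ‖(F : D.Jet 2 D.kMeas) - Fs‖ < δ) :
    IsNoisyData R (D.radius R A B) δ (Vs, qs) (V, F) ⟨_, hqF⟩ := by
  have hsqrt : δ ≤ √δ := Real.le_sqrt_of_sq_le (by nlinarith [hδ.1, hδ.2])
  have htail : D.tailConst * √δ ≤ D.tailConst :=
    mul_le_of_le_one_right tailConst_nonneg (Real.sqrt_le_one.2 hδ.2)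
  have htail' : √δ ≤ D.tailConst * √δ :=
    le_mul_of_one_le_left (Real.sqrt_nonneg _) one_le_tailConst
  have hnormV := norm_le_norm_add_norm_sub' V Vs
  have hnormq := norm_le_norm_add_norm_sub' (qs : D.Jet 2 D.kMeas) Fs
  have hnormF := norm_le_norm_add_norm_sub' (F : D.Jet 2 D.kMeas) Fs
  have hA' := hA.trans (le_abs_self A)
  have hB' := hB.trans (le_abs_self B)
  have h0 := norm_nonneg Fs
  have h0' := norm_nonneg Vs
  have hR0 := (norm_nonneg _).trans_lt hR
  have hRad : D.radius R A B = |A| + |B| + R + D.tailConst + 1 := rfl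
  have htail0 := tailConst_nonneg (D := D)
  refine ⟨max_le ?_ ?_, ?_, mem_ball_zero_iff.2 hR, fun i => lhPair_eq_zero_of_ae (heq i),
    max_le ?_ ?_⟩
  · linarith
  · exact hnormq.trans (by linarith)
  · have : ‖(V, F)‖ ≤ D.radius R A B - R := max_le (by linarith) (hnormF.trans (by linarith [hδ.2]))
    linarith
  · rw [Prod.fst_sub, Prod.fst_add, incl_fst, add_zero, norm_sub_rev]
    exact hV
  · have hsnd : (qs : D.Jet 2 D.kMeas) - (((qs : D.Jet 2 D.kMeas) - Fs) + F) = Fs - F := by abel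
    exact (congrArg norm ((coe_snd_sub_add_incl (Vs, qs) (V, F) ⟨_, hqF⟩).trans hsnd)).trans_le
      ((norm_sub_rev _ _).trans_le (hF.le.trans (hsqrt.trans htail')))

namespace IsNoisyData

variable {R ρ δ : ℝ} {xs x : Pairs D} {ps : D.H0 D.kMeas}

theorem bound_nonneg (h : IsNoisyData R ρ δ xs x ps) : 0 ≤ ρ :=
  (norm_nonneg xs).trans h.norm_exact_le

theorem radius_pos (h : IsNoisyData R ρ δ xs x ps) : 0 < R := Metric.pos_of_mem_ball h.mem_ball

theorem norm_sub_le_of_growth (h : IsNoisyData R ρ δ xs x ps) (hδ : 0 < δ)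
    (hlam : 0 ≤ D.carlemanParam δ) {pmin : D.H0 D.kMeas}
    (hgrowth : ∀ p ∈ Metric.closedBall (0 : D.H0 D.kMeas) R,
      fieldCost (x.1 : D.Jet 2 unitMeas) (x.2 : D.Jet 2 D.kMeas) (D.carlemanParam δ) pmin
          + 1 / (8 * D.jetCard) * ‖pmin - p‖ ^ 2
        ≤ fieldCost (x.1 : D.Jet 2 unitMeas) (x.2 : D.Jet 2 D.kMeas) (D.carlemanParam δ) p) :
    ‖ps - pmin‖ ≤ D.stabConst ρ * δ ^ (1 / 4 : ℝ) := by
  have hlip := lipConst_nonneg (D := D) h.bound_nonneg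
  have hps := Metric.ball_subset_closedBall h.mem_ball
  have hcost := fieldCost_le_of_lhPair_eq_zero hlam (norm_add_incl_le h.norm_noisy_add_le hps)
    h.norm_exact_le h.lhPair_exact
  rw [exp_carlemanParam hδ] at hcost
  have hlow := fieldCost_nonneg x (D.carlemanParam δ) pmin
  rw [norm_sub_rev]
  refine le_mul_rpow_quarter_of_sq_le jetCard_pos innerCard_nonneg
    (mul_nonneg hlip tailConst_nonneg) hδ ?_
  calc 1 / (8 * D.jetCard) * ‖pmin - ps‖ ^ 2
      ≤ fieldCost (x.1 : D.Jet 2 unitMeas) (x.2 : D.Jet 2 D.kMeas) (D.carlemanParam δ) ps := by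
        linarith [hgrowth ps hps]
    _ ≤ D.innerCard * ((√δ)⁻¹ * (D.lipConst ρ * ‖xs - (x + incl D ps)‖) ^ 2) := hcost
    _ ≤ D.innerCard * ((√δ)⁻¹ * (D.lipConst ρ * (D.tailConst * √δ)) ^ 2) := by
        have := innerCard_nonneg (D := D)
        gcongr
        exact h.norm_sub_le
    _ = _ := by rw [mul_assoc (D.lipConst ρ)]

theorem exists_minimizer (h : IsNoisyData R ρ δ xs x ps) (hδ : 0 < δ)
    (hlam : D.lamBound ρ ≤ D.carlemanParam δ) :
    ∃ pmin : D.H0 D.kMeas,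
      IsUniqueMinOn (fieldCost (x.1 : D.Jet 2 unitMeas) (x.2 : D.Jet 2 D.kMeas)
        (D.carlemanParam δ)) (Metric.closedBall 0 R) pmin ∧
      ‖ps - pmin‖ ≤ D.stabConst ρ * δ ^ (1 / 4 : ℝ) := by
  have hlen := (len_le_lamBound h.bound_nonneg).trans hlam
  have hcard := jetCard_pos (D := D)
  obtain ⟨pmin, hpmin, hgrowth⟩ := exists_fieldCost_growth h.radius_pos.le h.norm_noisy_add_le hlen
    (two_mul_remainderConst_mul_len_le_lamBound.trans hlam)
  exact ⟨pmin, isUniqueMinOn_of_add_mul_norm_sub_sq_le (by positivity) hpmin hgrowth,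
    h.norm_sub_le_of_growth hδ (len_pos.le.trans hlen) hgrowth⟩

theorem l2h_coeff_sub_le (h : IsNoisyData R ρ δ xs x ps) (hδ : δ ∈ Set.Ioc 0 1)
    {p : D.H0 D.kMeas} (hp : p ∈ Metric.closedBall (0 : D.H0 D.kMeas) R) {t : ℝ} (ht : 0 ≤ t)
    (hpt : ‖ps - p‖ ≤ D.stabConst ρ * δ ^ (1 / 4 : ℝ) + t) (rule : Rule) {k : ℝ}
    (hk : k ∈ Set.Icc D.kmin D.kmax) {cs : D.Inner → ℝ → ℂ}
    (hcs : ∀ i, ∀ᵐ z ∂D.zMeas, cs i z = coeff xs.1.1 xs.2.1 k i z rule) :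
    l2h (fun i z => cs i z
        - coeff (x.1 : D.Jet 2 unitMeas) ((p : D.Jet 2 D.kMeas) + x.2) k i z rule)
      ≤ ENNReal.ofReal (D.errConst ρ * δ ^ (1 / 4 : ℝ) + D.errConst ρ * t) := by
  have hρ := h.bound_nonneg
  have hcoeff := Config.l2h_coeff_sub_le h.norm_exact_le (norm_add_incl_le h.norm_noisy_add_le hp)
    rule hk hcs
  rw [coe_fst_add_incl, coe_snd_add_incl] at hcoeff
  refine hcoeff.trans (ENNReal.ofReal_le_ofReal ?_)
  calc D.coeffConst ρ * ‖xs - (x + incl D p)‖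
      ≤ D.coeffConst ρ * (D.tailConst * δ ^ (1 / 4 : ℝ)
          + (D.stabConst ρ * δ ^ (1 / 4 : ℝ) + t)) :=
        mul_le_mul_of_nonneg_left ((norm_sub_add_incl_le xs x ps p).trans (add_le_add
          (h.norm_sub_le.trans (mul_le_mul_of_nonneg_left (sqrt_le_rpow_quarter hδ.1.le hδ.2)
            tailConst_nonneg)) hpt)) (coeffConst_nonneg ρ)
    _ = D.coeffConst ρ * (D.tailConst + D.stabConst ρ) * δ ^ (1 / 4 : ℝ)
          + D.coeffConst ρ * t := by ring
    _ ≤ _ := add_le_add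
        (mul_le_mul_of_nonneg_right (coeffConst_mul_le_errConst hρ) (Real.rpow_nonneg hδ.1.le _))
        (mul_le_mul_of_nonneg_right (coeffConst_le_errConst hρ) ht)

end IsNoisyData

theorem mul_sq_le_fieldCost_add_sub_sub_inner {x : Pairs D} {R ρ lam : ℝ} (hρ : 0 ≤ ρ)
    (hx : ‖x‖ + R ≤ ρ) (hlam : D.lamBound ρ ≤ lam) {p r : D.H0 D.kMeas} (hp : ‖p‖ ≤ R)
    (hr : ‖p + r‖ ≤ R) :
    1 / (4 * D.jetCard) * ‖r‖ ^ 2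
      ≤ fieldCost (x.1 : D.Jet 2 unitMeas) (x.2 : D.Jet 2 D.kMeas) lam (p + r)
        - fieldCost (x.1 : D.Jet 2 unitMeas) (x.2 : D.Jet 2 D.kMeas) lam p
        - inner ℝ (costGrad x lam p) r := by
  have h := le_fieldCost_sub_sub_inner hx ((len_le_lamBound hρ).trans hlam)
    (two_mul_remainderConst_mul_len_le_lamBound.trans hlam) p (mem_closedBall_zero_iff.2 hp)
    (p + r) (mem_closedBall_zero_iff.2 hr)
  rwa [add_sub_cancel_left] at h

theorem norm_sub_iterate_le {x : Pairs D} {R ρ lam γ : ℝ} (hρ : 0 ≤ ρ) (hx : ‖x‖ + R ≤ ρ)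
    (hlam : D.lamBound ρ ≤ lam) (hγ : γ ∈ Set.Ioo 0 (D.stepBound ρ lam)) {pmin : D.H0 D.kMeas}
    (hmin : IsUniqueMinOn (fieldCost (x.1 : D.Jet 2 unitMeas) (x.2 : D.Jet 2 D.kMeas) lam)
      (Metric.closedBall 0 R) pmin) {p : ℕ → D.H0 D.kMeas}
    (hp0 : ‖p 0‖ < R)
    (hp : ∀ n, IsProjection (Metric.closedBall 0 R) (p n - γ • costGrad x lam (p n)) (p (n + 1)))
    (n : ℕ) : ‖pmin - p n‖ ≤ D.stepRate γ ^ n * ‖pmin - p 0‖ :=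
  norm_sub_gradient_projection_le (convex_closedBall 0 R) hγ.1.le
    (two_mul_step_mul_remainderConst_le_one hρ hγ) hmin.1 hmin.le
    (le_fieldCost_sub_sub_inner hx ((len_le_lamBound hρ).trans hlam)
      (two_mul_remainderConst_mul_len_le_lamBound.trans hlam))
    (fieldCost_sub_sub_inner_le hx lam) hp
    (forall_mem_of_isProjection (mem_closedBall_zero_iff.2 hp0.le) hp) n

end Config

end Convexification

end

open Convexification Convexification.Config in
theorem theorem7p6_general (D : Config) (R A B : ℝ) (hR : 0 < R) :
    ∃ (lam₁ C₁ C₂ : ℝ) (γ₀ : ℝ → ℝ) (θ : ℝ → ℝ → ℝ),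
      1 < lam₁ ∧ 0 < C₁ ∧ 0 < C₂ ∧ (∀ lam, γ₀ lam ∈ Set.Ioo 0 1) ∧
      (∀ lam, ∀ γ ∈ Set.Ioo 0 (γ₀ lam), θ lam γ ∈ Set.Ioo 0 1) ∧
      ∀ δ ∈ Set.Ioo 0 (Real.exp (-4 * (D.d + D.ξ) * lam₁)),
      ∀ Vs Qs : D.Jet 2 unitMeas, Vs ∈ D.H 2 unitMeas → Vs - Qs ∈ D.H0 unitMeas →
        (∀ i, ∀ᵐ w ∂D.cylMeas unitMeas, lapH Vs i w = 0) → ‖Vs‖ ≤ B →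
      ∀ qs Fs : D.Jet 2 D.kMeas, qs ∈ D.H 2 D.kMeas → qs - Fs ∈ D.H0 D.kMeas →
        (∀ i, ∀ᵐ w ∂D.cylMeas D.kMeas, Lh Vs qs i w = 0) → ‖Fs‖ ≤ A → ‖qs - Fs‖ < R →
      ∀ Q ∈ D.H 2 unitMeas, ‖Q - Qs‖ < δ → ∀ F ∈ D.H 2 D.kMeas, ‖F - Fs‖ < δ →
      ∃ W : D.H0 unitMeas,
        IsUniqueMinOn (tailCost Q (Real.log (δ ^ (-(1 / (2 * (D.d + D.ξ))))))) Set.univ W ∧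
      ∀ V : D.Jet 2 unitMeas, V = (W : D.Jet 2 unitMeas) + Q →
      ∃ G : ℝ → D.H0 D.kMeas → D.H0 D.kMeas,
        (∀ lam p, HasFDerivAt (fieldCost V F lam) (innerSL ℝ (G lam p)) p) ∧
        (∀ lam, lam₁ ≤ lam → ∀ p r : D.H0 D.kMeas, ‖p‖ ≤ R → ‖p + r‖ ≤ R →
          C₁ * ‖r‖ ^ 2 ≤ fieldCost V F lam (p + r) - fieldCost V F lam p - inner ℝ (G lam p) r) ∧
      ∀ lam : ℝ, lam = Real.log (δ ^ (-(1 / (4 * (D.d + D.ξ))))) →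
        lam₁ < lam ∧
        ∃ pmin : D.H0 D.kMeas, IsUniqueMinOn (fieldCost V F lam) (Metric.closedBall 0 R) pmin ∧
        ‖(qs - Fs) - (pmin : D.Jet 2 D.kMeas)‖ ≤ C₂ * δ ^ (1 / 4 : ℝ) ∧
        (∀ (ρ : Rule), ∀ k ∈ Set.Icc D.kmin D.kmax, ∀ cs : D.Inner → ℝ → ℂ,
          (∀ i, ∀ᵐ z ∂D.zMeas, cs i z = coeff Vs qs k i z ρ) →
          l2h (fun i z => cs i z - coeff V (pmin + F) k i z ρ)
            ≤ ENNReal.ofReal (C₂ * δ ^ (1 / 4 : ℝ))) ∧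
        ∀ γ ∈ Set.Ioo 0 (γ₀ lam), ∀ p : ℕ → D.H0 D.kMeas, ‖p 0‖ < R →
          (∀ n, IsProjection (Metric.closedBall 0 R) (p n - γ • G lam (p n)) (p (n + 1))) →
          ∀ n : ℕ,
            ‖pmin - p n‖ ≤ θ lam γ ^ n * ‖pmin - p 0‖ ∧
            ‖(qs - Fs) - (p n : D.Jet 2 D.kMeas)‖
              ≤ C₂ * δ ^ (1 / 4 : ℝ) + θ lam γ ^ n * ‖pmin - p 0‖ ∧
            ∀ (ρ : Rule), ∀ k ∈ Set.Icc D.kmin D.kmax, ∀ cs : D.Inner → ℝ → ℂ,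
              (∀ i, ∀ᵐ z ∂D.zMeas, cs i z = coeff Vs qs k i z ρ) →
              l2h (fun i z => cs i z - coeff V (p n + F) k i z ρ)
                ≤ ENNReal.ofReal (C₂ * δ ^ (1 / 4 : ℝ)
                  + C₂ * (θ lam γ ^ n * ‖pmin - p 0‖)) := by
  have hρ := radius_nonneg (D := D) hR.le A B
  have hcard := jetCard_pos (D := D)
  refine ⟨D.lamBound (D.radius R A B), 1 / (4 * D.jetCard), D.errConst (D.radius R A B),
    D.stepBound (D.radius R A B), fun _ => D.stepRate, one_lt_lamBound hρ, by positivity,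
    errConst_pos hρ, stepBound_mem_Ioo hρ, fun _ _ => stepRate_mem_Ioo, ?_⟩
  intro δ hδ Vs Qs hVs hVQ hV hB qs Fs hqs hqF hq hA hps Q hQ hQδ F hF hFδ
  have hlam := lt_carlemanParam hδ
  have hδ1 := mem_Ioc_of_lt_exp (zero_lt_one.trans (one_lt_lamBound hρ)).le hδ
  have hlam0 := (zero_lt_one.trans (one_lt_lamBound hρ)).trans hlam
  rw [log_rpow_eq_carlemanParam hδ.1, log_rpow_eq_two_mul_carlemanParam hδ.1]
  obtain ⟨W, hW, hWs⟩ := exists_tail hδ.1 hδ1.2 (exp_two_mul_carlemanParam hδ.1)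
    (by linarith [len_le_lamBound (D := D) hρ])
    (by linarith [two_mul_gridConst_sq_mul_len_le_lamBound (D := D) hρ]) hVQ hV hQδ
  refine ⟨W, hW, ?_⟩
  rintro _ rfl
  have hWQ : (W : D.Jet 2 unitMeas) + Q ∈ D.H 2 unitMeas := add_mem (H0_le_H W.2) hQ
  have h := isNoisyData_of_norm_sub_le hδ1 (Vs := ⟨Vs, hVs⟩)
    (V := ⟨_, hWQ⟩) (qs := ⟨qs, hqs⟩) (F := ⟨F, hF⟩) hB hA hqF hps hq hWs hFδ
  have hx := h.norm_noisy_add_le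
  refine ⟨costGrad (⟨_, hWQ⟩, ⟨F, hF⟩), hasFDerivAt_fieldCost (⟨_, hWQ⟩, ⟨F, hF⟩),
    fun lam hlam p r hp hr => mul_sq_le_fieldCost_add_sub_sub_inner hρ hx hlam hp hr, ?_⟩
  rintro _ rfl
  obtain ⟨pmin, hmin, hstab⟩ := h.exists_minimizer hδ.1 hlam.le
  have herr : D.stabConst _ * δ ^ (1 / 4 : ℝ) ≤ D.errConst _ * δ ^ (1 / 4 : ℝ) :=
    mul_le_mul_of_nonneg_right (stabConst_le_errConst hρ) (Real.rpow_nonneg hδ.1.le _)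
  refine ⟨hlam, pmin, hmin, hstab.trans herr, fun rule k hk cs hcs => ?_,
    fun γ hγ p hp0 hp n => ?_⟩
  · simpa only [mul_zero, add_zero] using
      h.l2h_coeff_sub_le hδ1 hmin.1 le_rfl (hstab.trans_eq (add_zero _).symm) rule hk hcs
  · have hconv := norm_sub_iterate_le hρ hx hlam.le hγ hmin hp0 hp n
    have hsum := (norm_sub_le_norm_sub_add_norm_sub _ pmin (p n)).trans (add_le_add hstab hconv)
    exact ⟨hconv, hsum.trans (add_le_add_left herr _),
      fun rule k hk cs hcs => h.l2h_coeff_sub_le hδ1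
        (forall_mem_of_isProjection (mem_closedBall_zero_iff.2 hp0.le) hp n)
        (mul_nonneg (pow_nonneg (stepRate_nonneg γ) n) (norm_nonneg _)) hsum rule hk hcs⟩

open Convexification Convexification.Config in
theorem theorem7p6 (D : Config) (R A B : ℝ) (hR : 0 < R) :
    -- `lam₁`, `C₁`, `C₂`, `γ₀`, `θ` depend only on the geometry, `R`, `kmin`, `kmax` and on the
    -- bounds `A`, `B` for the norms of `F_*`, `V_*`
    ∃ (lam₁ C₁ C₂ : ℝ) (γ₀ : ℝ → ℝ) (θ : ℝ → ℝ → ℝ),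
      1 < lam₁ ∧ 0 < C₁ ∧ 0 < C₂ ∧ (∀ lam, γ₀ lam ∈ Set.Ioo 0 1) ∧
      (∀ lam, ∀ γ ∈ Set.Ioo 0 (γ₀ lam), θ lam γ ∈ Set.Ioo 0 1) ∧
      ∀ δ ∈ Set.Ioo 0 (Real.exp (-4 * (D.d + D.ξ) * lam₁)),
      -- the exact solution, its boundary data and their extensions
      ∀ (ψ₀s ψ₁s : D.Inner → Unit → ℂ) (Vs Qs : D.Jet 2 unitMeas),
        IsTail Vs ψ₀s ψ₁s → Qs ∈ D.H 2 unitMeas → HasBC Qs ψ₀s ψ₁s → ‖Vs‖ ≤ B →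
      ∀ (φ₀s φ₁s : D.Inner → ℝ → ℂ) (qs : D.Jet 2 D.kMeas) (Fs : D.Jet 3 D.kMeas),
        IsField Vs qs φ₀s φ₁s → Fs ∈ D.H 3 D.kMeas → HasBC (trunc Fs) φ₀s φ₁s → ‖Fs‖ ≤ A →
        ‖qs - trunc Fs‖ < R →
      -- the noisy data
      ∀ (ψ₀ ψ₁ : D.Inner → Unit → ℂ) (Q : D.Jet 2 unitMeas),
        Q ∈ D.H 2 unitMeas → HasBC Q ψ₀ ψ₁ → ‖Q - Qs‖ < δ →
      ∀ (φ₀ φ₁ : D.Inner → ℝ → ℂ) (F : D.Jet 3 D.kMeas),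
        F ∈ D.H 3 D.kMeas → HasBC (trunc F) φ₀ φ₁ → ‖F - Fs‖ < δ →
      -- the tail function
      ∃ W : D.H0 unitMeas,
        IsUniqueMinOn (tailCost Q (Real.log (δ ^ (-(1 / (2 * (D.d + D.ξ))))))) Set.univ W ∧
      ∀ V : D.Jet 2 unitMeas, V = (W : D.Jet 2 unitMeas) + Q →
      -- the Fréchet derivative `G lam p` of the functional, and its strict convexity on the ball
      ∃ G : ℝ → D.H0 D.kMeas → D.H0 D.kMeas,
        (∀ lam p, HasFDerivAt (cost V F lam) (innerSL ℝ (G lam p)) p) ∧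
        (∀ lam, lam₁ ≤ lam → ∀ p r : D.H0 D.kMeas, ‖p‖ ≤ R → ‖p + r‖ ≤ R →
          C₁ * ‖r‖ ^ 2 ≤ cost V F lam (p + r) - cost V F lam p - inner ℝ (G lam p) r) ∧
      ∀ lam : ℝ, lam = Real.log (δ ^ (-(1 / (4 * (D.d + D.ξ))))) →
        lam₁ < lam ∧
        ∃ pmin : D.H0 D.kMeas, IsUniqueMinOn (cost V F lam) (Metric.closedBall 0 R) pmin ∧
        ‖(qs - trunc Fs) - (pmin : D.Jet 2 D.kMeas)‖ ≤ C₂ * δ ^ (1 / 4 : ℝ) ∧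
        -- reconstruction of the coefficient at a wave number `k`
        (∀ (ρ : Rule), ∀ k ∈ Set.Icc D.kmin D.kmax, ∀ cs : D.Inner → ℝ → ℂ,
          (∀ i, ∀ᵐ z ∂D.zMeas, cs i z = coeff Vs qs k i z ρ) →
          l2h (fun i z => cs i z - coeff V (pmin + trunc F) k i z ρ)
            ≤ ENNReal.ofReal (C₂ * δ ^ (1 / 4 : ℝ))) ∧
        -- the gradient projection method
        ∀ γ ∈ Set.Ioo 0 (γ₀ lam), ∀ p : ℕ → D.H0 D.kMeas, ‖p 0‖ < R →
          (∀ n, IsProjection (Metric.closedBall 0 R) (p n - γ • G lam (p n)) (p (n + 1))) →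
          ∀ n : ℕ, 1 ≤ n →
            ‖pmin - p n‖ ≤ θ lam γ ^ n * ‖pmin - p 0‖ ∧
            ‖(qs - trunc Fs) - (p n : D.Jet 2 D.kMeas)‖
              ≤ C₂ * δ ^ (1 / 4 : ℝ) + θ lam γ ^ n * ‖pmin - p 0‖ ∧
            ∀ (ρ : Rule), ∀ k ∈ Set.Icc D.kmin D.kmax, ∀ cs : D.Inner → ℝ → ℂ,
              (∀ i, ∀ᵐ z ∂D.zMeas, cs i z = coeff Vs qs k i z ρ) →
              l2h (fun i z => cs i z - coeff V (p n + trunc F) k i z ρ)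
                ≤ ENNReal.ofReal (C₂ * δ ^ (1 / 4 : ℝ)
                  + C₂ * (θ lam γ ^ n * ‖pmin - p 0‖)) := by
  obtain ⟨lam₁, C₁, C₂, γ₀, θ, hlam₁, hC₁, hC₂, hγ₀, hθ, h⟩ := theorem7p6_general D R A B hR
  refine ⟨lam₁, C₁, C₂, γ₀, θ, hlam₁, hC₁, hC₂, hγ₀, hθ, ?_⟩
  intro δ hδ ψ₀s ψ₁s Vs Qs hVs hQs bQs hB φ₀s φ₁s qs Fs hqs hFs bFs hA hps ψ₀ ψ₁ Q hQ _ hQδ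
    φ₀ φ₁ F hF _ hFδ
  obtain ⟨W, hW, h⟩ := h δ hδ Vs Qs hVs.mem (sub_mem_H0 hVs.mem hQs hVs.bc bQs) hVs.eq hB qs
    (trunc Fs) hqs.mem (sub_mem_H0 hqs.mem (trunc_mem hFs) hqs.bc bFs) hqs.eq
    ((norm_trunc_le Fs).trans hA) hps Q hQ hQδ (trunc F) (trunc_mem hF)
    (by rw [trunc_sub]; exact (norm_trunc_le _).trans_lt hFδ)
  refine ⟨W, hW, fun V hV => ?_⟩
  obtain ⟨G, hG, hconv, h⟩ := h V hV
  refine ⟨G, hG, hconv, fun lam hlam => ?_⟩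
  obtain ⟨hlam', pmin, hmin, herr, hcoeff, h⟩ := h lam hlam
  exact ⟨hlam', pmin, hmin, herr, hcoeff, fun γ hγ p hp0 hp n _ => h γ hγ p hp0 hp n⟩
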